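/- Let $T>0$, $\omega=2\pi/T$, and let $A:\mathbb{R}\to\mathbb{R}^{n\times n}$ be $T$-periodic with $A\in L^2([0,T])$. For a $T$-periodic matrix function $M\in L^2([0,T])$ put $M_k=\frac1T\int_0^T M(\tau)e^{-i\omega k\tau}\,d\tau$ $(k\in\mathbb{Z})$, and let $\mathcal{T}(M)=(M_{k-l})_{k,l\in\mathbb{Z}}$ be the associated doubly infinite block Toeplitz matrix. Put $\mathcal{A}=\mathcal{T}(A)$ and $\mathcal{N}=\mathrm{diag}(i\omega k\,\mathrm{Id}_n,\ k\in\mathbb{Z})$. Then the following are equivalent. 1. The system $\dot x=A(t)x$ (solutions in the sense of Carathéodory) is globally asymptotically stable: for every initial time $t_0$ the origin is Lyapunov stable and every solution tends to $0$ as $t\to+\infty$. 2. For every $T$-periodic $Q:\mathbb{R}\to\mathbb{R}^{n\times n}$ with $Q\in L^\infty([0,T])$ and $Q(t)$ symmetric positive definite for almost every $t$, the harmonic algebraic Lyapunov equation $$\mathcal{P}(\mathcal{A}-\mathcal{N})+(\mathcal{A}-\mathcal{N})^*\mathcal{P}+\mathcal{Q}=0,\qquad \mathcal{Q}=\mathcal{T}(Q),$$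 has exactly one Hermitian positive definite solution $\mathcal{P}$. Here $\mathcal{P}$ ranges over the doubly infinite block matrices $(\mathcal{P}_{kl})_{k,l\in\mathbb{Z}}$ with blocks in $\mathbb{C}^{n\times n}$ whose columns are uniformly square summable, $\sup_l\sum_k\|\mathcal{P}_{kl}\|^2<\infty$ (this includes all bounded operators on $\ell^2(\mathbb{Z},\mathbb{C}^n)$ and all $\mathcal{T}(P)$ with $P\in L^2([0,T])$); the equation is understood entrywise, all series being absolutely convergent; and $\mathcal{P}$ is called positive definite if $\mathrm{Re}\,(X^*\mathcal{P}X)>0$ for every nonzero $X\in\ell^2(\mathbb{Z},\mathbb{C}^n)$ with $\mathcal{P}X\in\ell^2(\mathbb{Z},\mathbb{C}^n)$. -/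

import Mathlib

open MeasureTheory

namespace HarmonicLyapunov

noncomputable section

/-- `x` is a Carathéodory solution on `[t₀, ∞)` of the linear system `x' = A(t) x`:
it is continuous and satisfies the integral equation. -/
def IsSolution {n : ℕ} (A : ℝ → Matrix (Fin n) (Fin n) ℝ) (t₀ : ℝ) (x : ℝ → Fin n → ℝ) : Prop :=
  ContinuousOn x (Set.Ici t₀) ∧
    ∀ t, t₀ ≤ t → x t = x t₀ + ∫ s in t₀..t, (A s).mulVec (x s)

/-- Global asymptotic stability of the origin for `x' = A(t) x`: for every initial time the origin
is Lyapunov stable, and every solution tends to the origin. -/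
def GloballyAsymptoticallyStable {n : ℕ} (A : ℝ → Matrix (Fin n) (Fin n) ℝ) : Prop :=
  ∀ t₀ : ℝ,
    (∀ ε > 0, ∃ δ > 0, ∀ x, IsSolution A t₀ x → ‖x t₀‖ < δ → ∀ t, t₀ ≤ t → ‖x t‖ < ε) ∧
    (∀ x, IsSolution A t₀ x → Filter.Tendsto x Filter.atTop (nhds 0))

/-- Doubly infinite block matrices with blocks of size `n × n`; the entry at `(k, i)`, `(l, j)` is
the entry `(i, j)` of the block `(k, l)`. -/
abbrev BlockMatrix (n : ℕ) : Type := Matrix (ℤ × Fin n) (ℤ × Fin n) ℂ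

/-- Product of doubly infinite block matrices. -/
def blockMul {n : ℕ} (X Y : BlockMatrix n) : BlockMatrix n :=
  Matrix.of fun p q => ∑' r, X p r * Y r q

/-- Action of a doubly infinite block matrix on a sequence of vectors of `ℂⁿ`. -/
def blockMulVec {n : ℕ} (X : BlockMatrix n) (v : ℤ × Fin n → ℂ) : ℤ × Fin n → ℂ :=
  fun p => ∑' q, X p q * v q

/-- The `k`-th phasor `(1/T) ∫₀ᵀ f(τ) exp(-i ω k τ) dτ`, `ω = 2π/T`, of a `T`-periodic function
`f`. By periodicity every window `[t - T, t]` gives the same value. -/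
def phasor (T : ℝ) (f : ℝ → ℝ) (k : ℤ) : ℂ :=
  (1 / T : ℂ) * ∫ τ in (0 : ℝ)..T,
    (f τ : ℂ) * Complex.exp (-(Complex.I * (2 * Real.pi / T : ℂ) * k * τ))

/-- The block Toeplitz matrix of a `T`-periodic matrix function `M`: its block `(k, l)` is the
phasor of `M` of index `k - l`. -/
def blockToeplitz {n : ℕ} (T : ℝ) (M : ℝ → Matrix (Fin n) (Fin n) ℝ) : BlockMatrix n :=
  Matrix.of fun p q => phasor T (fun t => M t p.2 q.2) (p.1 - q.1)

/-- The block diagonal matrix `diag(i ω k Id, k ∈ ℤ)`, `ω = 2π/T`. -/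
def harmonicN (n : ℕ) (T : ℝ) : BlockMatrix n :=
  Matrix.diagonal fun p => Complex.I * (2 * Real.pi / T : ℂ) * p.1

/-- The columns of `P` are square summable, with a common bound. For Hermitian `P` the same then
holds for the rows, so all the series in the Lyapunov equation converge absolutely. Every bounded
operator on `ℓ²` and every block Toeplitz matrix of a square integrable function has this
property. -/
def IsAdmissible {n : ℕ} (P : BlockMatrix n) : Prop :=
  ∃ C : ℝ, ∀ q, Summable (fun p => ‖P p q‖ ^ 2) ∧ ∑' p, ‖P p q‖ ^ 2 ≤ C

/-- Positive definiteness of `P` as a (possibly unbounded) operator on `ℓ²`: `X* P X > 0` for every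
nonzero `X ∈ ℓ²` such that `P X ∈ ℓ²`. If `P` is bounded, this concerns all nonzero `X ∈ ℓ²`. -/
def IsPosDef {n : ℕ} (P : BlockMatrix n) : Prop :=
  ∀ X : ℤ × Fin n → ℂ, X ≠ 0 → Memℓp X 2 → Memℓp (blockMulVec P X) 2 →
    0 < (∑' p, star (X p) * blockMulVec P X p).re

/-- The harmonic algebraic Lyapunov equation `P (𝒜 - N) + (𝒜 - N)* P + 𝒬 = 0`, where `𝒜` and `𝒬`
are the block Toeplitz matrices of `A` and `Q`. -/
def SolvesHarmonicLyapunov {n : ℕ} (T : ℝ) (A Q : ℝ → Matrix (Fin n) (Fin n) ℝ)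
    (P : BlockMatrix n) : Prop :=
  blockMul P (blockToeplitz T A - harmonicN n T)
    + blockMul (blockToeplitz T A - harmonicN n T).conjTranspose P
    + blockToeplitz T Q = 0

end

end HarmonicLyapunov

namespace HarmonicLyapunov

open scoped Matrix ComplexConjugate

/-! Fourier series turn the harmonic equation into a differential one. Multiplying block Toeplitz
matrices of square integrable functions corresponds to multiplying the functions pointwise, and `N`
enters the equation only through `iω(k - l)`, which is differentiation. For `𝒫 = 𝒯(P)` the harmonic
equation therefore says that `P` is a `T`-periodic absolutely continuous solution of `P' + PA + AᵀP
+ Q = 0` (`toeplitzC_solves_iff`).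

Solvability implies stability. Take `Q = 1`. Translating the block index carries solutions to
solutions, so by uniqueness the solution is translation invariant, hence Toeplitz. By Riesz–Fischer
it comes from a square integrable function, and `exists_isPrimitiveOn_of_fourierC` supplies an
absolutely continuous representative. Testing positivity of the operator on functions supported in
short intervals gives pointwise semidefiniteness. The quadratic form of the real part is then a
bounded nonnegative Lyapunov function with derivative `-|x|²`. Semidefiniteness is enough
(`globallyAsymptoticallyStable_of_lyapunov`), since the decrease over one period dominates `‖x‖²`.

Stability implies existence. Let `Φ` be the fundamental matrix and `M = Φ(T)`; stability gives `M^k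
→ 0`. Pulling the differential equation back by `Φ` leaves a pure integration, and periodicity
becomes the Stein equation `P₀ - MᵀP₀M = ∫ ΦᵀQΦ`, which is uniquely solvable. Positivity follows by
iterating `M`.

Stability implies uniqueness. The difference `D` of two solutions is a Hermitian matrix with
uniformly square summable rows; it need be neither bounded nor Toeplitz. Floquet's factorization `Φ
= Y exp(tR)` is used in the frequency domain: the columns `y_b` of `𝒯(Y)` satisfy `(𝒜 - N) y_b = ∑
(R - iωl) y`, a finite combination. They are in `ℓ¹` with `N y_b` in `ℓ²`, which is what makes the
double series converge absolutely (`sesqForm_add_conj_eq_zero`). The `n × n` blocks `E` of `(y_a, D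
y_b)` then satisfy `ER + R*E + iω(k - l)E = 0`. Exponentiating over a period removes the frequency
term and leaves `E = G*EG` with `G = exp(TR) = M`, so `E = 0`. Since `Y` is pointwise invertible,
`𝒯(Y)*` is injective on `ℓ²`, and applying this twice gives `D = 0` (`eq_zero_of_homogeneous`). -/

/-- On `[a, b]` the function `f` is absolutely continuous, being a primitive of the integrable
function `f'`. -/
structure IsPrimitiveOn {𝕜 : Type*} [RCLike 𝕜] (a b : ℝ) (f f' : ℝ → 𝕜) : Prop where
  le : a ≤ b
  integrable : IntervalIntegrable f' volume a b
  eq_integral : ∀ t ∈ Set.Icc a b, f t = f a + ∫ s in a..t, f' s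

/-! ### Calculus of absolutely continuous functions -/

section IntervalIntegral

variable {𝕜 : Type*} [RCLike 𝕜] {a b : ℝ} {f f' g g' : ℝ → 𝕜}

/-- Increments of the primitive are dominated by increments of the primitive of the norm, which
reduces the claim to real integrands. -/
theorem absolutelyContinuousOnInterval_integral (h : IntervalIntegrable f volume a b) :
    AbsolutelyContinuousOnInterval (fun x => ∫ v in a..x, f v) a b := by
  have H := (h.norm).absolutelyContinuousOnInterval_intervalIntegral (c := a) (by simp)
  refine squeeze_zero' ?_ ?_ H
  · exact Filter.Eventually.of_forall fun _ => Finset.sum_nonneg fun _ _ => dist_nonneg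
  rw [Filter.eventually_inf_principal]
  filter_upwards with E hE
  refine Finset.sum_le_sum fun i hi => ?_
  have h1 := hE.1 i hi
  have hint : ∀ x ∈ Set.uIcc a b, IntervalIntegrable f volume a x := fun x hx =>
    h.mono_set (Set.uIcc_subset_uIcc_left hx)
  rw [dist_eq_norm, Real.dist_eq,
    intervalIntegral.integral_interval_sub_left (hint _ h1.1) (hint _ h1.2),
    intervalIntegral.integral_interval_sub_left (hint _ h1.1).norm (hint _ h1.2).norm]
  exact intervalIntegral.norm_integral_le_abs_integral_norm

namespace IsPrimitiveOn

theorem congr_deriv (h : IsPrimitiveOn a b f f')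
    (hfg : ∀ᵐ t, t ∈ Set.Ioc a b → f' t = g' t) : IsPrimitiveOn a b f g' := by
  refine ⟨h.le, (intervalIntegrable_congr_ae (by
    rw [Set.uIoc_of_le h.le]; exact (ae_restrict_iff' measurableSet_Ioc).2 hfg)).1 h.integrable,
    fun t ht => ?_⟩
  rw [h.eq_integral t ht]
  congr 1
  refine intervalIntegral.integral_congr_ae ?_
  filter_upwards [hfg] with s hs hs'
  rw [Set.uIoc_of_le ht.1] at hs'
  exact hs ⟨hs'.1, hs'.2.trans ht.2⟩

theorem congr_fun (h : IsPrimitiveOn a b f f')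
    (hfg : ∀ t ∈ Set.Icc a b, g t = f t) : IsPrimitiveOn a b g f' := by
  refine ⟨h.le, h.integrable, fun t ht => ?_⟩
  rw [hfg t ht, hfg a ⟨le_rfl, h.le⟩, h.eq_integral t ht]

theorem continuousOn (h : IsPrimitiveOn a b f f') : ContinuousOn f (Set.Icc a b) := by
  have := (intervalIntegral.continuousOn_primitive_interval' h.integrable
    (Set.left_mem_uIcc)).const_add (f a)
  rw [Set.uIcc_of_le h.le] at this
  exact this.congr h.eq_integral

theorem integral_eq_sub (h : IsPrimitiveOn a b f f') :
    ∫ s in a..b, f' s = f b - f a := by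
  rw [h.eq_integral b ⟨h.le, le_rfl⟩]; ring

theorem mono_right {c : ℝ} (h : IsPrimitiveOn a b f f') (hac : a ≤ c) (hcb : c ≤ b) :
    IsPrimitiveOn a c f f' :=
  ⟨hac, h.integrable.mono_set (by
      rw [Set.uIcc_of_le hac, Set.uIcc_of_le (hac.trans hcb)]; exact Set.Icc_subset_Icc_right hcb),
    fun t ht => h.eq_integral t ⟨ht.1, ht.2.trans hcb⟩⟩

theorem mono_left {c : ℝ} (h : IsPrimitiveOn a b f f') (hac : a ≤ c) (hcb : c ≤ b) :
    IsPrimitiveOn c b f f' := by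
  have hsub : ∀ x ∈ Set.Icc a b, ∀ y ∈ Set.Icc a b, IntervalIntegrable f' volume x y :=
    fun x hx y hy => h.integrable.mono_set (by
      rw [Set.uIcc_of_le (hac.trans hcb)]; exact Set.uIcc_subset_Icc hx hy)
  have ha : a ∈ Set.Icc a b := ⟨le_rfl, hac.trans hcb⟩
  have hc : c ∈ Set.Icc a b := ⟨hac, hcb⟩
  refine ⟨hcb, hsub c hc b ⟨hac.trans hcb, le_rfl⟩, fun t ht => ?_⟩
  have ht' : t ∈ Set.Icc a b := ⟨hac.trans ht.1, ht.2⟩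
  rw [h.eq_integral t ht', h.eq_integral c hc,
    ← intervalIntegral.integral_add_adjacent_intervals (hsub a ha c hc) (hsub c hc t ht')]
  ring

theorem const (hab : a ≤ b) (c : 𝕜) : IsPrimitiveOn a b (fun _ => c) (fun _ => 0) :=
  ⟨hab, by simp, by simp⟩

theorem add (hf : IsPrimitiveOn a b f f') (hg : IsPrimitiveOn a b g g') :
    IsPrimitiveOn a b (fun t => f t + g t) (fun t => f' t + g' t) := by
  refine ⟨hf.le, hf.integrable.add hg.integrable, fun t ht => ?_⟩
  rw [intervalIntegral.integral_add (hf.mono_right ht.1 ht.2).integrable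
    (hg.mono_right ht.1 ht.2).integrable, hf.eq_integral t ht, hg.eq_integral t ht]
  ring

theorem const_mul (hf : IsPrimitiveOn a b f f') (c : 𝕜) :
    IsPrimitiveOn a b (fun t => c * f t) (fun t => c * f' t) := by
  refine ⟨hf.le, hf.integrable.const_mul c, fun t ht => ?_⟩
  rw [intervalIntegral.integral_const_mul, hf.eq_integral t ht]
  ring

theorem neg (hf : IsPrimitiveOn a b f f') :
    IsPrimitiveOn a b (fun t => - f t) (fun t => - f' t) := by
  simpa using hf.const_mul (-1)

theorem sub (hf : IsPrimitiveOn a b f f') (hg : IsPrimitiveOn a b g g') :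
    IsPrimitiveOn a b (fun t => f t - g t) (fun t => f' t - g' t) := by
  simpa [sub_eq_add_neg] using hf.add hg.neg

theorem sum {ι : Type*} (hab : a ≤ b) (s : Finset ι) {F F' : ι → ℝ → 𝕜}
    (h : ∀ i ∈ s, IsPrimitiveOn a b (F i) (F' i)) :
    IsPrimitiveOn a b (fun t => ∑ i ∈ s, F i t) (fun t => ∑ i ∈ s, F' i t) := by
  classical
  induction s using Finset.induction_on with
  | empty => simpa using const hab (0 : 𝕜)
  | insert i s hi ih =>
    simp only [Finset.sum_insert hi]
    exact (h i (Finset.mem_insert_self i s)).add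
      (ih fun j hj => h j (Finset.mem_insert_of_mem hj))

theorem ofReal {f f' : ℝ → ℝ} (h : IsPrimitiveOn a b f f') :
    IsPrimitiveOn a b (fun t => (f t : ℂ)) (fun t => (f' t : ℂ)) := by
  refine ⟨h.le, ⟨h.integrable.1.ofReal, h.integrable.2.ofReal⟩, fun t ht => ?_⟩
  rw [intervalIntegral.integral_ofReal, h.eq_integral t ht]
  push_cast; rfl

theorem re {f f' : ℝ → ℂ} (h : IsPrimitiveOn a b f f') :
    IsPrimitiveOn a b (fun t => (f t).re) (fun t => (f' t).re) := by
  have H : ∀ {x y : ℝ}, IntervalIntegrable f' volume x y →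
      IntervalIntegrable (fun t => (f' t).re) volume x y := fun h => ⟨h.1.re, h.2.re⟩
  refine ⟨h.le, H h.integrable, fun t ht => ?_⟩
  have := Complex.reCLM.intervalIntegral_comp_comm (h.mono_right ht.1 ht.2).integrable
  simp only [Complex.reCLM_apply] at this
  rw [h.eq_integral t ht, Complex.add_re, this]

/-- The product rule for absolutely continuous functions. -/
theorem mul (hf : IsPrimitiveOn a b f f') (hg : IsPrimitiveOn a b g g') :
    IsPrimitiveOn a b (fun t => f t * g t) (fun t => f' t * g t + f t * g' t) := by
  have hab := hf.le
  set F : ℝ → 𝕜 := fun t => f a + ∫ s in a..t, f' s with hF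
  set G : ℝ → 𝕜 := fun t => g a + ∫ s in a..t, g' s with hG
  have hfF : ∀ t ∈ Set.Icc a b, f t = F t := hf.eq_integral
  have hgG : ∀ t ∈ Set.Icc a b, g t = G t := hg.eq_integral
  have cont : ∀ c : 𝕜, AbsolutelyContinuousOnInterval (fun _ : ℝ => c) a b := fun c =>
    (LipschitzWith.const c).lipschitzOnWith.absolutelyContinuousOnInterval
  have hFac : AbsolutelyContinuousOnInterval F a b :=
    (cont (f a)).fun_add (absolutelyContinuousOnInterval_integral hf.integrable)
  have hGac : AbsolutelyContinuousOnInterval G a b :=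
    (cont (g a)).fun_add (absolutelyContinuousOnInterval_integral hg.integrable)
  have hint : IntervalIntegrable (fun t => f' t * G t + F t * g' t) volume a b :=
    (hf.integrable.mul_continuousOn hGac.continuousOn).add
      (hg.integrable.continuousOn_mul hFac.continuousOn)
  have hIoc : ∀ t ∈ Set.Ioc a b, f' t * G t + F t * g' t = f' t * g t + f t * g' t :=
    fun t ht => by rw [hfF t ⟨ht.1.le, ht.2⟩, hgG t ⟨ht.1.le, ht.2⟩]
  -- The difference between `FG` and the primitive of the expected derivative is absolutely
  -- continuous with derivative zero almost everywhere, hence constant.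
  have hac : AbsolutelyContinuousOnInterval
      (fun t => F t * G t - ∫ s in a..t, (f' s * G s + F s * g' s)) a b :=
    (hFac.fun_smul hGac).fun_sub (absolutelyContinuousOnInterval_integral hint)
  obtain ⟨C, hC⟩ := hac.const_of_ae_hasDerivAt_zero (by
    filter_upwards [hf.integrable.ae_hasDerivAt_integral, hg.integrable.ae_hasDerivAt_integral,
      hint.ae_hasDerivAt_integral] with x h1 h2 h3 hx
    have h1 := (h1 hx a (by simp)).const_add (f a)
    have h2 := (h2 hx a (by simp)).const_add (g a)
    have h3 := h3 hx a (by simp)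
    have h4 : HasDerivAt (fun t => F t * G t - ∫ s in a..t, (f' s * G s + F s * g' s))
        (f' x * G x + F x * g' x - (f' x * G x + F x * g' x)) x := (h1.mul h2).sub h3
    rwa [sub_self] at h4)
  have key : IsPrimitiveOn a b (fun t => F t * G t) (fun t => f' t * G t + F t * g' t) := by
    refine ⟨hab, hint, fun t ht => ?_⟩
    have h1 := hC t (by rwa [Set.uIcc_of_le hab])
    have h2 := hC a (by simp)
    simp only [intervalIntegral.integral_same, sub_zero] at h2
    rw [h2, ← h1]; ring
  exact (key.congr_deriv (Filter.Eventually.of_forall hIoc)).congr_fun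
    fun t ht => by rw [hfF t ht, hgG t ht]

theorem of_hasDerivAt (hab : a ≤ b) (h : ∀ t, HasDerivAt f (f' t) t) (hf' : Continuous f') :
    IsPrimitiveOn a b f f' := by
  refine ⟨hab, hf'.intervalIntegrable _ _, fun t _ => ?_⟩
  rw [intervalIntegral.integral_eq_sub_of_hasDerivAt (fun x _ => h x)
    (hf'.intervalIntegrable _ _)]
  ring

theorem of_integral (hab : a ≤ b) (hf' : IntervalIntegrable f' volume a b) (c : 𝕜)  :
    IsPrimitiveOn a b (fun t => c + ∫ s in a..t, f' s) f' :=
  ⟨hab, hf', by simp⟩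

theorem eq_of_deriv_eq_zero (h : IsPrimitiveOn a b f f') (h0 : ∀ t ∈ Set.Ioc a b, f' t = 0) :
    ∀ t ∈ Set.Icc a b, f t = f a := by
  intro t ht
  have := (h.congr_deriv (g' := fun _ => 0) (Filter.Eventually.of_forall h0)).eq_integral t ht
  simpa using this

end IsPrimitiveOn
end IntervalIntegral

theorem intervalIntegrable_fun_sum {E ι : Type*} [NormedAddCommGroup E] {a b : ℝ}
    {s : Finset ι} {f : ι → ℝ → E} (h : ∀ i ∈ s, IntervalIntegrable (f i) volume a b) :
    IntervalIntegrable (fun t => ∑ i ∈ s, f i t) volume a b :=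
  ⟨integrable_finsetSum s fun i hi => (h i hi).1, integrable_finsetSum s fun i hi => (h i hi).2⟩

/-! ### Carathéodory solutions and fundamental matrices of linear systems -/

section LinearODE

variable {n : ℕ} {A : ℝ → Matrix (Fin n) (Fin n) ℝ}

/-- All entries of `A` are integrable on bounded intervals. -/
def LocIntegrable (A : ℝ → Matrix (Fin n) (Fin n) ℝ) : Prop :=
  ∀ i j a b, IntervalIntegrable (fun t => A t i j) volume a b

/-- The sum of the absolute values of the entries. -/
noncomputable def entrySum (A : ℝ → Matrix (Fin n) (Fin n) ℝ) (t : ℝ) : ℝ := ∑ i, ∑ j, |A t i j|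

theorem entrySum_nonneg (t : ℝ) : 0 ≤ entrySum A t :=
  Finset.sum_nonneg fun _ _ => Finset.sum_nonneg fun _ _ => abs_nonneg _

theorem LocIntegrable.entrySum (hA : LocIntegrable A) (a b : ℝ) :
    IntervalIntegrable (entrySum A) volume a b :=
  intervalIntegrable_fun_sum fun i _ => intervalIntegrable_fun_sum fun j _ => (hA i j a b).abs

theorem abs_mulVec_le (t : ℝ) (v : Fin n → ℝ) {c : ℝ} (hv : ∀ j, |v j| ≤ c) (i : Fin n) :
    |(A t *ᵥ v) i| ≤ entrySum A t * c := by
  calc |(A t *ᵥ v) i| ≤ ∑ j, |A t i j * v j| := Finset.abs_sum_le_sum_abs (fun j => A t i j * v j) Finset.univ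
    _ ≤ ∑ j, |A t i j| * c := Finset.sum_le_sum fun j _ => by
        rw [abs_mul]; exact mul_le_mul_of_nonneg_left (hv j) (abs_nonneg _)
    _ = (∑ j, |A t i j|) * c := by rw [Finset.sum_mul]
    _ ≤ entrySum A t * c := by
        rcases isEmpty_or_nonempty (Fin n) with h | h
        · exact h.elim i
        · exact mul_le_mul_of_nonneg_right
            (Finset.single_le_sum (f := fun i => ∑ j, |A t i j|)
              (fun _ _ => Finset.sum_nonneg fun _ _ => abs_nonneg _) (Finset.mem_univ i))
            ((abs_nonneg _).trans (hv i))

theorem LocIntegrable.mulVec (hA : LocIntegrable A) {a b : ℝ} {x : ℝ → Fin n → ℝ}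
    (hx : ∀ j, ContinuousOn (fun t => x t j) (Set.uIcc a b)) (i : Fin n) :
    IntervalIntegrable (fun t => (A t *ᵥ x t) i) volume a b :=
  intervalIntegrable_fun_sum (s := Finset.univ) (f := fun j t => A t i j * x t j)
    fun j _ => (hA i j a b).mul_continuousOn (hx j)

theorem isPrimitiveOn_pow {a b : ℝ} {f f' : ℝ → ℝ} (h : IsPrimitiveOn a b f f') (k : ℕ) :
    IsPrimitiveOn a b (fun t => f t ^ (k + 1)) (fun t => (k + 1) * (f' t * f t ^ k)) := by
  induction k with
  | zero => simpa using h
  | succ k ih =>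
    have h1 := ih.mul h
    simp only [← pow_succ] at h1
    convert h1 using 2
    push_cast; ring

/-- The terms of the Peano–Baker series of the solution starting at time `s` in `v`. -/
noncomputable def peanoBaker (A : ℝ → Matrix (Fin n) (Fin n) ℝ) (s : ℝ) (v : Fin n → ℝ) :
    ℕ → ℝ → Fin n → ℝ
  | 0, _, i => v i
  | k + 1, t, i => ∫ r in s..t, (A r *ᵥ peanoBaker A s v k r) i

theorem isPrimitiveOn_peanoBaker (hA : LocIntegrable A) {s b : ℝ} (hb : s ≤ b) (v : Fin n → ℝ)
    (k : ℕ) (i : Fin n) : IsPrimitiveOn s b (fun t => peanoBaker A s v (k + 1) t i)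
      (fun t => (A t *ᵥ peanoBaker A s v k t) i) := by
  induction k generalizing i with
  | zero =>
    simpa [peanoBaker] using IsPrimitiveOn.of_integral hb
      (hA.mulVec (x := peanoBaker A s v 0) (fun j => continuousOn_const) i) 0
  | succ k ih =>
    have := IsPrimitiveOn.of_integral hb (hA.mulVec (x := peanoBaker A s v (k + 1))
      (fun j => by rw [Set.uIcc_of_le hb]; exact (ih j).continuousOn) i) 0
    simpa only [zero_add, peanoBaker] using this

theorem continuousOn_peanoBaker (hA : LocIntegrable A) {s b : ℝ} (hb : s ≤ b) (v : Fin n → ℝ)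
    (k : ℕ) (i : Fin n) : ContinuousOn (fun t => peanoBaker A s v k t i) (Set.Icc s b) := by
  cases k with
  | zero => exact continuousOn_const
  | succ k => exact (isPrimitiveOn_peanoBaker hA hb v k i).continuousOn

theorem integral_entrySum_nonneg {s t : ℝ} (ht : s ≤ t) : 0 ≤ ∫ r in s..t, entrySum A r :=
  intervalIntegral.integral_nonneg ht fun r _ => entrySum_nonneg r

theorem integral_entrySum_mono (hA : LocIntegrable A) (s : ℝ) {t b : ℝ} (hb : t ≤ b) :
    ∫ r in s..t, entrySum A r ≤ ∫ r in s..b, entrySum A r := by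
  rw [← intervalIntegral.integral_add_adjacent_intervals (hA.entrySum s t) (hA.entrySum t b)]
  linarith [integral_entrySum_nonneg (A := A) hb]

/-- Induction on `k`: with `a` = `entrySum A`, the integrand `a (∫ a)^k / k!` is exactly the
derivative of `(∫ a)^(k+1) / (k+1)!`. -/
theorem abs_peanoBaker_le (hA : LocIntegrable A) {s t : ℝ} (ht : s ≤ t) (v : Fin n → ℝ)
    (k : ℕ) (i : Fin n) : |peanoBaker A s v k t i| ≤
      ‖v‖ * ((∫ r in s..t, entrySum A r) ^ k / k.factorial) := by
  induction k generalizing i t with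
  | zero => simpa [peanoBaker] using norm_le_pi_norm v i
  | succ k ih =>
    have hprim := (IsPrimitiveOn.of_integral ht (hA.entrySum s t) 0)
    simp only [zero_add] at hprim
    have hpow := (isPrimitiveOn_pow hprim k).const_mul (‖v‖ / (k + 1).factorial)
    have hint := hpow.integral_eq_sub
    simp only [intervalIntegral.integral_same, ne_eq, Nat.add_eq_zero_iff, one_ne_zero, and_false,
      not_false_eq_true, zero_pow, mul_zero, sub_zero] at hint
    have hle : |∫ r in s..t, (A r *ᵥ peanoBaker A s v k r) i| ≤ ∫ r in s..t,
        ‖v‖ / (k + 1).factorial * ((k + 1) * (entrySum A r * (∫ u in s..r, entrySum A u) ^ k)) := by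
      rw [← Real.norm_eq_abs]
      refine intervalIntegral.norm_integral_le_of_norm_le ht ?_ hpow.integrable
      refine Filter.Eventually.of_forall fun r hr => ?_
      refine (abs_mulVec_le r _ (fun j => ih hr.1.le j) i).trans_eq ?_
      rw [Nat.factorial_succ]; push_cast
      have : (k.factorial : ℝ) ≠ 0 := by positivity
      field_simp
    refine (show |peanoBaker A s v (k + 1) t i| ≤ _ from hle).trans_eq ?_
    rw [hint]; ring

/-- Existence of Carathéodory solutions of a linear system, with the Gronwall bound. -/
theorem exists_solution (hA : LocIntegrable A) (s : ℝ) (v : Fin n → ℝ) :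
    ∃ x : ℝ → Fin n → ℝ, x s = v ∧
      (∀ b, s ≤ b → ∀ i, IsPrimitiveOn s b (fun t => x t i) (fun t => (A t *ᵥ x t) i)) ∧
      ∀ t, s ≤ t → ∀ i, |x t i| ≤ ‖v‖ * Real.exp (∫ r in s..t, entrySum A r) := by
  have hexp : ∀ t, HasSum (fun k : ℕ => ‖v‖ * ((∫ r in s..t, entrySum A r) ^ k / k.factorial))
      (‖v‖ * Real.exp (∫ r in s..t, entrySum A r)) := fun t => by
    have := NormedSpace.expSeries_div_hasSum_exp (𝔸 := ℝ) (∫ r in s..t, entrySum A r)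
    rw [← Real.exp_eq_exp_ℝ] at this
    exact this.mul_left _
  have hsum : ∀ t, s ≤ t → ∀ i, Summable fun k => peanoBaker A s v k t i := fun t ht i =>
    Summable.of_norm_bounded (hexp t).summable fun k => abs_peanoBaker_le hA ht v k i
  have hbd : ∀ {b}, s ≤ b → ∀ t ∈ Set.Icc s b, ∀ k i, |peanoBaker A s v k t i| ≤
      ‖v‖ * ((∫ r in s..b, entrySum A r) ^ k / k.factorial) := fun {b} hb t ht k i => by
    refine (abs_peanoBaker_le hA ht.1 v k i).trans ?_
    have h0 := integral_entrySum_nonneg (A := A) ht.1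
    have h1 := integral_entrySum_mono hA s ht.2
    gcongr
  have hs : ∀ i, ∑' k, peanoBaker A s v k s i = v i := fun i => by
    rw [tsum_eq_single 0]
    · rfl
    · intro k hk
      obtain ⟨k, rfl⟩ := Nat.exists_eq_succ_of_ne_zero hk
      simp [peanoBaker]
  refine ⟨fun t i => ∑' k, peanoBaker A s v k t i, ?_, fun b hb => ?_, fun t ht i => ?_⟩
  · exact funext hs
  · have hcont : ∀ i, ContinuousOn (fun t => ∑' k, peanoBaker A s v k t i) (Set.Icc s b) :=
      fun i => continuousOn_tsum (fun k => continuousOn_peanoBaker hA hb v k i)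
        (hexp b).summable fun k t ht => hbd hb t ht k i
    intro i
    refine ⟨hb, hA.mulVec (x := fun t i => ∑' k, peanoBaker A s v k t i)
      (fun j => by rw [Set.uIcc_of_le hb]; exact hcont j) i, fun t ht => ?_⟩
    -- The factorial bound is uniform on the interval, so dominated convergence allows the series to
    -- be integrated term by term.
    have key : HasSum (fun k => ∫ r in s..t, (A r *ᵥ peanoBaker A s v k r) i)
        (∫ r in s..t, (A r *ᵥ fun i => ∑' k, peanoBaker A s v k r i) i) := by
      refine intervalIntegral.hasSum_integral_of_dominated_convergence
        (fun k r => entrySum A r * (‖v‖ * ((∫ r in s..t, entrySum A r) ^ k / k.factorial)))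
        (fun k => ?_) (fun k => ?_) ?_ ?_ ?_
      · exact (isPrimitiveOn_peanoBaker hA ht.1 v k i).integrable.aestronglyMeasurable_restrict_uIoc
      · refine Filter.Eventually.of_forall fun r hr => ?_
        rw [Set.uIoc_of_le ht.1] at hr
        exact abs_mulVec_le r _ (fun j => hbd ht.1 r ⟨hr.1.le, hr.2⟩ k j) i
      · exact Filter.Eventually.of_forall fun r _ => (hexp t).summable.mul_left _
      · simp only [tsum_mul_left, (hexp t).tsum_eq]
        simpa only [← tsum_mul_left, (hexp t).tsum_eq] using
          (hA.entrySum s t).mul_const (‖v‖ * Real.exp (∫ r in s..t, entrySum A r))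
      · refine Filter.Eventually.of_forall fun r hr => ?_
        rw [Set.uIoc_of_le ht.1] at hr
        simp only [Matrix.mulVec, dotProduct]
        exact hasSum_sum fun j _ => ((hsum r hr.1.le j).hasSum).mul_left _
    show ∑' k, peanoBaker A s v k t i = ∑' k, peanoBaker A s v k s i + _
    rw [hs, (hsum t ht.1 i).tsum_eq_zero_add, ← key.tsum_eq]
    rfl
  · have h1 : ‖∑' k, peanoBaker A s v k t i‖ ≤ _ :=
      tsum_of_norm_bounded (hexp t) fun k => abs_peanoBaker_le hA ht v k i
    exact h1

/-- `Φ` is the fundamental matrix of `x' = A x` on `[s, ∞)` normalized at `s`, and `Ψ` is its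
inverse. -/
structure IsFundamental (A : ℝ → Matrix (Fin n) (Fin n) ℝ) (s : ℝ)
    (Φ Ψ : ℝ → Matrix (Fin n) (Fin n) ℝ) : Prop where
  init : Φ s = 1
  init_inv : Ψ s = 1
  deriv : ∀ b, s ≤ b → ∀ i j,
    IsPrimitiveOn s b (fun t => Φ t i j) (fun t => (A t * Φ t) i j)
  deriv_inv : ∀ b, s ≤ b → ∀ i j,
    IsPrimitiveOn s b (fun t => Ψ t i j) (fun t => -(Ψ t * A t) i j)

theorem isPrimitiveOn_mul_matrix {𝕜 : Type*} [RCLike 𝕜] {m : Type*} {l : Type*} {a b : ℝ} (hab : a ≤ b)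
    {F F' : ℝ → Matrix m (Fin n) 𝕜} {G G' : ℝ → Matrix (Fin n) l 𝕜}
    (hF : ∀ i j, IsPrimitiveOn a b (fun t => F t i j) (fun t => F' t i j))
    (hG : ∀ i j, IsPrimitiveOn a b (fun t => G t i j) (fun t => G' t i j)) (i : m) (j : l) :
    IsPrimitiveOn a b (fun t => (F t * G t) i j) (fun t => (F' t * G t + F t * G' t) i j) := by
  simp only [Matrix.mul_apply, Matrix.add_apply, ← Finset.sum_add_distrib]
  exact IsPrimitiveOn.sum hab _ fun k _ => (hF i k).mul (hG k j)

theorem isPrimitiveOn_mulVec {𝕜 : Type*} [RCLike 𝕜] {m : Type*} {a b : ℝ} (hab : a ≤ b)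
    {F F' : ℝ → Matrix m (Fin n) 𝕜} {x x' : ℝ → Fin n → 𝕜}
    (hF : ∀ i j, IsPrimitiveOn a b (fun t => F t i j) (fun t => F' t i j))
    (hx : ∀ i, IsPrimitiveOn a b (fun t => x t i) (fun t => x' t i)) (i : m) :
    IsPrimitiveOn a b (fun t => (F t *ᵥ x t) i) (fun t => (F' t *ᵥ x t + F t *ᵥ x' t) i) := by
  simp only [Matrix.mulVec, dotProduct, Pi.add_apply, ← Finset.sum_add_distrib]
  exact IsPrimitiveOn.sum hab _ fun k _ => (hF i k).mul (hx k)

namespace IsFundamental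

variable {s : ℝ} {Φ Ψ : ℝ → Matrix (Fin n) (Fin n) ℝ}

/-- The product rule gives `(ΨΦ)' = -ΨAΦ + ΨAΦ = 0`. -/
theorem inv_mul (h : IsFundamental A s Φ Ψ) {t : ℝ} (ht : s ≤ t) : Ψ t * Φ t = 1 := by
  ext i j
  have h1 := isPrimitiveOn_mul_matrix ht (F' := fun t => -(Ψ t * A t)) (G' := fun t => A t * Φ t)
    (h.deriv_inv t ht) (h.deriv t ht) i j
  have := h1.eq_of_deriv_eq_zero (fun r _ => by
    simp [Matrix.mul_assoc]) t ⟨ht, le_rfl⟩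
  simp only [h.init, h.init_inv, mul_one] at this
  exact this

theorem mul_inv (h : IsFundamental A s Φ Ψ) {t : ℝ} (ht : s ≤ t) : Φ t * Ψ t = 1 :=
  mul_eq_one_comm.1 (h.inv_mul ht)

/-- Uniqueness of solutions. -/
theorem eq_mulVec (h : IsFundamental A s Φ Ψ) {b : ℝ} {x : ℝ → Fin n → ℝ} (hb : s ≤ b)
    (hx : ∀ i, IsPrimitiveOn s b (fun t => x t i) (fun t => (A t *ᵥ x t) i)) :
    ∀ t ∈ Set.Icc s b, x t = Φ t *ᵥ x s := by
  intro t ht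
  -- Variation of constants: `Ψx` has derivative zero.
  have h1 : Ψ t *ᵥ x t = x s := by
    funext i
    have := (isPrimitiveOn_mulVec hb (F' := fun t => -(Ψ t * A t)) (x' := fun t => A t *ᵥ x t)
      (h.deriv_inv b hb) hx i).eq_of_deriv_eq_zero (fun r _ => by
        simp [Matrix.neg_mulVec]) t ht
    simp only [h.init_inv, Matrix.one_mulVec] at this
    exact this
  rw [← h1, Matrix.mulVec_mulVec, h.mul_inv ht.1, Matrix.one_mulVec]

end IsFundamental

theorem exists_isFundamental (hA : LocIntegrable A) (s : ℝ) :
    ∃ Φ Ψ, IsFundamental A s Φ Ψ ∧ ∀ t, s ≤ t → ∀ i j,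
      |Φ t i j| ≤ Real.exp (∫ r in s..t, entrySum A r) := by
  -- The rows of the inverse `Ψ` are solutions of the adjoint system `y' = -Aᵀ y`.
  have hA' : LocIntegrable fun t => -(A t)ᵀ := fun i j a b => (hA j i a b).neg
  choose x hx0 hx hxb using fun j => exists_solution hA s (Pi.single j (1 : ℝ))
  choose y hy0 hy _ using fun j => exists_solution hA' s (Pi.single j (1 : ℝ))
  refine ⟨fun t => Matrix.of fun i j => x j t i, fun t => Matrix.of fun i j => y i t j,
    ⟨?_, ?_, fun b hb i j => ?_, fun b hb i j => ?_⟩, fun t ht i j => ?_⟩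
  · ext i j
    simp [hx0, Matrix.one_apply, Pi.single_apply]
  · ext i j
    simp [hy0, Matrix.one_apply, Pi.single_apply, eq_comm]
  · exact hx j b hb i
  · refine (hy i b hb j).congr_deriv (Filter.Eventually.of_forall fun t _ => ?_)
    rw [Matrix.neg_mulVec, Pi.neg_apply, Matrix.mulVec_transpose]
    rfl
  · refine (hxb j t ht i).trans ?_
    rw [Pi.norm_single]
    simp

theorem IsSolution.isPrimitiveOn (hA : LocIntegrable A) {t₀ : ℝ} {x : ℝ → Fin n → ℝ}
    (hx : IsSolution A t₀ x) {b : ℝ} (hb : t₀ ≤ b) (i : Fin n) :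
    IsPrimitiveOn t₀ b (fun t => x t i) (fun t => (A t *ᵥ x t) i) := by
  have hc : ∀ t, t₀ ≤ t → ∀ j, ContinuousOn (fun t => x t j) (Set.uIcc t₀ t) := fun t ht j => by
    rw [Set.uIcc_of_le ht]
    exact ((continuous_apply j).comp_continuousOn hx.1).mono Set.Icc_subset_Ici_self
  refine ⟨hb, hA.mulVec (hc b hb) i, fun t ht => ?_⟩
  have hint : IntervalIntegrable (fun t => A t *ᵥ x t) volume t₀ t := by
    constructor
    · exact Integrable.of_eval fun i => (hA.mulVec (hc t ht.1) i).1
    · exact Integrable.of_eval fun i => (hA.mulVec (hc t ht.1) i).2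
  have := congrFun (hx.2 t ht.1) i
  rw [this, Pi.add_apply]
  congr 1
  exact ((ContinuousLinearMap.proj (R := ℝ) (φ := fun _ : Fin n => ℝ) i).intervalIntegral_comp_comm
    hint).symm

theorem isSolution_of_isPrimitiveOn {t₀ : ℝ} {x : ℝ → Fin n → ℝ}
    (hx : ∀ b, t₀ ≤ b → ∀ i, IsPrimitiveOn t₀ b (fun t => x t i) (fun t => (A t *ᵥ x t) i)) :
    IsSolution A t₀ x := by
  constructor
  · refine continuousOn_pi.2 fun i t ht => ?_
    have h1 := (hx (t + 1) (by linarith [Set.mem_Ici.1 ht]) i).continuousOn t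
      ⟨ht, by linarith⟩
    refine h1.mono_of_mem_nhdsWithin ?_
    rw [← Set.Ici_inter_Iic]
    exact Filter.inter_mem self_mem_nhdsWithin
      (mem_nhdsWithin_of_mem_nhds (Iic_mem_nhds (by linarith)))
  · intro t ht
    have hint : IntervalIntegrable (fun t => A t *ᵥ x t) volume t₀ t := by
      constructor
      · exact Integrable.of_eval fun i => (hx t ht i).integrable.1
      · exact Integrable.of_eval fun i => (hx t ht i).integrable.2
    funext i
    rw [(hx t ht i).eq_integral t ⟨ht, le_rfl⟩, Pi.add_apply]
    congr 1
    exact (ContinuousLinearMap.proj (R := ℝ) (φ := fun _ : Fin n => ℝ) i).intervalIntegral_comp_comm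
      hint

end LinearODE

/-! ### Fourier coefficients on one period: Parseval, Riesz–Fischer, convolution, derivatives -/

section Fourier

/-- The `k`-th Fourier coefficient of a complex function on `[0, T]`. -/
noncomputable def fourierC (T : ℝ) (f : ℝ → ℂ) (k : ℤ) : ℂ :=
  (1 / T : ℂ) * ∫ τ in (0 : ℝ)..T,
    f τ * Complex.exp (-(Complex.I * (2 * Real.pi / T : ℂ) * k * τ))

/-- The exponential `exp (i ω k t)`, `ω = 2π/T`. -/
noncomputable def wave (T : ℝ) (k : ℤ) (t : ℝ) : ℂ :=
  Complex.exp (Complex.I * (2 * Real.pi / T : ℂ) * k * t)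

variable {T : ℝ} {f g : ℝ → ℂ}

theorem fourierC_eq_wave (k : ℤ) :
    fourierC T f k = (1 / T : ℂ) * ∫ t in (0 : ℝ)..T, f t * wave T (-k) t := by
  simp [fourierC, wave]

theorem wave_add (k l : ℤ) (t : ℝ) : wave T (k + l) t = wave T k t * wave T l t := by
  rw [wave, wave, wave, ← Complex.exp_add]; congr 1; push_cast; ring

theorem conj_wave (k : ℤ) (t : ℝ) : conj (wave T k t) = wave T (-k) t := by
  rw [wave, wave, ← Complex.exp_conj]; congr 1
  simp only [map_mul, Complex.conj_I, map_div₀, Complex.conj_ofReal, map_ofNat, map_intCast]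
  push_cast; ring

theorem hasDerivAt_wave (k : ℤ) (t : ℝ) :
    HasDerivAt (wave T k) (Complex.I * (2 * Real.pi / T : ℂ) * k * wave T k t) t := by
  have h1 : HasDerivAt (fun t : ℝ => Complex.I * (2 * Real.pi / T : ℂ) * k * (t : ℂ))
      (Complex.I * (2 * Real.pi / T : ℂ) * k * 1) t :=
    (Complex.ofRealCLM.hasDerivAt (x := t)).const_mul _
  have := h1.cexp
  simp only [mul_one] at this
  rw [mul_comm]
  exact this

theorem continuous_wave (k : ℤ) : Continuous (wave T k) := by unfold wave; fun_prop

theorem wave_period (hT : 0 < T) (k : ℤ) : wave T k T = 1 := by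
  have hT' : (T : ℂ) ≠ 0 := by exact_mod_cast hT.ne'
  rw [wave, show Complex.I * (2 * Real.pi / T : ℂ) * k * T = k * (2 * Real.pi * Complex.I) by
    field_simp]
  exact Complex.exp_int_mul_two_pi_mul_I k

theorem wave_zero (k : ℤ) : wave T k 0 = 1 := by simp [wave]

/-- Square integrability on one period. -/
abbrev SqIntegrable (T : ℝ) (f : ℝ → ℂ) : Prop := MemLp f 2 (volume.restrict (Set.Ioc 0 T))

theorem fourierC_eq_fourierCoeff [hT : Fact (0 < T)] (F : AddCircle T → ℂ)
    (hF : ∀ t ∈ Set.Ioc 0 T, F (t : AddCircle T) = f t) (k : ℤ) :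
    fourierC T f k = fourierCoeff F k := by
  rw [fourierCoeff_eq_intervalIntegral F k 0, zero_add, fourierC, Complex.real_smul]
  push_cast
  congr 1
  refine intervalIntegral.integral_congr_ae (Filter.Eventually.of_forall fun t ht => ?_)
  rw [Set.uIoc_of_le hT.out.le] at ht
  rw [hF t ht, fourier_coe_apply, smul_eq_mul, mul_comm]
  congr 2
  push_cast; ring

/-- Parseval's identity. -/
theorem hasSum_conj_fourierC_mul (hT : 0 < T) (hf : SqIntegrable T f) (hg : SqIntegrable T g) :
    HasSum (fun k => conj (fourierC T f k) * fourierC T g k)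
      ((1 / T : ℂ) * ∫ t in (0 : ℝ)..T, conj (f t) * g t) := by
  have := Fact.mk hT
  have key : ∀ {f : ℝ → ℂ}, SqIntegrable T f → MemLp (AddCircle.liftIoc T 0 f) 2
      (@AddCircle.haarAddCircle T _) := fun {f} hf => by
    have hf' : MemLp f 2 (volume.restrict (Set.Ioc 0 (0 + T))) := by rwa [zero_add]
    exact hf'.memLp_liftIoc.haarAddCircle
  have coe : ∀ (f : ℝ → ℂ), ∀ t ∈ Set.Ioc 0 T, AddCircle.liftIoc T 0 f (t : AddCircle T) = f t :=
    fun f t ht => AddCircle.liftIoc_coe_apply (by rwa [zero_add])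
  have hco : ∀ {f : ℝ → ℂ} (hf : SqIntegrable T f) (k : ℤ),
      fourierBasis.repr (key hf).toLp k = fourierC T f k := fun {f} hf k => by
    rw [fourierBasis_repr, fourierCoeff_congr_ae (key hf).coeFn_toLp,
      fourierC_eq_fourierCoeff _ (coe f)]
  have hs := lp.hasSum_inner (𝕜 := ℂ) (fourierBasis.repr (key hf).toLp) (fourierBasis.repr (key hg).toLp)
  rw [LinearIsometryEquiv.inner_map_map, MeasureTheory.L2.inner_def] at hs
  have h2 : ∫ a, conj (((key hf).toLp : Lp ℂ 2 (@AddCircle.haarAddCircle T _)) a) *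
      ((key hg).toLp : Lp ℂ 2 (@AddCircle.haarAddCircle T _)) a ∂(@AddCircle.haarAddCircle T _) =
      ∫ a, conj (AddCircle.liftIoc T 0 f a) * AddCircle.liftIoc T 0 g a
        ∂(@AddCircle.haarAddCircle T _) := by
    refine integral_congr_ae ?_
    filter_upwards [(key hf).coeFn_toLp, (key hg).coeFn_toLp] with a ha hb
    rw [ha, hb]
  simp only [RCLike.inner_apply'] at hs
  have e : (fun k => conj (fourierC T f k) * fourierC T g k) = fun k =>
      conj (fourierBasis.repr (key hf).toLp k) * fourierBasis.repr (key hg).toLp k :=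
    funext fun k => by rw [hco hf, hco hg]
  suffices h3 : (1 / T : ℂ) * ∫ t in (0 : ℝ)..T, conj (f t) * g t = _ by
    rw [e, h3]; exact hs
  rw [h2, AddCircle.integral_haarAddCircle, ← AddCircle.intervalIntegral_preimage T 0, zero_add,
    Complex.real_smul]
  rw [one_div, Complex.ofReal_inv]
  congr 1
  refine intervalIntegral.integral_congr_ae (Filter.Eventually.of_forall fun t ht => ?_)
  rw [Set.uIoc_of_le hT.le] at ht
  simp only [coe _ t ht]

/-- The Riesz–Fischer theorem. -/
theorem exists_fourierC_eq (hT : 0 < T) {a : ℤ → ℂ} (ha : Summable fun k => ‖a k‖ ^ 2) :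
    ∃ f : ℝ → ℂ, Function.Periodic f T ∧ SqIntegrable T f ∧ ∀ k, fourierC T f k = a k := by
  have := Fact.mk hT
  have ha' : Memℓp a 2 := by
    refine memℓp_gen ?_
    simpa using ha
  set F := (fourierBasis (T := T)).repr.symm (⟨a, ha'⟩ : lp (fun _ : ℤ => ℂ) 2) with hF
  refine ⟨fun t => (F : AddCircle T → ℂ) (t : AddCircle T), fun t => by simp, ?_, fun k => ?_⟩
  · have h1 := (Lp.memLp F).of_haarAddCircle
    have h2 := h1.comp_measurePreserving (AddCircle.measurePreserving_mk T 0)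
    rwa [zero_add] at h2
  · rw [fourierC_eq_fourierCoeff (F : AddCircle T → ℂ) (fun _ _ => rfl), ← fourierBasis_repr, hF,
      LinearIsometryEquiv.apply_symm_apply]

theorem summable_norm_fourierC_sq (hT : 0 < T) (hf : SqIntegrable T f) :
    Summable fun k => ‖fourierC T f k‖ ^ 2 := by
  have := (hasSum_conj_fourierC_mul hT hf hf).summable.norm
  simpa [sq] using this

/-- A square integrable function without Fourier coefficients vanishes. -/
theorem ae_eq_zero_of_fourierC (hT : 0 < T) (hf : SqIntegrable T f) (h : ∀ k, fourierC T f k = 0) :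
    ∀ᵐ t, t ∈ Set.Ioc 0 T → f t = 0 := by
  have h1 := (hasSum_conj_fourierC_mul hT hf hf).tsum_eq
  simp only [h, map_zero, mul_zero, tsum_zero] at h1
  have hT' : (1 / T : ℂ) ≠ 0 := by simpa using hT.ne'
  have h2 := (mul_eq_zero.1 h1.symm).resolve_left hT'
  have h3 : ∀ t, conj (f t) * f t = ((‖f t‖ ^ 2 : ℝ) : ℂ) := fun t => by
    rw [Complex.conj_mul']; push_cast; rfl
  simp only [h3, intervalIntegral.integral_ofReal] at h2
  rw [intervalIntegral.integral_of_le hT.le] at h2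
  have h4 := (integral_eq_zero_iff_of_nonneg (μ := volume.restrict (Set.Ioc 0 T))
    (fun t => by positivity) (hf.integrable_norm_pow (by norm_num))).1 (by exact_mod_cast h2)
  rw [Filter.EventuallyEq, ae_restrict_iff' measurableSet_Ioc] at h4
  filter_upwards [h4] with t ht ht'
  simpa using ht ht'

theorem SqIntegrable.mul_bdd (hf : SqIntegrable T f)
    (hg : AEStronglyMeasurable g (volume.restrict (Set.Ioc 0 T))) {C : ℝ}
    (hC : ∀ t ∈ Set.Ioc 0 T, ‖g t‖ ≤ C) : SqIntegrable T (fun t => g t * f t) :=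
  hf.of_le_mul (c := C) (hg.mul hf.1) ((ae_restrict_iff' measurableSet_Ioc).2
    (Filter.Eventually.of_forall fun t ht => by
      rw [norm_mul]; exact mul_le_mul_of_nonneg_right (hC t ht) (norm_nonneg _)))

theorem sqIntegrable_of_bdd (hg : AEStronglyMeasurable g (volume.restrict (Set.Ioc 0 T))) {C : ℝ}
    (hC : ∀ t ∈ Set.Ioc 0 T, ‖g t‖ ≤ C) : SqIntegrable T g :=
  MemLp.of_bound hg C ((ae_restrict_iff' measurableSet_Ioc).2 (Filter.Eventually.of_forall hC))

theorem sqIntegrable_of_continuousOn (hg : ContinuousOn g (Set.Icc 0 T)) : SqIntegrable T g := by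
  obtain ⟨C, hC⟩ := isCompact_Icc.exists_bound_of_continuousOn hg
  exact sqIntegrable_of_bdd
    ((hg.mono Set.Ioc_subset_Icc_self).aestronglyMeasurable measurableSet_Ioc)
    fun t ht => hC t (Set.Ioc_subset_Icc_self ht)

theorem SqIntegrable.mul_continuousOn (hf : SqIntegrable T f) (hg : ContinuousOn g (Set.Icc 0 T)) :
    SqIntegrable T (fun t => g t * f t) := by
  obtain ⟨C, hC⟩ := isCompact_Icc.exists_bound_of_continuousOn hg
  exact hf.mul_bdd ((hg.mono Set.Ioc_subset_Icc_self).aestronglyMeasurable measurableSet_Ioc)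
    fun t ht => hC t (Set.Ioc_subset_Icc_self ht)

theorem SqIntegrable.mul_wave (hf : SqIntegrable T f) (k : ℤ) :
    SqIntegrable T (fun t => wave T k t * f t) :=
  hf.mul_continuousOn (continuous_wave k).continuousOn

theorem SqIntegrable.conj (hf : SqIntegrable T f) : SqIntegrable T (fun t => conj (f t)) :=
  hf.star

theorem SqIntegrable.integrable_mul (hT : 0 < T) (hf : SqIntegrable T f) (hg : SqIntegrable T g) :
    IntervalIntegrable (fun t => f t * g t) volume 0 T :=
  (intervalIntegrable_iff_integrableOn_Ioc_of_le hT.le).2 (MemLp.integrable_mul hf hg)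

theorem SqIntegrable.intervalIntegrable (hT : 0 < T) (hf : SqIntegrable T f) :
    IntervalIntegrable f volume 0 T :=
  (intervalIntegrable_iff_integrableOn_Ioc_of_le hT.le).2 (MemLp.integrable (by norm_num) hf)

theorem fourierC_wave_mul (m k : ℤ) :
    fourierC T (fun t => wave T m t * f t) k = fourierC T f (k - m) := by
  simp only [fourierC_eq_wave]
  congr 2 with t
  rw [show -(k - m) = m + -k by ring, wave_add]; ring

theorem conj_fourierC (k : ℤ) : conj (fourierC T f k) = fourierC T (fun t => conj (f t)) (-k) := by
  simp only [fourierC_eq_wave, map_mul]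
  congr 1
  · simp
  · rw [intervalIntegral.intervalIntegral_eq_integral_uIoc,
      intervalIntegral.intervalIntegral_eq_integral_uIoc]
    simp only [← integral_conj, map_mul, conj_wave, Complex.real_smul, Complex.conj_ofReal]

/-- The Fourier coefficients of a product are the convolution. -/
theorem hasSum_fourierC_mul (hT : 0 < T) (hf : SqIntegrable T f) (hg : SqIntegrable T g) (k : ℤ) :
    HasSum (fun m => fourierC T f (k - m) * fourierC T g m)
      (fourierC T (fun t => f t * g t) k) := by
  -- Parseval for the pair `wave k · conj f` and `g`: the conjugated `m`-th coefficient of the first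
  -- is the coefficient of `f` of index `k - m`.
  have h := hasSum_conj_fourierC_mul hT (hf.conj.mul_wave k) hg
  convert h using 1
  · funext m
    rw [fourierC_wave_mul, conj_fourierC]
    simp
  · rw [fourierC_eq_wave]
    congr 2 with t
    rw [map_mul, conj_wave, Complex.conj_conj]; ring

theorem fourierC_add (hf : IntervalIntegrable f volume 0 T) (hg : IntervalIntegrable g volume 0 T)
    (k : ℤ) : fourierC T (fun t => f t + g t) k = fourierC T f k + fourierC T g k := by
  simp only [fourierC_eq_wave, add_mul]
  rw [intervalIntegral.integral_add (hf.mul_continuousOn (continuous_wave _).continuousOn)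
    (hg.mul_continuousOn (continuous_wave _).continuousOn), mul_add]

theorem fourierC_const_mul (c : ℂ) (k : ℤ) :
    fourierC T (fun t => c * f t) k = c * fourierC T f k := by
  simp only [fourierC_eq_wave, mul_assoc, intervalIntegral.integral_const_mul]
  ring

theorem fourierC_neg (k : ℤ) : fourierC T (fun t => - f t) k = - fourierC T f k := by
  simpa using fourierC_const_mul (T := T) (f := f) (-1) k

theorem fourierC_sum {ι : Type*} (s : Finset ι) {F : ι → ℝ → ℂ}
    (hF : ∀ i ∈ s, IntervalIntegrable (F i) volume 0 T) (k : ℤ) :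
    fourierC T (fun t => ∑ i ∈ s, F i t) k = ∑ i ∈ s, fourierC T (F i) k := by
  simp only [fourierC_eq_wave, Finset.sum_mul]
  rw [intervalIntegral.integral_finsetSum fun i hi =>
    (hF i hi).mul_continuousOn (continuous_wave _).continuousOn, Finset.mul_sum]

theorem fourierC_congr (hT : 0 < T) (h : ∀ᵐ t, t ∈ Set.Ioc 0 T → f t = g t) (k : ℤ) :
    fourierC T f k = fourierC T g k := by
  unfold fourierC
  congr 1
  refine intervalIntegral.integral_congr_ae ?_
  filter_upwards [h] with t ht ht'
  rw [Set.uIoc_of_le hT.le] at ht'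
  rw [ht ht']

/-- Fourier coefficients of the derivative of an absolutely continuous periodic function. -/
theorem fourierC_deriv (h : IsPrimitiveOn 0 T f g) (hT : 0 < T) (hper : f T = f 0) (k : ℤ) :
    fourierC T g k = Complex.I * (2 * Real.pi / T : ℂ) * k * fourierC T f k := by
  have h1 : IsPrimitiveOn 0 T (wave T (-k))
      (fun t => Complex.I * (2 * Real.pi / T : ℂ) * (-k : ℤ) * wave T (-k) t) :=
    .of_hasDerivAt hT.le (hasDerivAt_wave (-k)) ((continuous_wave (-k)).const_mul _)
  have h2 := (h.mul h1).integral_eq_sub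
  rw [wave_period hT, wave_zero, hper, sub_self, intervalIntegral.integral_add] at h2
  · have h3 : ∫ t in (0 : ℝ)..T, f t * (Complex.I * (2 * Real.pi / T : ℂ) * (-k : ℤ) *
        wave T (-k) t) = -(Complex.I * (2 * Real.pi / T : ℂ) * k) *
        ∫ t in (0 : ℝ)..T, f t * wave T (-k) t := by
      rw [← intervalIntegral.integral_const_mul]
      congr 1 with t
      push_cast; ring
    rw [h3] at h2
    rw [fourierC_eq_wave, fourierC_eq_wave]
    linear_combination (1 / T : ℂ) * h2
  · exact h.integrable.mul_continuousOn (continuous_wave _).continuousOn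
  · refine ContinuousOn.intervalIntegrable ?_
    rw [Set.uIcc_of_le hT.le]
    exact h.continuousOn.mul ((continuous_wave (-k)).const_mul _).continuousOn

theorem fourierC_const (hT : 0 < T) (c : ℂ) (k : ℤ) :
    fourierC T (fun _ => c) k = if k = 0 then c else 0 := by
  have hT' : (T : ℂ) ≠ 0 := by exact_mod_cast hT.ne'
  split_ifs with hk
  · subst hk
    simp [fourierC, hT']
  · have := fourierC_deriv (IsPrimitiveOn.const hT.le c) hT rfl k
    have h0 : fourierC T (fun _ => (0 : ℂ)) k = 0 := by simp [fourierC]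
    rw [h0] at this
    have hne : Complex.I * (2 * Real.pi / T : ℂ) * k ≠ 0 := by
      simp [Complex.I_ne_zero, Real.pi_ne_zero, hT.ne', hk]
    exact (mul_eq_zero.1 this.symm).resolve_left hne

end Fourier

/-! ### Sums over block indices -/

section Sums

variable {n : ℕ}

theorem hasSum_prod_fin {f : ℤ × Fin n → ℂ} {s : Fin n → ℂ}
    (h : ∀ j, HasSum (fun k => f (k, j)) (s j)) : HasSum f (∑ j, s j) := by
  have h1 : ∀ j, HasSum (fun p : ℤ × Fin n => if p.2 = j then f p else 0) (s j) := fun j => by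
    have hinj : Function.Injective fun k : ℤ => (k, j) := fun a b hab => (Prod.mk.inj hab).1
    rw [← hinj.hasSum_iff]
    · simpa [Function.comp_def] using h j
    · rintro ⟨k, i⟩ hk
      have : i ≠ j := fun hij => hk ⟨k, by rw [hij]⟩
      simp [this]
  simpa using hasSum_sum (s := Finset.univ) fun j _ => h1 j

theorem summable_prod_fin {f : ℤ × Fin n → ℝ} (h : ∀ j, Summable fun k => f (k, j)) :
    Summable f := by
  have h1 : Summable fun p => ((f p : ℝ) : ℂ) :=
    (hasSum_prod_fin (f := fun p => ((f p : ℝ) : ℂ)) fun j =>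
      (Complex.summable_ofReal.2 (h j)).hasSum).summable
  exact Complex.summable_ofReal.1 h1

theorem tsum_prod_fin {f : ℤ × Fin n → ℝ} (h : ∀ j, Summable fun k => f (k, j)) :
    ∑' p, f p = ∑ j, ∑' k, f (k, j) := by
  have h1 := (hasSum_prod_fin (f := fun p => ((f p : ℝ) : ℂ)) fun j =>
      (Complex.summable_ofReal.2 (h j)).hasSum).tsum_eq
  simp only [← Complex.ofReal_tsum] at h1
  exact_mod_cast h1

theorem summable_slice {f : ℤ × Fin n → ℝ} (h : Summable f) (j : Fin n) :
    Summable fun k => f (k, j) :=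
  h.comp_injective (i := fun k : ℤ => (k, j)) fun _ _ hab => (Prod.mk.inj hab).1

theorem summable_mul_of_sq {ι : Type*} {a b : ι → ℂ} (ha : Summable fun i => ‖a i‖ ^ 2)
    (hb : Summable fun i => ‖b i‖ ^ 2) : Summable fun i => a i * b i :=
  Summable.of_norm_bounded (ha.add hb) fun i => by
    rw [norm_mul]; nlinarith [sq_nonneg (‖a i‖ - ‖b i‖), sq_nonneg (‖a i‖), sq_nonneg (‖b i‖)]

theorem memℓp_two_iff {ι : Type*} {a : ι → ℂ} : Memℓp a 2 ↔ Summable fun i => ‖a i‖ ^ 2 := by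
  rw [memℓp_gen_iff (by norm_num)]
  simp

end Sums

/-! ### Block Toeplitz matrices as multiplication operators -/

section Toeplitz

variable {n : ℕ} {T : ℝ}

/-- Block Toeplitz matrix of a complex matrix function. -/
noncomputable def toeplitzC (T : ℝ) (M : ℝ → Matrix (Fin n) (Fin n) ℂ) : BlockMatrix n :=
  Matrix.of fun p q => fourierC T (fun t => M t p.2 q.2) (p.1 - q.1)

/-- Complexification of a real matrix function. -/
noncomputable def complexify (M : ℝ → Matrix (Fin n) (Fin n) ℝ) (t : ℝ) :
    Matrix (Fin n) (Fin n) ℂ :=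
  (M t).map Complex.ofReal

theorem blockToeplitz_eq (M : ℝ → Matrix (Fin n) (Fin n) ℝ) :
    blockToeplitz T M = toeplitzC T (complexify M) := rfl

/-- All entries are square integrable on one period. -/
def SqIntegrableMatrix (T : ℝ) (M : ℝ → Matrix (Fin n) (Fin n) ℂ) : Prop :=
  ∀ i j, SqIntegrable T (fun t => M t i j)

variable {M N : ℝ → Matrix (Fin n) (Fin n) ℂ}

theorem summable_toeplitzC_col (hT : 0 < T) (hM : SqIntegrableMatrix T M) (q : ℤ × Fin n) :
    Summable fun p => ‖toeplitzC T M p q‖ ^ 2 :=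
  summable_prod_fin (f := fun p => ‖toeplitzC T M p q‖ ^ 2) fun i => (Equiv.subRight q.1).summable_iff.2
    (summable_norm_fourierC_sq hT (hM i q.2))

/-- Up to translation there are only `n` different columns, so the sum of their squared norms is a
common bound. -/
theorem isAdmissible_toeplitzC (hT : 0 < T) (hM : SqIntegrableMatrix T M) :
    IsAdmissible (toeplitzC T M) := by
  refine ⟨∑ j, ∑ i, ∑' k, ‖fourierC T (fun t => M t i j) k‖ ^ 2, fun q =>
    ⟨summable_toeplitzC_col hT hM q, ?_⟩⟩
  have hs : ∀ i, Summable fun k => ‖toeplitzC T M (k, i) q‖ ^ 2 :=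
    summable_slice (f := fun p => ‖toeplitzC T M p q‖ ^ 2) (summable_toeplitzC_col hT hM q)
  rw [tsum_prod_fin (f := fun p => ‖toeplitzC T M p q‖ ^ 2) hs]
  have : ∀ i, ∑' k, ‖toeplitzC T M (k, i) q‖ ^ 2 =
      ∑' k, ‖fourierC T (fun t => M t i q.2) k‖ ^ 2 := fun i =>
    (Equiv.subRight q.1).tsum_eq fun k => ‖fourierC T (fun t => M t i q.2) k‖ ^ 2
  simp only [this]
  exact Finset.single_le_sum (f := fun j => ∑ i, ∑' k, ‖fourierC T (fun t => M t i j) k‖ ^ 2)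
    (fun _ _ => Finset.sum_nonneg fun _ _ => tsum_nonneg fun _ => by positivity)
    (Finset.mem_univ q.2)

theorem conj_toeplitzC (p q : ℤ × Fin n) :
    conj (toeplitzC T M q p) = toeplitzC T (fun t => (M t)ᴴ) p q := by
  simp only [toeplitzC, Matrix.of_apply, conj_fourierC, Matrix.conjTranspose_apply, neg_sub]
  rfl

theorem SqIntegrableMatrix.conjTranspose (hM : SqIntegrableMatrix T M) :
    SqIntegrableMatrix T (fun t => (M t)ᴴ) := fun i j => (hM j i).conj

theorem SqIntegrableMatrix.integrable_mul (hT : 0 < T) (hM : SqIntegrableMatrix T M)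
    (hN : SqIntegrableMatrix T N) (i j : Fin n) :
    IntervalIntegrable (fun t => (M t * N t) i j) volume 0 T := by
  simp only [Matrix.mul_apply]
  exact intervalIntegrable_fun_sum fun l _ => (hM i l).integrable_mul hT (hN l j)

/-- This is the convolution theorem entry by entry, after translating the summation index by the
column index. Square integrability of both factors suffices; the product itself is only integrable.
-/
theorem hasSum_toeplitzC_mul (hT : 0 < T) (hM : SqIntegrableMatrix T M)
    (hN : SqIntegrableMatrix T N) (p q : ℤ × Fin n) :
    HasSum (fun r => toeplitzC T M p r * toeplitzC T N r q)
      (toeplitzC T (fun t => M t * N t) p q) := by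
  have h : toeplitzC T (fun t => M t * N t) p q =
      ∑ l, fourierC T (fun t => M t p.2 l * N t l q.2) (p.1 - q.1) := by
    simp only [toeplitzC, Matrix.of_apply, Matrix.mul_apply]
    exact fourierC_sum _ (fun l _ => (hM p.2 l).integrable_mul hT (hN l q.2)) _
  rw [h]
  refine hasSum_prod_fin fun l => ?_
  have := hasSum_fourierC_mul hT (hM p.2 l) (hN l q.2) (p.1 - q.1)
  rw [← (Equiv.subRight q.1).hasSum_iff] at this
  simpa [Function.comp_def, toeplitzC] using this

/-- The Fourier coefficients of a vector function. -/
noncomputable def fourierVec (T : ℝ) (x : ℝ → Fin n → ℂ) (p : ℤ × Fin n) : ℂ :=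
  fourierC T (fun t => x t p.2) p.1

theorem hasSum_toeplitzC_mulVec (hT : 0 < T) (hM : SqIntegrableMatrix T M) {x : ℝ → Fin n → ℂ}
    (hx : ∀ i, SqIntegrable T fun t => x t i) (p : ℤ × Fin n) :
    HasSum (fun q => toeplitzC T M p q * fourierVec T x q)
      (fourierVec T (fun t => M t *ᵥ x t) p) := by
  have h : fourierVec T (fun t => M t *ᵥ x t) p =
      ∑ l, fourierC T (fun t => M t p.2 l * x t l) p.1 := by
    simp only [fourierVec, Matrix.mulVec, dotProduct]
    exact fourierC_sum _ (fun l _ => (hM p.2 l).integrable_mul hT (hx l)) _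
  rw [h]
  exact hasSum_prod_fin fun l => hasSum_fourierC_mul hT (hM p.2 l) (hx l) p.1

theorem summable_fourierVec (hT : 0 < T) {x : ℝ → Fin n → ℂ}
    (hx : ∀ i, SqIntegrable T fun t => x t i) : Summable fun p => ‖fourierVec T x p‖ ^ 2 :=
  summable_prod_fin fun i => by
    have := summable_norm_fourierC_sq hT (hx i)
    exact this

theorem hasSum_conj_fourierVec_mul (hT : 0 < T) {x y : ℝ → Fin n → ℂ}
    (hx : ∀ i, SqIntegrable T fun t => x t i) (hy : ∀ i, SqIntegrable T fun t => y t i) :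
    HasSum (fun p => conj (fourierVec T x p) * fourierVec T y p)
      ((1 / T : ℂ) * ∫ t in (0 : ℝ)..T, ∑ i, conj (x t i) * y t i) := by
  have h : ∫ t in (0 : ℝ)..T, ∑ i, conj (x t i) * y t i =
      ∑ i, ∫ t in (0 : ℝ)..T, conj (x t i) * y t i :=
    intervalIntegral.integral_finsetSum fun i _ => (hx i).conj.integrable_mul hT (hy i)
  rw [h, Finset.mul_sum]
  exact hasSum_prod_fin (f := fun p => conj (fourierVec T x p) * fourierVec T y p)
    fun i => by
      have := hasSum_conj_fourierC_mul hT (hx i) (hy i)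
      exact this

theorem exists_fourierVec_eq (hT : 0 < T) {X : ℤ × Fin n → ℂ} (hX : Summable fun p => ‖X p‖ ^ 2) :
    ∃ x : ℝ → Fin n → ℂ, (∀ i, SqIntegrable T fun t => x t i) ∧ fourierVec T x = X := by
  choose f _ hf hfX using fun i => exists_fourierC_eq hT
    (a := fun k => X (k, i)) (summable_slice (f := fun p => ‖X p‖ ^ 2) hX i)
  exact ⟨fun t i => f i t, hf, funext fun p => hfX p.2 p.1⟩

/-- The quadratic form of a block Toeplitz matrix. -/
theorem hasSum_toeplitzC_quadratic (hT : 0 < T) (hM : SqIntegrableMatrix T M) {x : ℝ → Fin n → ℂ}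
    (hx : ∀ i, SqIntegrable T fun t => x t i) (hMx : ∀ i, SqIntegrable T fun t => (M t *ᵥ x t) i) :
    HasSum (fun p => star (fourierVec T x p) * blockMulVec (toeplitzC T M) (fourierVec T x) p)
      ((1 / T : ℂ) * ∫ t in (0 : ℝ)..T, star (x t) ⬝ᵥ (M t *ᵥ x t)) := by
  have h : blockMulVec (toeplitzC T M) (fourierVec T x) = fourierVec T (fun t => M t *ᵥ x t) :=
    funext fun p => (hasSum_toeplitzC_mulVec hT hM hx p).tsum_eq
  rw [h]
  exact hasSum_conj_fourierVec_mul hT hx hMx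

end Toeplitz

/-! ### The harmonic Lyapunov equation in coordinates -/

section Equation

variable {n : ℕ} {T : ℝ} {A Q : ℝ → Matrix (Fin n) (Fin n) ℝ} {P : BlockMatrix n}

theorem IsAdmissible.summable_col (hP : IsAdmissible P) (q : ℤ × Fin n) :
    Summable fun p => ‖P p q‖ ^ 2 := by
  obtain ⟨C, hC⟩ := hP
  exact (hC q).1

theorem norm_apply_comm (hP : P.IsHermitian) (p q : ℤ × Fin n) : ‖P p q‖ = ‖P q p‖ := by
  rw [← hP.apply p q, norm_star]

theorem IsAdmissible.summable_row (hP : IsAdmissible P) (hH : P.IsHermitian) (p : ℤ × Fin n) :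
    Summable fun q => ‖P p q‖ ^ 2 := by
  simpa only [norm_apply_comm hH p] using hP.summable_col p

theorem hasSum_mul_harmonic (hT : 0 < T) (hA : SqIntegrableMatrix T (complexify A))
    (hP : IsAdmissible P) (hH : P.IsHermitian) (p q : ℤ × Fin n) :
    HasSum (fun r => P p r * (blockToeplitz T A - harmonicN n T) r q)
      (∑' r, P p r * blockToeplitz T A r q - Complex.I * (2 * Real.pi / T : ℂ) * q.1 * P p q) := by
  have h1 := (summable_mul_of_sq (hP.summable_row hH p) (summable_toeplitzC_col hT hA q)).hasSum
  have h2 : HasSum (fun r => P p r * harmonicN n T r q)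
      (Complex.I * (2 * Real.pi / T : ℂ) * q.1 * P p q) := by
    convert hasSum_single q ?_ using 1
    · simp [harmonicN, mul_comm]
    · intro r hr
      simp [harmonicN, hr]
  simp only [Matrix.sub_apply, mul_sub]
  exact h1.sub h2

theorem hasSum_harmonic_mul (hT : 0 < T) (hA : SqIntegrableMatrix T (complexify A))
    (hP : IsAdmissible P) (p q : ℤ × Fin n) :
    HasSum (fun r => (blockToeplitz T A - harmonicN n T).conjTranspose p r * P r q)
      (∑' r, conj (blockToeplitz T A r p) * P r q
        + Complex.I * (2 * Real.pi / T : ℂ) * p.1 * P p q) := by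
  have h1 := (summable_mul_of_sq (a := fun r => conj (blockToeplitz T A r p))
    (by simp only [RCLike.norm_conj]; exact summable_toeplitzC_col hT hA p) (hP.summable_col q)).hasSum
  have h2 : HasSum (fun r => conj (harmonicN n T r p) * P r q)
      (-(Complex.I * (2 * Real.pi / T : ℂ) * p.1 * P p q)) := by
    convert hasSum_single p ?_ using 1
    · simp [harmonicN, map_ofNat]
    · intro r hr
      simp [harmonicN, hr]
  have := h1.sub h2
  rw [sub_neg_eq_add] at this
  simp only [Matrix.conjTranspose_apply, Matrix.sub_apply, star_sub, sub_mul]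
  exact this

/-- The harmonic Lyapunov equation, written out. -/
theorem solves_iff (hT : 0 < T) (hA : SqIntegrableMatrix T (complexify A))
    (hP : IsAdmissible P) (hH : P.IsHermitian) :
    SolvesHarmonicLyapunov T A Q P ↔ ∀ p q,
      ∑' r, P p r * blockToeplitz T A r q + ∑' r, conj (blockToeplitz T A r p) * P r q
        + Complex.I * (2 * Real.pi / T : ℂ) * (p.1 - q.1) * P p q + blockToeplitz T Q p q = 0 := by
  rw [SolvesHarmonicLyapunov, ← Matrix.ext_iff]
  refine forall_congr' fun p => forall_congr' fun q => ?_
  rw [Matrix.add_apply, Matrix.add_apply, blockMul, blockMul, Matrix.of_apply, Matrix.of_apply,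
    (hasSum_mul_harmonic hT hA hP hH p q).tsum_eq, (hasSum_harmonic_mul hT hA hP p q).tsum_eq,
    Matrix.zero_apply]
  constructor <;> intro h <;> linear_combination h

/-- The harmonic Lyapunov equation for a block Toeplitz matrix. -/
theorem toeplitzC_solves_iff (hT : 0 < T) (hA : SqIntegrableMatrix T (complexify A))
    {M : ℝ → Matrix (Fin n) (Fin n) ℂ} (hM : SqIntegrableMatrix T M)
    (hH : (toeplitzC T M).IsHermitian) :
    SolvesHarmonicLyapunov T A Q (toeplitzC T M) ↔ ∀ i j k,
      fourierC T (fun t => (M t * complexify A t) i j) k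
        + fourierC T (fun t => ((complexify A t)ᴴ * M t) i j) k
        + Complex.I * (2 * Real.pi / T : ℂ) * k * fourierC T (fun t => M t i j) k
        + fourierC T (fun t => complexify Q t i j) k = 0 := by
  rw [solves_iff hT hA (isAdmissible_toeplitzC hT hM) hH]
  have h1 : ∀ p q, ∑' r, toeplitzC T M p r * blockToeplitz T A r q =
      fourierC T (fun t => (M t * complexify A t) p.2 q.2) (p.1 - q.1) := fun p q =>
    (hasSum_toeplitzC_mul hT hM hA p q).tsum_eq
  have h2 : ∀ p q, ∑' r, conj (blockToeplitz T A r p) * toeplitzC T M r q =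
      fourierC T (fun t => ((complexify A t)ᴴ * M t) p.2 q.2) (p.1 - q.1) := fun p q => by
    simp only [blockToeplitz_eq, conj_toeplitzC]
    exact (hasSum_toeplitzC_mul hT hA.conjTranspose hM p q).tsum_eq
  simp only [h1, h2]
  constructor
  · intro h i j k
    simpa [toeplitzC, blockToeplitz_eq] using h (k, i) (0, j)
  · intro h p q
    simpa [toeplitzC, blockToeplitz_eq] using h p.2 q.2 (p.1 - q.1)

end Equation

/-! ### Lyapunov's direct method for periodic systems -/

section Periodic

variable {n : ℕ} {T : ℝ} {A : ℝ → Matrix (Fin n) (Fin n) ℝ}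

theorem intervalIntegrable_of_memLp_Icc {f : ℝ → ℝ} (hT : 0 < T)
    (h : MemLp f 2 (volume.restrict (Set.Icc 0 T))) : IntervalIntegrable f volume 0 T :=
  (intervalIntegrable_iff_integrableOn_Icc_of_le hT.le).2 (h.integrable (by norm_num))

theorem locIntegrable_of_periodic (hT : 0 < T) (hper : Function.Periodic A T)
    (hA : ∀ i j, IntervalIntegrable (fun t => A t i j) volume 0 T) :
    LocIntegrable A := fun i j a b =>
  Function.Periodic.intervalIntegrable₀ (fun t => by simp only [hper t]) hT.ne' (hA i j) a b

theorem sqIntegrableMatrix_complexify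
    (hA : ∀ i j, MemLp (fun t => A t i j) 2 (volume.restrict (Set.Icc 0 T))) :
    SqIntegrableMatrix T (complexify A) := fun i j => by
  have h : MemLp (fun t => A t i j) 2 (volume.restrict (Set.Ioc 0 T)) :=
    (hA i j).mono_measure (Measure.restrict_mono Set.Ioc_subset_Icc_self le_rfl)
  exact h.ofReal

theorem periodic_entrySum (hper : Function.Periodic A T) : Function.Periodic (entrySum A) T :=
  fun t => by simp only [entrySum, hper t]

/-- The Gronwall exponent over a period is the integral of `entrySum A` over that period, which by
periodicity does not depend on the starting time. Hence one constant serves all `s`. -/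
theorem exists_growth_bound (hper : Function.Periodic A T) (hA : LocIntegrable A) :
    ∃ c > 0, ∀ (s : ℝ) (x : ℝ → Fin n → ℝ),
      (∀ b, s ≤ b → ∀ i, IsPrimitiveOn s b (fun t => x t i) (fun t => (A t *ᵥ x t) i)) →
      ∀ t ∈ Set.Icc s (s + T), ‖x t‖ ≤ c * ‖x s‖ := by
  -- The summand `1` keeps the constant positive when `n = 0`.
  refine ⟨n * Real.exp (∫ r in (0 : ℝ)..T, entrySum A r) + 1, by positivity,
    fun s x hx t ht => ?_⟩
  obtain ⟨Φ, Ψ, hΦ, hbd⟩ := exists_isFundamental hA s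
  rw [hΦ.eq_mulVec ht.1 (hx t ht.1) t ⟨ht.1, le_rfl⟩, pi_norm_le_iff_of_nonneg (by positivity)]
  intro i
  have h1 : Real.exp (∫ r in s..t, entrySum A r) ≤ Real.exp (∫ r in (0 : ℝ)..T, entrySum A r) := by
    rw [Real.exp_le_exp]
    refine (integral_entrySum_mono hA s ht.2).trans_eq ?_
    simpa using (periodic_entrySum hper).intervalIntegral_add_eq s 0
  calc ‖(Φ t *ᵥ x s) i‖ ≤ ∑ j, |Φ t i j * x s j| :=
        Finset.abs_sum_le_sum_abs (fun j => Φ t i j * x s j) Finset.univ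
    _ ≤ ∑ _j : Fin n, Real.exp (∫ r in (0 : ℝ)..T, entrySum A r) * ‖x s‖ :=
        Finset.sum_le_sum fun j _ => by
          rw [abs_mul]
          exact mul_le_mul ((hbd t ht.1 i j).trans h1) (norm_le_pi_norm (x s) j) (abs_nonneg _)
            (Real.exp_pos _).le
    _ = n * Real.exp (∫ r in (0 : ℝ)..T, entrySum A r) * ‖x s‖ := by simp; ring
    _ ≤ _ := by nlinarith [norm_nonneg (x s)]

theorem norm_sq_le_dotProduct (v : Fin n → ℝ) : ‖v‖ ^ 2 ≤ v ⬝ᵥ v := by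
  have h0 : 0 ≤ v ⬝ᵥ v := Finset.sum_nonneg fun i _ => mul_self_nonneg _
  have : ‖v‖ ≤ Real.sqrt (v ⬝ᵥ v) := by
    rw [pi_norm_le_iff_of_nonneg (Real.sqrt_nonneg _)]
    intro i
    refine Real.le_sqrt_of_sq_le ?_
    rw [Real.norm_eq_abs, sq_abs, sq]
    exact Finset.single_le_sum (f := fun i => v i * v i) (fun i _ => mul_self_nonneg _)
      (Finset.mem_univ i)
  calc ‖v‖ ^ 2 ≤ Real.sqrt (v ⬝ᵥ v) ^ 2 := by gcongr
    _ = v ⬝ᵥ v := Real.sq_sqrt h0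

theorem abs_quadratic_le {S : Matrix (Fin n) (Fin n) ℝ} {K : ℝ} (hK : ∀ i j, |S i j| ≤ K)
    (v : Fin n → ℝ) : |v ⬝ᵥ S *ᵥ v| ≤ n * (n * K) * ‖v‖ ^ 2 := by
  have h1 : v ⬝ᵥ S *ᵥ v = ∑ i, ∑ j, v i * (S i j * v j) := by
    simp [dotProduct, Matrix.mulVec, Finset.mul_sum]
  rw [h1]
  calc |∑ i, ∑ j, v i * (S i j * v j)| ≤ ∑ i, ∑ j, |v i * (S i j * v j)| :=
        (Finset.abs_sum_le_sum_abs _ _).trans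
          (Finset.sum_le_sum fun i _ => Finset.abs_sum_le_sum_abs _ _)
    _ ≤ ∑ _i : Fin n, ∑ _j : Fin n, ‖v‖ * (K * ‖v‖) :=
        Finset.sum_le_sum fun i _ => Finset.sum_le_sum fun j _ => by
          rw [abs_mul, abs_mul]
          have h2 := norm_le_pi_norm v i
          have h3 := norm_le_pi_norm v j
          have h4 := hK i j
          have h5 : 0 ≤ K := (abs_nonneg _).trans h4
          simp only [Real.norm_eq_abs] at h2 h3
          gcongr
    _ = _ := by simp; ring

/-- A bounded nonnegative solution of the differential Lyapunov inequality gives stability. -/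
theorem globallyAsymptoticallyStable_of_lyapunov (hT : 0 < T) (hper : Function.Periodic A T)
    (hA : LocIntegrable A) {S : ℝ → Matrix (Fin n) (Fin n) ℝ} {K : ℝ}
    (hS : ∀ a b, a ≤ b → ∀ i j, IsPrimitiveOn a b (fun t => S t i j)
      (fun t => (-(S t * A t + (A t)ᵀ * S t + 1)) i j))
    (hpos : ∀ t v, 0 ≤ v ⬝ᵥ S t *ᵥ v) (hK : ∀ t i j, |S t i j| ≤ K) :
    GloballyAsymptoticallyStable A := by
  obtain ⟨c, hc, hgrow⟩ := exists_growth_bound hper hA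
  have main : ∀ t₀ x, IsSolution A t₀ x →
      -- Write `V = x · S x`. Three facts suffice: growth over a period is bounded, `V` decreases,
      -- and its decrease over the last period controls `‖x t‖²`.
      (∀ s, t₀ ≤ s → ∀ t ∈ Set.Icc s (s + T), ‖x t‖ ≤ c * ‖x s‖) ∧
      (∀ a b, t₀ ≤ a → a ≤ b → x b ⬝ᵥ S b *ᵥ x b ≤ x a ⬝ᵥ S a *ᵥ x a) ∧
      (∀ t, t₀ + T ≤ t → ‖x t‖ ^ 2 ≤ c ^ 2 / T *
        (x (t - T) ⬝ᵥ S (t - T) *ᵥ x (t - T) - x t ⬝ᵥ S t *ᵥ x t)) := by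
    intro t₀ x hx
    have hprim : ∀ a b, t₀ ≤ a → a ≤ b → ∀ i,
        IsPrimitiveOn a b (fun t => x t i) (fun t => (A t *ᵥ x t) i) := fun a b ha hab i =>
      (hx.isPrimitiveOn hA (ha.trans hab) i).mono_left ha hab
    have hV : ∀ a b, t₀ ≤ a → a ≤ b →
        IsPrimitiveOn a b (fun t => x t ⬝ᵥ S t *ᵥ x t) (fun t => -(x t ⬝ᵥ x t)) := by
      intro a b ha hab
      have h1 := isPrimitiveOn_mulVec hab (hS a b hab) (hprim a b ha hab)
      have h2 := IsPrimitiveOn.sum hab Finset.univ fun i _ => (hprim a b ha hab i).mul (h1 i)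
      refine h2.congr_deriv (Filter.Eventually.of_forall fun t _ => ?_)
      rw [Finset.sum_add_distrib]
      change (A t *ᵥ x t) ⬝ᵥ (S t *ᵥ x t) + x t ⬝ᵥ _ = _
      rw [Matrix.neg_mulVec, Matrix.add_mulVec, Matrix.add_mulVec, Matrix.one_mulVec,
        ← Matrix.mulVec_mulVec, ← Matrix.mulVec_mulVec]
      have h3 : x t ⬝ᵥ (A t)ᵀ *ᵥ (S t *ᵥ x t) = (A t *ᵥ x t) ⬝ᵥ (S t *ᵥ x t) := by
        rw [Matrix.dotProduct_mulVec, Matrix.vecMul_transpose]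
      simp only [dotProduct_add, dotProduct_neg, h3]
      ring
    have hg : ∀ s, t₀ ≤ s → ∀ t ∈ Set.Icc s (s + T), ‖x t‖ ≤ c * ‖x s‖ := fun s hs =>
      hgrow s x fun b hb => hprim s b hs hb
    refine ⟨hg, fun a b ha hab => ?_, fun t ht => ?_⟩
    · have h1 := (hV a b ha hab).integral_eq_sub
      have h2 : ∫ t in a..b, -(x t ⬝ᵥ x t) ≤ 0 := by
        rw [intervalIntegral.integral_neg, neg_nonpos]
        exact intervalIntegral.integral_nonneg hab fun t _ =>
          Finset.sum_nonneg fun i _ => mul_self_nonneg _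
      linarith
    · have hle : t - T ≤ t := by linarith
      have h0 : t₀ ≤ t - T := by linarith
      have h1 := (hV (t - T) t h0 hle)
      have h2 := h1.integral_eq_sub
      -- Each `s` in the last period satisfies `‖x t‖ ≤ c ‖x s‖`. Integrating the square over that
      -- period gives `T ‖x t‖² ≤ c² ∫ x · x = c² (V(t - T) - V(t))`.
      have h3 : ∫ _s in (t - T)..t, ‖x t‖ ^ 2 ≤ ∫ s in (t - T)..t, -c ^ 2 * -(x s ⬝ᵥ x s) := by
        refine intervalIntegral.integral_mono_on hle (by simp) (h1.integrable.const_mul _)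
          fun s hs => ?_
        have h4 := hg s (h0.trans hs.1) t ⟨hs.2, by linarith [hs.1]⟩
        calc ‖x t‖ ^ 2 ≤ (c * ‖x s‖) ^ 2 := by gcongr
          _ = c ^ 2 * ‖x s‖ ^ 2 := by ring
          _ ≤ c ^ 2 * (x s ⬝ᵥ x s) := by gcongr; exact norm_sq_le_dotProduct _
          _ = _ := by ring
      rw [intervalIntegral.integral_const_mul, h2, intervalIntegral.integral_const,
        sub_sub_cancel, smul_eq_mul] at h3
      rw [div_mul_eq_mul_div, le_div_iff₀ hT]
      linarith
  intro t₀
  constructor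
  · intro ε hε
    -- The term `c` covers the first period. The root covers later times, where the decrease of `V`
    -- is at most `V(t₀) ≤ n² |K| ‖x t₀‖²`.
    set L : ℝ := c + Real.sqrt (c ^ 2 / T * (n * (n * |K|))) with hL
    have hLpos : 0 < L := by positivity
    refine ⟨ε / L, by positivity, fun x hx hx0 t ht => ?_⟩
    obtain ⟨hg, hmono, hdec⟩ := main t₀ x hx
    suffices h : ‖x t‖ ≤ L * ‖x t₀‖ by
      refine h.trans_lt ?_
      rwa [lt_div_iff₀' hLpos] at hx0
    rcases le_total t (t₀ + T) with htT | htT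
    · refine (hg t₀ le_rfl t ⟨ht, htT⟩).trans ?_
      gcongr
      exact le_add_of_nonneg_right (Real.sqrt_nonneg _)
    · have h1 := hdec t htT
      have h2 := hmono t₀ (t - T) le_rfl (by linarith)
      have h3 := (le_abs_self _).trans
        (abs_quadratic_le (fun i j => (hK t₀ i j).trans (le_abs_self K)) (x t₀))
      have h4 : ‖x t‖ ^ 2 ≤ c ^ 2 / T * (n * (n * |K|)) * ‖x t₀‖ ^ 2 := by
        refine h1.trans ?_
        rw [mul_assoc]
        gcongr
        linarith [hpos t (x t)]
      have h5 : ‖x t‖ ≤ Real.sqrt (c ^ 2 / T * (n * (n * |K|))) * ‖x t₀‖ := by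
        refine (Real.le_sqrt_of_sq_le h4).trans_eq ?_
        rw [Real.sqrt_mul (by positivity), Real.sqrt_sq (norm_nonneg _)]
      refine h5.trans ?_
      gcongr
      exact le_add_of_nonneg_left hc.le
  · intro x hx
    obtain ⟨hg, hmono, hdec⟩ := main t₀ x hx
    -- `V` is frozen before `t₀` so as to be antitone on the whole line. Being bounded below, it
    -- converges, so its decrease over a period tends to zero.
    set W : ℝ → ℝ := fun t => x (max t t₀) ⬝ᵥ S (max t t₀) *ᵥ x (max t t₀) with hW
    have hanti : Antitone W := fun a b hab =>
      hmono _ _ (le_max_right _ _) (max_le_max_right _ hab)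
    have hlim := tendsto_atTop_ciInf hanti ⟨0, by rintro _ ⟨t, rfl⟩; exact hpos _ _⟩
    have hlim2 := hlim.comp (Filter.tendsto_atTop_add_const_right Filter.atTop (-T)
      Filter.tendsto_id)
    have hsub := (hlim2.sub hlim).const_mul (c ^ 2 / T)
    rw [sub_self, mul_zero] at hsub
    have hsq : Filter.Tendsto (fun t => ‖x t‖ ^ 2) Filter.atTop (nhds 0) := by
      refine squeeze_zero' (Filter.Eventually.of_forall fun t => by positivity) ?_ hsub
      filter_upwards [Filter.eventually_ge_atTop (t₀ + T)] with t ht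
      have := hdec t ht
      simp only [hW, Function.comp_apply, id]
      rwa [max_eq_left (by linarith), max_eq_left (by linarith), ← sub_eq_add_neg]
    rw [tendsto_zero_iff_norm_tendsto_zero]
    have := hsq.sqrt
    simpa [Real.sqrt_sq (norm_nonneg _)] using this

end Periodic

/-! ### Translation invariance of the harmonic equation -/

section Shift

variable {n : ℕ} {T : ℝ} {A Q : ℝ → Matrix (Fin n) (Fin n) ℝ} {P : BlockMatrix n}

/-- Translation of the block index. -/
def blockShift (n : ℕ) (m : ℤ) : ℤ × Fin n ≃ ℤ × Fin n :=
  (Equiv.addRight m).prodCongr (Equiv.refl _)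

theorem blockShift_apply (m : ℤ) (p : ℤ × Fin n) : blockShift n m p = (p.1 + m, p.2) := rfl

theorem blockToeplitz_shift (M : ℝ → Matrix (Fin n) (Fin n) ℝ) (m : ℤ) (p q : ℤ × Fin n) :
    blockToeplitz T M (blockShift n m p) (blockShift n m q) = blockToeplitz T M p q := by
  simp [blockToeplitz, blockShift_apply]

theorem IsAdmissible.shift (hP : IsAdmissible P) (m : ℤ) :
    IsAdmissible (P.submatrix (blockShift n m) (blockShift n m)) := by
  obtain ⟨C, hC⟩ := hP
  refine ⟨C, fun q => ⟨(blockShift n m).summable_iff.2 (hC (blockShift n m q)).1, ?_⟩⟩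
  exact ((blockShift n m).tsum_eq fun p => ‖P p (blockShift n m q)‖ ^ 2).trans_le
    (hC (blockShift n m q)).2

theorem IsPosDef.shift (hP : IsPosDef P) (m : ℤ) :
    IsPosDef (P.submatrix (blockShift n m) (blockShift n m)) := by
  intro X hX0 hX hPX
  set σ := blockShift n m
  have key : ∀ p, blockMulVec P (X ∘ σ.symm) p = blockMulVec (P.submatrix σ σ) X (σ.symm p) := by
    intro p
    unfold blockMulVec
    rw [← σ.tsum_eq]
    simp
  have h1 : Summable fun p => ‖(X ∘ σ.symm) p‖ ^ 2 :=
    (σ.symm.summable_iff (f := fun p => ‖X p‖ ^ 2)).2 (memℓp_two_iff.1 hX)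
  have h2 : Summable fun p => ‖blockMulVec P (X ∘ σ.symm) p‖ ^ 2 := by
    simp only [key]
    exact (σ.symm.summable_iff (f := fun p => ‖blockMulVec (P.submatrix σ σ) X p‖ ^ 2)).2
      (memℓp_two_iff.1 hPX)
  have h := hP (X ∘ σ.symm) (fun h0 => hX0 (funext fun p => by simpa using congrFun h0 (σ p)))
    (memℓp_two_iff.2 h1) (memℓp_two_iff.2 h2)
  simp only [key] at h
  have e := σ.symm.tsum_eq fun p => star (X p) * blockMulVec (P.submatrix σ σ) X p
  rw [← e]
  exact h

/-- Translating both indices leaves the Toeplitz matrices unchanged. The diagonal matrix `N` is not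
invariant, but it enters only through the difference `p.1 - q.1`, which is. -/
theorem SolvesHarmonicLyapunov.shift (hT : 0 < T) (hA : SqIntegrableMatrix T (complexify A))
    (hP : IsAdmissible P) (hH : P.IsHermitian) (h : SolvesHarmonicLyapunov T A Q P) (m : ℤ) :
    SolvesHarmonicLyapunov T A Q (P.submatrix (blockShift n m) (blockShift n m)) := by
  rw [solves_iff hT hA hP hH] at h
  rw [solves_iff hT hA (hP.shift m) (hH.submatrix _)]
  intro p q
  set σ := blockShift n m with hσ
  have h1 := h (σ p) (σ q)
  rw [← σ.tsum_eq fun r => P (σ p) r * blockToeplitz T A r (σ q),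
    ← σ.tsum_eq fun r => conj (blockToeplitz T A r (σ p)) * P r (σ q)] at h1
  simp only [hσ, blockToeplitz_shift] at h1
  simp only [← hσ] at h1
  simp only [Matrix.submatrix_apply]
  rw [← h1]
  simp only [hσ, blockShift_apply]
  push_cast
  ring

end Shift

/-! ### Absolutely continuous representatives of periodic functions -/

section Regularity

variable {T : ℝ} {f g : ℝ → ℂ}

/-- Every point reaches `(0, T]` by one of countably many translations, each preserving null sets.
-/
theorem ae_of_periodic (hT : 0 < T) {p : ℝ → Prop} (hp : ∀ t, p (t + T) ↔ p t)
    (h : ∀ᵐ t, t ∈ Set.Ioc 0 T → p t) : ∀ᵐ t, p t := by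
  have hper : Function.Periodic p T := fun t => propext (hp t)
  have h1 : ∀ m : ℤ, ∀ᵐ t : ℝ, t + m • T ∈ Set.Ioc 0 T → p (t + m • T) := fun m =>
    (measurePreserving_add_right volume (m • T)).quasiMeasurePreserving.ae h
  filter_upwards [ae_all_iff.2 h1] with t ht
  obtain ⟨m, hm, _⟩ := existsUnique_add_zsmul_mem_Ioc hT t 0
  rw [zero_add] at hm
  have := ht m hm
  rwa [hper.zsmul m t] at this

/-- A square integrable periodic function whose distributional derivative is integrable has an
absolutely continuous representative. -/
theorem exists_isPrimitiveOn_of_fourierC (hT : 0 < T) (hf : SqIntegrable T f)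
    (hfper : Function.Periodic f T) (hgper : Function.Periodic g T)
    (hg : IntervalIntegrable g volume 0 T)
    (h : ∀ k, fourierC T g k = Complex.I * (2 * Real.pi / T : ℂ) * k * fourierC T f k) :
    ∃ F : ℝ → ℂ, Function.Periodic F T ∧ (∀ a b, a ≤ b → IsPrimitiveOn a b F g) ∧
      ∀ᵐ t, F t = f t := by
  have hgi : ∀ a b, IntervalIntegrable g volume a b := fun a b =>
    hgper.intervalIntegrable₀ hT.ne' hg a b
  have hT' : (T : ℂ) ≠ 0 := by exact_mod_cast hT.ne'
  set R : ℝ → ℂ := fun t => ∫ s in (0 : ℝ)..t, g s with hR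
  have hR0 : R 0 = 0 := by simp [hR]
  -- The hypothesis at `k = 0` says that `g` has mean zero, so its primitive is periodic.
  have hRT : R T = 0 := by
    have := h 0
    simp only [fourierC, Int.cast_zero, mul_zero, zero_mul, neg_zero, Complex.exp_zero, mul_one,
      mul_eq_zero, one_div, inv_eq_zero, hT', false_or] at this
    exact this
  have hprim : ∀ (c : ℂ) a b, a ≤ b → IsPrimitiveOn a b (fun t => c + R t) g := by
    intro c a b hab
    refine ⟨hab, hgi a b, fun t _ => ?_⟩
    simp only [hR]
    rw [← intervalIntegral.integral_add_adjacent_intervals (hgi 0 a) (hgi a t)]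
    ring
  -- The constant of integration is chosen to match the zeroth coefficient; the other coefficients
  -- agree by the derivative formula.
  set c : ℂ := fourierC T f 0 - fourierC T R 0 with hc
  have hRint : IntervalIntegrable R volume 0 T := by
    have := (hprim 0 0 T hT.le).continuousOn
    simp only [zero_add] at this
    exact ContinuousOn.intervalIntegrable (by rwa [Set.uIcc_of_le hT.le])
  have hcoef : ∀ k, fourierC T (fun t => c + R t) k = fourierC T f k := by
    intro k
    rcases eq_or_ne k 0 with rfl | hk
    · rw [fourierC_add (f := fun _ => c) (by simp) hRint, fourierC_const hT]
      simp [hc]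
    · have h1 := fourierC_deriv (hprim c 0 T hT.le) hT (by rw [hR0, hRT]) k
      rw [h k] at h1
      refine (mul_left_cancel₀ ?_ h1).symm
      simp [Complex.I_ne_zero, Real.pi_ne_zero, hT.ne', hk]
  have hper : Function.Periodic (fun t => c + R t) T := fun t => by
    simp only [hR]
    rw [← intervalIntegral.integral_add_adjacent_intervals (hgi 0 t) (hgi t (t + T)),
      hgper.intervalIntegral_add_eq t 0, zero_add]
    have : ∫ s in (0 : ℝ)..T, g s = 0 := hRT
    rw [this, add_zero]
  have hsq : SqIntegrable T (fun t => c + R t) :=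
    sqIntegrable_of_continuousOn (hprim c 0 T hT.le).continuousOn
  refine ⟨fun t => c + R t, hper, hprim c, ae_of_periodic hT (fun t => ?_) ?_⟩
  · simp only [hper t, hfper t]
  · have h2 : ∀ k, fourierC T (fun t => (c + R t) + -f t) k = 0 := fun k => by
      rw [fourierC_add (g := fun t => -f t) (hsq.intervalIntegrable hT)
        (hf.intervalIntegrable hT).neg, hcoef, fourierC_neg, add_neg_cancel]
    filter_upwards [ae_eq_zero_of_fourierC hT (hsq.add hf.neg) h2] with t ht ht'
    exact add_neg_eq_zero.1 (ht ht')

end Regularity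

/-! ### Unique solvability implies stability -/

section Stability

variable {n : ℕ} {T : ℝ} {A : ℝ → Matrix (Fin n) (Fin n) ℝ}

/-- A matrix function whose block Toeplitz matrix is positive definite is positive semidefinite at
every point. -/
theorem quadratic_nonneg_of_isPosDef (hT : 0 < T) {M : ℝ → Matrix (Fin n) (Fin n) ℂ}
    (hM : ∀ i j, Continuous fun t => M t i j) (hper : Function.Periodic M T)
    (hpos : IsPosDef (toeplitzC T M)) (t : ℝ) (v : Fin n → ℂ) :
    0 ≤ (star v ⬝ᵥ M t *ᵥ v).re := by
  obtain ⟨t₁, ht₁, hMt⟩ := hper.exists_mem_Ico₀ hT t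
  rw [hMt]
  by_contra! hneg
  have hcont : Continuous fun t => (star v ⬝ᵥ M t *ᵥ v).re := by
    simp only [dotProduct, Matrix.mulVec]
    fun_prop
  obtain ⟨δ, hδ, hball⟩ := Metric.isOpen_iff.1 (isOpen_lt hcont continuous_const) t₁ hneg
  -- Since `t₁` lies in `[0, T)`, an interval to its right fits both in the period and in the
  -- neighbourhood where the form is negative.
  set t₂ := min T (t₁ + δ / 2) with ht₂
  have h12 : t₁ < t₂ := lt_min ht₁.2 (by linarith)
  have hlt : ∀ t ∈ Set.Ioc t₁ t₂, (star v ⬝ᵥ M t *ᵥ v).re < 0 := fun t ht => by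
    refine hball ?_
    rw [Metric.mem_ball, Real.dist_eq, abs_of_pos (by linarith [ht.1])]
    have := ht.2.trans (min_le_right _ _)
    linarith
  have hsub : Set.Ioc t₁ t₂ ⊆ Set.Ioc 0 T := Set.Ioc_subset_Ioc ht₁.1 (min_le_left _ _)
  -- The test function is `v` on the short interval and zero elsewhere. Its Toeplitz quadratic form
  -- is the mean of a nonpositive function, contradicting positivity.
  set x : ℝ → Fin n → ℂ := fun t => Set.indicator (Set.Ioc t₁ t₂) (fun _ => v) t with hx
  have hxi : ∀ i, SqIntegrable T fun t => x t i := fun i => by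
    have h1 : (fun t => x t i) = Set.indicator (Set.Ioc t₁ t₂) (fun _ => v i) := by
      funext t
      by_cases ht : t ∈ Set.Ioc t₁ t₂ <;> simp [hx, ht]
    rw [h1]
    exact (memLp_const (v i)).indicator measurableSet_Ioc
  have hMsq : SqIntegrableMatrix T M := fun i j => sqIntegrable_of_continuousOn (hM i j).continuousOn
  have hMx : ∀ i, SqIntegrable T fun t => (M t *ᵥ x t) i := fun i => by
    simp only [Matrix.mulVec, dotProduct]
    exact memLp_finsetSum _ fun j _ => (hxi j).mul_continuousOn (hM i j).continuousOn
  have hsum := hasSum_toeplitzC_quadratic hT hMsq hxi hMx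
  have hmv : blockMulVec (toeplitzC T M) (fourierVec T x) = fourierVec T (fun t => M t *ᵥ x t) :=
    funext fun p => (hasSum_toeplitzC_mulVec hT hMsq hxi p).tsum_eq
  have h := hpos (fourierVec T x) ?_ (memℓp_two_iff.2 (summable_fourierVec hT hxi))
    (by rw [hmv]; exact memℓp_two_iff.2 (summable_fourierVec hT hMx))
  · rw [hsum.tsum_eq, show (1 / T : ℂ) = ((1 / T : ℝ) : ℂ) by push_cast; rfl, Complex.re_ofReal_mul]
      at h
    have hint : IntervalIntegrable (fun t => star (x t) ⬝ᵥ (M t *ᵥ x t)) volume 0 T :=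
      intervalIntegrable_fun_sum (s := Finset.univ)
        (f := fun i t => star (x t i) * (M t *ᵥ x t) i)
        fun i _ => (hxi i).conj.integrable_mul hT (hMx i)
    have hre := Complex.reCLM.intervalIntegral_comp_comm hint
    simp only [Complex.reCLM_apply] at hre
    rw [← hre] at h
    have hle : ∫ t in (0 : ℝ)..T, (star (x t) ⬝ᵥ (M t *ᵥ x t)).re ≤ 0 := by
      rw [← neg_nonneg, ← intervalIntegral.integral_neg]
      refine intervalIntegral.integral_nonneg hT.le fun t _ => ?_
      by_cases ht : t ∈ Set.Ioc t₁ t₂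
      · have := hlt t ht
        simp only [hx, ht, Set.indicator_of_mem]
        linarith
      · simp [hx, ht]
    exact absurd h (not_lt.2 (mul_nonpos_of_nonneg_of_nonpos (by positivity) hle))
  · intro h0
    have hv : v = 0 := by
      funext i
      have h1 := ae_eq_zero_of_fourierC hT (hxi i) fun k => congrFun h0 (k, i)
      by_contra hvi
      have h2 : ∀ᵐ t, t ∉ Set.Ioc t₁ t₂ := by
        filter_upwards [h1] with t ht htm
        have := ht (hsub htm)
        simp only [hx, htm, Set.indicator_of_mem] at this
        exact hvi this
      have h3 := measure_eq_zero_iff_ae_notMem.2 h2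
      simp [Real.volume_Ioc] at h3
      linarith
    simp [hv] at hneg

theorem complexify_conjTranspose (t : ℝ) : (complexify A t)ᴴ = (complexify fun t => (A t)ᵀ) t := by
  ext i j
  simp [complexify]

theorem re_mul_complexify (M : Matrix (Fin n) (Fin n) ℂ) (t : ℝ) :
    (M * complexify A t).map Complex.re = M.map Complex.re * A t := by
  ext i j
  simp [complexify, Matrix.mul_apply]

theorem re_complexify_mul (M : Matrix (Fin n) (Fin n) ℂ) (t : ℝ) :
    (complexify A t * M).map Complex.re = A t * M.map Complex.re := by
  ext i j
  simp [complexify, Matrix.mul_apply]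

/-- Solvability of the harmonic Lyapunov equation with right-hand side the identity implies
stability. -/
theorem globallyAsymptoticallyStable_of_existsUnique (hT : 0 < T)
    (hAper : Function.Periodic A T)
    (hA : ∀ i j, MemLp (fun t => A t i j) 2 (volume.restrict (Set.Icc 0 T)))
    (h : ∃! P : BlockMatrix n, IsAdmissible P ∧ P.IsHermitian ∧ IsPosDef P ∧
      SolvesHarmonicLyapunov T A (fun _ => 1) P) :
    GloballyAsymptoticallyStable A := by
  have hAc := sqIntegrableMatrix_complexify hA
  obtain ⟨P, ⟨hadm, hH, hpos, hsol⟩, huniq⟩ := h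
  -- By uniqueness `P` equals its translate by `-q.1`, so `P` depends only on `p.1 - q.1` and the
  -- inner indices, and is determined by its zeroth block column.
  have hshift : ∀ p q, P p q = P (p.1 - q.1, p.2) (0, q.2) := fun p q => by
    have := huniq _ ⟨hadm.shift (-q.1), hH.submatrix _, hpos.shift (-q.1),
      hsol.shift hT hAc hadm hH (-q.1)⟩
    rw [← congrFun (congrFun this p) q]
    simp [blockShift_apply, sub_eq_add_neg]
  choose f hfper hf hfP using fun i j => exists_fourierC_eq hT (a := fun k => P (k, i) (0, j))
    (summable_slice (f := fun p => ‖P p (0, j)‖ ^ 2) (hadm.summable_col (0, j)) i)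
  set M : ℝ → Matrix (Fin n) (Fin n) ℂ := fun t => Matrix.of fun i j => f i j t with hMdef
  have hM : SqIntegrableMatrix T M := hf
  have hMP : toeplitzC T M = P := by
    ext p q
    rw [hshift p q]
    exact hfP p.2 q.2 (p.1 - q.1)
  have hMper : Function.Periodic M T := fun t => by
    ext i j
    exact hfper i j t
  have hAcper : Function.Periodic (complexify A) T := fun t => by simp only [complexify, hAper t]
  rw [← hMP] at hH hsol hpos
  rw [toeplitzC_solves_iff hT hAc hM hH] at hsol
  -- `G` is the derivative that the Lyapunov equation assigns to `M`; in Fourier coefficients the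
  -- equation says that `G` is the distributional derivative of `M`.
  set G : ℝ → Matrix (Fin n) (Fin n) ℂ := fun t =>
    -(M t * complexify A t + (complexify A t)ᴴ * M t + 1) with hG
  have hGper : Function.Periodic G T := fun t => by simp only [hG, hMper t, hAcper t]
  have hi1 := hM.integrable_mul hT hAc
  have hi2 := hAc.conjTranspose.integrable_mul hT hM
  have hone : ∀ i j t, complexify (fun _ => (1 : Matrix (Fin n) (Fin n) ℝ)) t i j =
      (1 : Matrix (Fin n) (Fin n) ℂ) i j := fun i j t => by
    simp [complexify, Matrix.one_apply, apply_ite Complex.ofReal]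
  have hi3 : ∀ c : ℂ, IntervalIntegrable (fun _ : ℝ => c) volume 0 T := fun c => by simp
  choose F hFper hFprim hFae using fun i j => exists_isPrimitiveOn_of_fourierC hT (hf i j)
    (hfper i j) (g := fun t => G t i j) (fun t => by simp only [hGper t])
    (((hi1 i j).add (hi2 i j)).add (hi3 ((1 : Matrix (Fin n) (Fin n) ℂ) i j))).neg (fun k => by
      have h1 := hsol i j k
      simp only [hone] at h1
      have h2 : fourierC T (fun t => G t i j) k =
          -(fourierC T (fun t => (M t * complexify A t) i j) k +
            fourierC T (fun t => ((complexify A t)ᴴ * M t) i j) k +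
            fourierC T (fun _ => (1 : Matrix (Fin n) (Fin n) ℂ) i j) k) := by
        rw [← fourierC_add (hi1 i j) (hi2 i j), ← fourierC_add ((hi1 i j).add (hi2 i j)) (hi3 _),
          ← fourierC_neg]
        rfl
      have h3 : fourierC T (f i j) k = fourierC T (fun t => M t i j) k := rfl
      rw [h2, h3]
      linear_combination -h1)
  set N : ℝ → Matrix (Fin n) (Fin n) ℂ := fun t => Matrix.of fun i j => F i j t with hN
  have hNM : ∀ᵐ t, N t = M t := by
    filter_upwards [ae_all_iff.2 fun i => ae_all_iff.2 fun j => hFae i j] with t ht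
    ext i j
    exact ht i j
  have hNper : Function.Periodic N T := fun t => by
    ext i j
    exact hFper i j t
  have hNprim : ∀ a b, a ≤ b → ∀ i j, IsPrimitiveOn a b (fun t => N t i j)
      (fun t => (-(N t * complexify A t + (complexify A t)ᴴ * N t + 1)) i j) := by
    intro a b hab i j
    refine (hFprim i j a b hab).congr_deriv ?_
    filter_upwards [hNM] with t ht _
    rw [ht]
  have hNcont : ∀ i j, Continuous fun t => N t i j := fun i j =>
    continuous_iff_continuousAt.2 fun t =>
      ((hNprim (t - 1) (t + 1) (by linarith) i j).continuousOn).continuousAt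
        (Icc_mem_nhds (by linarith) (by linarith))
  have hNT : toeplitzC T N = toeplitzC T M := by
    ext p q
    refine fourierC_congr hT ?_ _
    filter_upwards [hNM] with t ht _
    rw [ht]
  rw [← hNT] at hpos
  have hnonneg := quadratic_nonneg_of_isPosDef hT hNcont hNper hpos
  have hbound : ∃ K, ∀ t i j, |(N t i j).re| ≤ K := by
    have h1 : ∀ i j, ∃ K, ∀ t, ‖N t i j‖ ≤ K := fun i j => by
      obtain ⟨K, hK⟩ := isCompact_Icc.exists_bound_of_continuousOn
        (s := Set.Icc 0 T) (hNcont i j).continuousOn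
      refine ⟨K, fun t => ?_⟩
      obtain ⟨s, hs, hst⟩ := hNper.exists_mem_Ico₀ hT t
      rw [hst]
      exact hK s (Set.Ico_subset_Icc_self hs)
    choose K hK using h1
    have hK0 : ∀ i j, 0 ≤ K i j := fun i j => (norm_nonneg _).trans (hK i j 0)
    refine ⟨∑ i, ∑ j, K i j, fun t i j => ?_⟩
    calc |(N t i j).re| ≤ K i j := (Complex.abs_re_le_norm _).trans (hK i j t)
      _ ≤ ∑ j, K i j := Finset.single_le_sum (fun j _ => hK0 i j) (Finset.mem_univ j)
      _ ≤ ∑ i, ∑ j, K i j := Finset.single_le_sum (f := fun i => ∑ j, K i j)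
        (fun i _ => Finset.sum_nonneg fun j _ => hK0 i j) (Finset.mem_univ i)
  obtain ⟨K, hK⟩ := hbound
  -- As `A` is real, the real part of the complex solution solves the same equation, and on real
  -- vectors its form is the real part of the complex form.
  refine globallyAsymptoticallyStable_of_lyapunov hT hAper
    (locIntegrable_of_periodic hT hAper fun i j => intervalIntegrable_of_memLp_Icc hT (hA i j))
    (S := fun t => (N t).map Complex.re) (fun a b hab i j => ?_) (fun t v => ?_) hK
  · refine (hNprim a b hab i j).re.congr_deriv (Filter.Eventually.of_forall fun t _ => ?_)
    rw [complexify_conjTranspose, ← re_mul_complexify,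
      ← re_complexify_mul (A := fun t => (A t)ᵀ) (N t) t]
    simp [Matrix.one_apply]
    split_ifs <;> simp
  · have := hnonneg t (fun i => (v i : ℂ))
    convert this using 1
    simp [dotProduct, Matrix.mulVec, Matrix.map_apply]

end Stability

/-! ### The monodromy matrix, the Stein equation and the periodic Lyapunov solution -/

section Monodromy

variable {n : ℕ} {T : ℝ} {A : ℝ → Matrix (Fin n) (Fin n) ℝ}
  {Φ Ψ : ℝ → Matrix (Fin n) (Fin n) ℝ}

theorem IsPrimitiveOn.comp_add {𝕜 : Type*} [RCLike 𝕜] {a b c : ℝ} {f f' : ℝ → 𝕜}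
    (h : IsPrimitiveOn (a + c) (b + c) f f') :
    IsPrimitiveOn a b (fun t => f (t + c)) (fun t => f' (t + c)) := by
  refine ⟨by linarith [h.le], ?_, fun t ht => ?_⟩
  · simpa using h.integrable.comp_add_right c
  · rw [h.eq_integral (t + c) ⟨by linarith [ht.1], by linarith [ht.2]⟩,
      intervalIntegral.integral_comp_add_right]

theorem IsFundamental.isPrimitiveOn_mulVec (h : IsFundamental A 0 Φ Ψ) (v : Fin n → ℝ) {b : ℝ}
    (hb : 0 ≤ b) (i : Fin n) :
    IsPrimitiveOn 0 b (fun t => (Φ t *ᵥ v) i) (fun t => (A t *ᵥ (Φ t *ᵥ v)) i) := by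
  have h1 := HarmonicLyapunov.isPrimitiveOn_mulVec hb (F' := fun t => A t * Φ t)
    (x := fun _ => v) (x' := fun _ => 0) (h.deriv b hb) (fun i => IsPrimitiveOn.const hb (v i)) i
  simpa using h1

/-- By periodicity of `A`, each column of `t ↦ Φ(t + T)` is again a solution on `[0, ∞)`, with the
corresponding column of `Φ(T)` as initial value. -/
theorem IsFundamental.add_period (h : IsFundamental A 0 Φ Ψ) (hT : 0 < T)
    (hper : Function.Periodic A T) {t : ℝ} (ht : 0 ≤ t) : Φ (t + T) = Φ t * Φ T := by
  refine Matrix.ext_of_mulVec_single fun j => ?_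
  set v : Fin n → ℝ := Pi.single j 1
  have h1 : ∀ i, IsPrimitiveOn 0 t (fun t => (Φ (t + T) *ᵥ v) i)
      (fun t => (A t *ᵥ (Φ (t + T) *ᵥ v)) i) := fun i => by
    have h2 := (h.isPrimitiveOn_mulVec v (b := t + T) (by linarith) i).mono_left
      (c := 0 + T) (by linarith) (by linarith)
    simpa only [hper _] using h2.comp_add
  have h2 := h.eq_mulVec ht h1 t ⟨ht, le_rfl⟩
  rw [h2, zero_add, Matrix.mulVec_mulVec]

theorem IsFundamental.pow_period (h : IsFundamental A 0 Φ Ψ) (hT : 0 < T)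
    (hper : Function.Periodic A T) (k : ℕ) : Φ (k * T) = Φ T ^ k := by
  induction k with
  | zero => simp [h.init]
  | succ k ih =>
    rw [show ((k + 1 : ℕ) : ℝ) * T = k * T + T by push_cast; ring,
      h.add_period hT hper (by positivity), ih, pow_succ]

/-- The columns of `Φ` are solutions, so they tend to zero; sampling them at multiples of the period
gives the powers of `Φ(T)`. -/
theorem IsFundamental.tendsto_pow (h : IsFundamental A 0 Φ Ψ) (hT : 0 < T)
    (hper : Function.Periodic A T) (hstab : GloballyAsymptoticallyStable A) :
    Filter.Tendsto (fun k : ℕ => Φ T ^ k) Filter.atTop (nhds 0) := by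
  refine tendsto_pi_nhds.2 fun i => tendsto_pi_nhds.2 fun j => ?_
  have hsol : IsSolution A 0 fun t => Φ t *ᵥ Pi.single j 1 :=
    isSolution_of_isPrimitiveOn fun b hb => h.isPrimitiveOn_mulVec _ hb
  have h1 := tendsto_pi_nhds.1 ((hstab 0).2 _ hsol) i
  have h2 : Filter.Tendsto (fun k : ℕ => (k : ℝ) * T) Filter.atTop Filter.atTop :=
    tendsto_natCast_atTop_atTop.atTop_mul_const hT
  have h3 := h1.comp h2
  simpa [Function.comp_def, h.pow_period hT hper] using h3

/-- The discrete Lyapunov equation of a stable matrix. -/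
theorem stein_injective {𝕜 : Type*} [RCLike 𝕜] {M N X : Matrix (Fin n) (Fin n) 𝕜}
    (hM : Filter.Tendsto (fun k : ℕ => M ^ k) Filter.atTop (nhds 0))
    (hN : Filter.Tendsto (fun k : ℕ => N ^ k) Filter.atTop (nhds 0)) (hX : X = N * X * M) :
    X = 0 := by
  have h1 : ∀ k : ℕ, X = N ^ k * X * M ^ k := fun k => by
    induction k with
    | zero => simp
    | succ k ih =>
      calc X = N ^ k * X * M ^ k := ih
        _ = N ^ k * (N * X * M) * M ^ k := by rw [← hX]
        _ = N ^ (k + 1) * X * M ^ (k + 1) := by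
          rw [pow_succ N, pow_succ' M]; simp only [Matrix.mul_assoc]
  have h2 : Filter.Tendsto (fun k : ℕ => N ^ k * X * M ^ k) Filter.atTop (nhds (0 * X * 0)) :=
    (hN.mul tendsto_const_nhds).mul hM
  simp only [← h1, mul_zero] at h2
  exact tendsto_nhds_unique tendsto_const_nhds h2

theorem tendsto_transpose_pow {M : Matrix (Fin n) (Fin n) ℝ}
    (hM : Filter.Tendsto (fun k : ℕ => M ^ k) Filter.atTop (nhds 0)) :
    Filter.Tendsto (fun k : ℕ => Mᵀ ^ k) Filter.atTop (nhds 0) := by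
  have := (continuous_id.matrix_transpose (R := ℝ)).continuousAt.tendsto.comp hM
  simpa [Function.comp_def, Matrix.transpose_pow] using this

/-- In finite dimension the injectivity of `X ↦ X - MᵀXM` gives surjectivity. -/
theorem exists_stein {M : Matrix (Fin n) (Fin n) ℝ}
    (hM : Filter.Tendsto (fun k : ℕ => M ^ k) Filter.atTop (nhds 0))
    (S : Matrix (Fin n) (Fin n) ℝ) : ∃ X, X - Mᵀ * X * M = S := by
  let L : Matrix (Fin n) (Fin n) ℝ →ₗ[ℝ] Matrix (Fin n) (Fin n) ℝ :=
    LinearMap.id - (LinearMap.mulRight ℝ M) ∘ₗ (LinearMap.mulLeft ℝ Mᵀ)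
  have hL : ∀ X, L X = X - Mᵀ * X * M := fun X => by simp [L]
  have hinj : Function.Injective L := by
    rw [← LinearMap.ker_eq_bot, LinearMap.ker_eq_bot']
    intro X hX
    rw [hL, sub_eq_zero] at hX
    exact stein_injective hM (tendsto_transpose_pow hM) hX
  obtain ⟨X, hX⟩ := LinearMap.injective_iff_surjective.1 hinj S
  exact ⟨X, by rw [← hL, hX]⟩

theorem integral_pos_of_ae {a b : ℝ} (hab : a < b) {f : ℝ → ℝ} (hf : IntervalIntegrable f volume a b)
    (h0 : ∀ᵐ t, t ∈ Set.Ioc a b → 0 ≤ f t) (hne : ¬ ∀ᵐ t, t ∈ Set.Ioc a b → f t = 0) :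
    0 < ∫ t in a..b, f t := by
  have h0' : 0 ≤ᵐ[volume.restrict (Set.Ioc a b)] f := (ae_restrict_iff' measurableSet_Ioc).2 h0
  rw [intervalIntegral.integral_of_le hab.le]
  refine lt_of_le_of_ne (integral_nonneg_of_ae h0') fun h => hne ?_
  have := (integral_eq_zero_iff_of_nonneg_ae h0' hf.1).1 h.symm
  exact (ae_restrict_iff' measurableSet_Ioc).1 this

variable {Q : ℝ → Matrix (Fin n) (Fin n) ℝ}

/-- The periodic solution of the differential Lyapunov equation of a stable system. -/
theorem exists_periodic_lyapunov (hT : 0 < T) (hper : Function.Periodic A T)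
    (hA : LocIntegrable A) (hstab : GloballyAsymptoticallyStable A)
    (hQ : ∀ i j, IntervalIntegrable (fun t => Q t i j) volume 0 T) (hQpos : ∀ᵐ t, (Q t).PosDef) :
    ∃ P : ℝ → Matrix (Fin n) (Fin n) ℝ,
      (∀ i j, IsPrimitiveOn 0 T (fun t => P t i j)
        (fun t => (-(P t * A t + (A t)ᵀ * P t + Q t)) i j)) ∧
      P T = P 0 ∧ (∀ t ∈ Set.Icc 0 T, (P t)ᵀ = P t) ∧
      ∀ t ∈ Set.Icc 0 T, ∀ v, v ≠ 0 → 0 < v ⬝ᵥ P t *ᵥ v := by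
  obtain ⟨Φ, Ψ, hΦ, -⟩ := exists_isFundamental hA 0
  set M := Φ T with hMdef
  have hM : Filter.Tendsto (fun k : ℕ => M ^ k) Filter.atTop (nhds 0) :=
    hΦ.tendsto_pow hT hper hstab
  -- With the ansatz `P = ΨᵀWΨ` the Lyapunov equation reduces to `W' = -ΦᵀQΦ`.
  set G : ℝ → Matrix (Fin n) (Fin n) ℝ := fun t => (Φ t)ᵀ * Q t * Φ t with hG
  have hΦc : ∀ i j, ContinuousOn (fun t => Φ t i j) (Set.uIcc 0 T) := fun i j => by
    rw [Set.uIcc_of_le hT.le]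
    exact (hΦ.deriv T hT.le i j).continuousOn
  have hGint : ∀ i j, IntervalIntegrable (fun t => G t i j) volume 0 T := fun i j => by
    simp only [hG, Matrix.mul_apply, Matrix.transpose_apply]
    exact intervalIntegrable_fun_sum fun l _ => (intervalIntegrable_fun_sum fun m _ =>
      (hQ m l).continuousOn_mul (hΦc m i)).mul_continuousOn (hΦc l j)
  -- `P(T) = P(0)` means `W(T) = MᵀP₀M`, which is the Stein equation for the initial value `P₀`.
  obtain ⟨P₀, hP₀⟩ := exists_stein hM (Matrix.of fun i j => ∫ t in (0 : ℝ)..T, G t i j)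
  set W : ℝ → Matrix (Fin n) (Fin n) ℝ := fun t =>
    Matrix.of fun i j => P₀ i j - ∫ s in (0 : ℝ)..t, G s i j with hW
  have hWprim : ∀ i j, IsPrimitiveOn 0 T (fun t => W t i j) (fun t => (-G t) i j) := fun i j => by
    simpa [hW, sub_eq_add_neg] using
      (IsPrimitiveOn.const hT.le (P₀ i j)).sub (IsPrimitiveOn.of_integral hT.le (hGint i j) 0)
  have hW0 : W 0 = P₀ := by ext i j; simp [hW]
  have hWT : W T = Mᵀ * P₀ * M := by
    rw [sub_eq_iff_eq_add, ← sub_eq_iff_eq_add'] at hP₀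
    rw [← hP₀]
    ext i j
    simp [hW]
  have hQsymm : ∀ᵐ t, (Q t)ᵀ = Q t := by
    filter_upwards [hQpos] with t ht
    simpa [Matrix.conjTranspose_eq_transpose_of_trivial] using ht.isHermitian.eq
  have hGsymm : ∀ᵐ t, ∀ i j, G t i j = G t j i := by
    filter_upwards [hQsymm] with t ht i j
    have : (G t)ᵀ = G t := by simp [hG, Matrix.transpose_mul, ht, Matrix.mul_assoc]
    exact congrFun (congrFun this j) i
  have hIsymm : ∀ t i j, ∫ s in (0 : ℝ)..t, G s i j = ∫ s in (0 : ℝ)..t, G s j i :=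
    fun t i j => intervalIntegral.integral_congr_ae (by
      filter_upwards [hGsymm] with s hs _ using hs i j)
  -- The transpose solves the same Stein equation, whose solution is unique.
  have hP₀symm : P₀ᵀ = P₀ := by
    have h1 : P₀ᵀ - Mᵀ * P₀ᵀ * M = P₀ - Mᵀ * P₀ * M := by
      have h2 := congrArg Matrix.transpose hP₀
      rw [Matrix.transpose_sub, Matrix.transpose_mul, Matrix.transpose_mul,
        Matrix.transpose_transpose, ← Matrix.mul_assoc] at h2
      rw [h2, hP₀]
      ext i j
      exact hIsymm T j i
    refine sub_eq_zero.1 (stein_injective hM (tendsto_transpose_pow hM) ?_)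
    rw [Matrix.mul_sub, Matrix.sub_mul]
    rw [sub_eq_sub_iff_sub_eq_sub] at h1
    exact h1
  have hWsymm : ∀ t, (W t)ᵀ = W t := fun t => by
    ext i j
    simp only [hW, Matrix.transpose_apply, Matrix.of_apply, hIsymm t j i]
    rw [show P₀ j i = P₀ i j from congrFun (congrFun hP₀symm i) j]
  have hquad : ∀ v, IsPrimitiveOn 0 T (fun t => v ⬝ᵥ W t *ᵥ v)
      (fun t => -((Φ t *ᵥ v) ⬝ᵥ Q t *ᵥ (Φ t *ᵥ v))) := fun v => by
    have h1 := HarmonicLyapunov.isPrimitiveOn_mulVec hT.le (F' := fun t => -G t)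
      (x := fun _ => v) (x' := fun _ => 0) hWprim (fun i => IsPrimitiveOn.const hT.le (v i))
    have h2 := IsPrimitiveOn.sum hT.le Finset.univ fun i _ => (h1 i).const_mul (v i)
    refine h2.congr_deriv (Filter.Eventually.of_forall fun t _ => ?_)
    change v ⬝ᵥ (-G t *ᵥ v + W t *ᵥ 0) = _
    rw [Matrix.mulVec_zero, add_zero, Matrix.neg_mulVec, dotProduct_neg, hG]
    simp only [← Matrix.mulVec_mulVec]
    rw [Matrix.dotProduct_mulVec, Matrix.vecMul_transpose]
  have hMinv : ∀ v, v ≠ 0 → M *ᵥ v ≠ 0 := fun v hv h0 => hv (by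
    have := congrArg (Ψ T *ᵥ ·) h0
    simpa [hMdef, hΦ.inv_mul hT.le] using this)
  have hΦinv : ∀ t, 0 ≤ t → ∀ v, v ≠ 0 → Φ t *ᵥ v ≠ 0 := fun t ht v hv h0 => hv (by
    have := congrArg (Ψ t *ᵥ ·) h0
    simpa [hΦ.inv_mul ht] using this)
  have hQnonneg : ∀ v, ∀ᵐ t, 0 ≤ (Φ t *ᵥ v) ⬝ᵥ Q t *ᵥ (Φ t *ᵥ v) := fun v => by
    filter_upwards [hQpos] with t ht
    simpa using ht.posSemidef.dotProduct_mulVec_nonneg (Φ t *ᵥ v)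
  have hWTquad : ∀ v, v ⬝ᵥ W T *ᵥ v = (M *ᵥ v) ⬝ᵥ P₀ *ᵥ (M *ᵥ v) := fun v => by
    rw [hWT]
    simp only [← Matrix.mulVec_mulVec]
    rw [Matrix.dotProduct_mulVec, Matrix.vecMul_transpose]
  have hstep : ∀ v t, t ∈ Set.Icc 0 T → v ⬝ᵥ W T *ᵥ v ≤ v ⬝ᵥ W t *ᵥ v := fun v t ht => by
    have h1 := ((hquad v).mono_left ht.1 ht.2).integral_eq_sub
    have h2 : 0 ≤ ∫ s in t..T, (Φ s *ᵥ v) ⬝ᵥ Q s *ᵥ (Φ s *ᵥ v) :=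
      intervalIntegral.integral_nonneg_of_ae ht.2 (hQnonneg v)
    rw [intervalIntegral.integral_neg] at h1
    linarith
  have hstrict : ∀ v, v ≠ 0 → v ⬝ᵥ W T *ᵥ v < v ⬝ᵥ W 0 *ᵥ v := fun v hv => by
    have h1 := (hquad v).integral_eq_sub
    rw [intervalIntegral.integral_neg] at h1
    have h2 : 0 < ∫ s in (0 : ℝ)..T, (Φ s *ᵥ v) ⬝ᵥ Q s *ᵥ (Φ s *ᵥ v) := by
      refine integral_pos_of_ae hT (by simpa only [Pi.neg_def, neg_neg] using (hquad v).integrable.neg)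
        (by filter_upwards [hQnonneg v] with t ht _ using ht) fun h0 => ?_
      have h3 : ∀ᵐ t : ℝ, t ∉ Set.Ioc 0 T := by
        filter_upwards [h0, hQpos] with t ht htp htm
        have := htp.dotProduct_mulVec_pos (hΦinv t htm.1.le v hv)
        simp only [star_trivial] at this
        exact this.ne' (ht htm)
      have h4 := measure_eq_zero_iff_ae_notMem.2 h3
      simp [Real.volume_Ioc] at h4
      linarith
    linarith
  have hle : ∀ v, (M *ᵥ v) ⬝ᵥ P₀ *ᵥ (M *ᵥ v) ≤ v ⬝ᵥ P₀ *ᵥ v := fun v => by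
    have := hstep v 0 ⟨le_rfl, hT.le⟩
    rwa [hWTquad, hW0] at this
  -- The form of `P₀` does not increase along `v, Mv, M²v, …`, and `M^k v → 0`, so its initial value
  -- is at least zero.
  have hP₀nonneg : ∀ v, 0 ≤ v ⬝ᵥ P₀ *ᵥ v := fun v => by
    have h1 : ∀ k : ℕ, (M ^ k *ᵥ v) ⬝ᵥ P₀ *ᵥ (M ^ k *ᵥ v) ≤ v ⬝ᵥ P₀ *ᵥ v := fun k => by
      induction k with
      | zero => simp
      | succ k ih =>
        refine le_trans ?_ ih
        rw [pow_succ', ← Matrix.mulVec_mulVec]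
        exact hle _
    have hc : Continuous fun X : Matrix (Fin n) (Fin n) ℝ => (X *ᵥ v) ⬝ᵥ P₀ *ᵥ (X *ᵥ v) := by
      fun_prop
    have h2 := (hc.tendsto 0).comp hM
    simp only [Matrix.zero_mulVec, zero_dotProduct] at h2
    exact le_of_tendsto' h2 h1
  -- Semidefiniteness at `Mv` and the strict decrease over a period give definiteness at `v`.
  have hP₀pos : ∀ v, v ≠ 0 → 0 < v ⬝ᵥ P₀ *ᵥ v := fun v hv => by
    have := hstrict v hv
    rw [hWTquad, hW0] at this
    exact (hP₀nonneg _).trans_lt this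
  refine ⟨fun t => (Ψ t)ᵀ * W t * Ψ t, fun i j => ?_, ?_, fun t _ => ?_, fun t ht v hv => ?_⟩
  · have h1 : ∀ i j, IsPrimitiveOn 0 T (fun t => (Ψ t)ᵀ i j) (fun t => (-(Ψ t * A t)ᵀ) i j) :=
      fun i j => hΦ.deriv_inv T hT.le j i
    have h2 := isPrimitiveOn_mul_matrix hT.le (isPrimitiveOn_mul_matrix hT.le h1 hWprim)
      (G' := fun t => -(Ψ t * A t)) (hΦ.deriv_inv T hT.le) i j
    refine h2.congr_deriv (Filter.Eventually.of_forall fun t ht => ?_)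
    have h3 : (Ψ t)ᵀ * G t * Ψ t = Q t := by
      have h4 := hΦ.mul_inv ht.1.le
      have h5 : (Ψ t)ᵀ * (Φ t)ᵀ = 1 := by rw [← Matrix.transpose_mul, h4, Matrix.transpose_one]
      calc (Ψ t)ᵀ * G t * Ψ t = ((Ψ t)ᵀ * (Φ t)ᵀ) * Q t * (Φ t * Ψ t) := by
            simp only [hG, Matrix.mul_assoc]
        _ = Q t := by rw [h4, h5, Matrix.one_mul, Matrix.mul_one]
    have h4 : (-(Ψ t * A t)ᵀ * W t + (Ψ t)ᵀ * -G t) * Ψ t + (Ψ t)ᵀ * W t * -(Ψ t * A t) =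
        -((Ψ t)ᵀ * W t * Ψ t * A t + (A t)ᵀ * ((Ψ t)ᵀ * W t * Ψ t) + Q t) := by
      rw [← h3, Matrix.transpose_mul]
      noncomm_ring
    rw [h4]
  · have h1 : (Ψ T)ᵀ * Mᵀ = 1 := by
      rw [← Matrix.transpose_mul, hΦ.mul_inv hT.le, Matrix.transpose_one]
    have h2 : M * Ψ T = 1 := hΦ.mul_inv hT.le
    calc (Ψ T)ᵀ * W T * Ψ T = ((Ψ T)ᵀ * Mᵀ) * P₀ * (M * Ψ T) := by
          rw [hWT]; simp only [Matrix.mul_assoc]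
      _ = (Ψ 0)ᵀ * W 0 * Ψ 0 := by rw [h1, h2, hΦ.init_inv, hW0, Matrix.transpose_one]
  · simp [Matrix.transpose_mul, hWsymm, Matrix.mul_assoc]
  · have hΨv : Ψ t *ᵥ v ≠ 0 := fun h0 => hv (by
      have := congrArg (Φ t *ᵥ ·) h0
      simpa [hΦ.mul_inv ht.1] using this)
    simp only [← Matrix.mulVec_mulVec]
    rw [Matrix.dotProduct_mulVec, Matrix.vecMul_transpose]
    -- With `w = Ψ(t)v`, the form is `w · W(t)w ≥ w · W(T)w = Mw · P₀Mw > 0`.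
    refine lt_of_lt_of_le ?_ (hstep _ t ht)
    rw [hWTquad]
    exact hP₀pos _ (hMinv _ hΨv)

end Monodromy

/-! ### From the periodic solution to the harmonic solution -/

section Existence

variable {n : ℕ} {T : ℝ} {A Q P : ℝ → Matrix (Fin n) (Fin n) ℝ}

theorem re_quadratic_map (S : Matrix (Fin n) (Fin n) ℝ) (v : Fin n → ℂ) :
    (star v ⬝ᵥ S.map Complex.ofReal *ᵥ v).re =
      (fun i => (v i).re) ⬝ᵥ S *ᵥ (fun i => (v i).re) +
        (fun i => (v i).im) ⬝ᵥ S *ᵥ (fun i => (v i).im) := by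
  simp only [dotProduct, Matrix.mulVec, Matrix.map_apply, Complex.re_sum, Complex.mul_re,
    Pi.star_apply, Complex.star_def, Complex.conj_re, Complex.conj_im, Complex.im_sum,
    Complex.mul_im, Complex.ofReal_re, Complex.ofReal_im, ← Finset.sum_add_distrib]
  refine Finset.sum_congr rfl fun i _ => ?_
  simp

/-- The block Toeplitz matrix of a periodic solution of the differential Lyapunov equation solves
the harmonic Lyapunov equation. -/
theorem toeplitzC_isSolution (hT : 0 < T) (hA : SqIntegrableMatrix T (complexify A))
    (hQ : ∀ i j, IntervalIntegrable (fun t => Q t i j) volume 0 T)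
    (hP : ∀ i j, IsPrimitiveOn 0 T (fun t => P t i j)
        (fun t => (-(P t * A t + (A t)ᵀ * P t + Q t)) i j))
    (hPT : P T = P 0) (hsymm : ∀ t ∈ Set.Icc 0 T, (P t)ᵀ = P t)
    (hpos : ∀ t ∈ Set.Icc 0 T, ∀ v, v ≠ 0 → 0 < v ⬝ᵥ P t *ᵥ v) :
    IsAdmissible (toeplitzC T (complexify P)) ∧ (toeplitzC T (complexify P)).IsHermitian ∧
      IsPosDef (toeplitzC T (complexify P)) ∧
      SolvesHarmonicLyapunov T A Q (toeplitzC T (complexify P)) := by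
  have hPc : ∀ i j, ContinuousOn (fun t => complexify P t i j) (Set.Icc 0 T) := fun i j =>
    (hP i j).ofReal.continuousOn
  have hPs : SqIntegrableMatrix T (complexify P) := fun i j => sqIntegrable_of_continuousOn (hPc i j)
  have hH : (toeplitzC T (complexify P)).IsHermitian := by
    ext p q
    rw [Matrix.conjTranspose_apply]
    refine (conj_toeplitzC p q).trans ?_
    refine fourierC_congr hT (Filter.Eventually.of_forall fun t ht => ?_) _
    have h1 : (complexify P t)ᴴ = complexify P t := by
      rw [complexify_conjTranspose, complexify, complexify, hsymm t (Set.Ioc_subset_Icc_self ht)]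
    exact congrFun (congrFun h1 p.2) q.2
  refine ⟨isAdmissible_toeplitzC hT hPs, hH, ?_, ?_⟩
  · intro X hX0 hX _
    obtain ⟨x, hx, rfl⟩ := exists_fourierVec_eq hT (memℓp_two_iff.1 hX)
    have hMx : ∀ i, SqIntegrable T fun t => (complexify P t *ᵥ x t) i := fun i => by
      simp only [Matrix.mulVec, dotProduct]
      exact memLp_finsetSum _ fun j _ => (hx j).mul_continuousOn (hPc i j)
    have hint : IntervalIntegrable (fun t => star (x t) ⬝ᵥ (complexify P t *ᵥ x t)) volume 0 T :=
      intervalIntegrable_fun_sum (s := Finset.univ)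
        (f := fun i t => star (x t i) * (complexify P t *ᵥ x t) i)
        fun i _ => (hx i).conj.integrable_mul hT (hMx i)
    rw [(hasSum_toeplitzC_quadratic hT hPs hx hMx).tsum_eq,
      show (1 / T : ℂ) = ((1 / T : ℝ) : ℂ) by push_cast; rfl, Complex.re_ofReal_mul]
    have hre := Complex.reCLM.intervalIntegral_comp_comm hint
    simp only [Complex.reCLM_apply] at hre
    rw [← hre]
    have hnonneg : ∀ t ∈ Set.Icc 0 T, ∀ v, 0 ≤ v ⬝ᵥ P t *ᵥ v := fun t ht v => by
      rcases eq_or_ne v 0 with rfl | hv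
      · simp
      · exact (hpos t ht v hv).le
    refine mul_pos (by positivity) (integral_pos_of_ae hT ⟨hint.1.re, hint.2.re⟩
      (Filter.Eventually.of_forall fun t ht => ?_) fun h0 => hX0 ?_)
    · simp only [complexify, re_quadratic_map]
      exact add_nonneg (hnonneg t (Set.Ioc_subset_Icc_self ht) _)
        (hnonneg t (Set.Ioc_subset_Icc_self ht) _)
    -- The integrand is the sum of the forms at the real and imaginary parts of `x`. If it vanishes
    -- almost everywhere then so does `x`, and all Fourier coefficients are zero.
    · have hz : ∀ᵐ t, t ∈ Set.Ioc 0 T → x t = 0 := by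
        filter_upwards [h0] with t ht htm
        have h1 := ht htm
        simp only [complexify, re_quadratic_map] at h1
        have hm := Set.Ioc_subset_Icc_self htm
        have h2 := hnonneg t hm (fun i => (x t i).re)
        have h3 := hnonneg t hm (fun i => (x t i).im)
        by_contra hne
        by_cases hre0 : (fun i => (x t i).re) = 0
        · have him : (fun i => (x t i).im) ≠ 0 := fun him => hne (by
            funext i
            exact Complex.ext (congrFun hre0 i) (congrFun him i))
          have := hpos t hm _ him
          linarith
        · have := hpos t hm _ hre0
          linarith
      funext p
      have h4 := fourierC_congr (f := fun t => x t p.2) (g := fun _ => 0) hT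
        (by filter_upwards [hz] with t ht htm; rw [ht htm]; rfl) p.1
      change fourierC T (fun t => x t p.2) p.1 = 0
      rw [h4]
      simp [fourierC]
  · rw [toeplitzC_solves_iff hT hA hPs hH]
    intro i j k
    have h1 := fourierC_deriv (hP i j).ofReal hT (by rw [hPT]) k
    have h2 : fourierC T (fun t => (((-(P t * A t + (A t)ᵀ * P t + Q t)) i j : ℝ) : ℂ)) k =
        -(fourierC T (fun t => (complexify P t * complexify A t) i j) k
          + fourierC T (fun t => ((complexify A t)ᴴ * complexify P t) i j) k
          + fourierC T (fun t => complexify Q t i j) k) := by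
      have hi1 := hPs.integrable_mul hT hA i j
      have hi2 := hA.conjTranspose.integrable_mul hT hPs i j
      have hi3 : IntervalIntegrable (fun t => complexify Q t i j) volume 0 T :=
        ⟨(hQ i j).1.ofReal, (hQ i j).2.ofReal⟩
      rw [← fourierC_add hi1 hi2, ← fourierC_add (hi1.add hi2) hi3, ← fourierC_neg]
      congr 1
      funext t
      simp [complexify, Matrix.mul_apply]
    rw [h2] at h1
    have h3 : fourierC T (fun t => ((P t i j : ℝ) : ℂ)) k =
      fourierC T (fun t => complexify P t i j) k := rfl
    rw [h3] at h1
    linear_combination -h1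

end Existence

/-! ### Logarithms of invertible complex matrices -/

section MatrixLog

variable {n : ℕ}

/-- The determinant is a polynomial in `z` with value `1` at `0`. -/
theorem finite_det_one_add_smul_eq_zero (N : Matrix (Fin n) (Fin n) ℂ) :
    {z : ℂ | (1 + z • N).det = 0}.Finite := by
  set p : Polynomial ℂ := (1 + (Polynomial.X : Polynomial ℂ) • N.map Polynomial.C).det with hp
  have heval : ∀ z, p.eval z = (1 + z • N).det := fun z => by
    rw [hp, ← Polynomial.coe_evalRingHom, RingHom.map_det]
    congr 1
    ext i j
    by_cases hij : i = j <;> simp [hij] <;> ring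
  have hp0 : p ≠ 0 := fun h0 => by
    have := heval 0
    simp [h0] at this
  refine (p.roots.toFinset.finite_toSet).subset fun z hz => ?_
  simp only [Finset.mem_coe, Multiset.mem_toFinset, Polynomial.mem_roots hp0, Polynomial.IsRoot,
    heval]
  exact hz

/-- The identity and an invertible matrix are joined by a curve of invertible matrices in the
affine line through them. -/
theorem exists_curve_det_ne_zero {M : Matrix (Fin n) (Fin n) ℂ} (hM : M.det ≠ 0) :
    ∃ ε : ℝ, ∀ s : ℝ, (1 + ((s : ℂ) + ε * s * (1 - s) * Complex.I) • (M - 1)).det ≠ 0 := by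
  -- A point `w = s + iεs(1 - s)` with `s ≠ 0, 1` determines `ε` as `im w / (re w (1 - re w))`, so
  -- the finitely many zeros of the determinant exclude only finitely many `ε`.
  have hfin := (finite_det_one_add_smul_eq_zero (M - 1)).image
    fun w : ℂ => w.im / (w.re * (1 - w.re))
  obtain ⟨ε, hε⟩ := hfin.infinite_compl.nonempty
  refine ⟨ε, fun s hs => ?_⟩
  rcases eq_or_ne s 0 with rfl | h0
  · simp at hs
  rcases eq_or_ne s 1 with rfl | h1
  · simp at hs
    exact hM hs
  refine hε ⟨_, hs, ?_⟩
  have h1' : 1 - s ≠ 0 := sub_ne_zero.2 h1.symm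
  simp
  field_simp

attribute [local instance] Matrix.linftyOpNormedRing Matrix.linftyOpNormedAlgebra

theorem commute_intervalIntegral {X : Matrix (Fin n) (Fin n) ℂ} {ρ : ℝ → Matrix (Fin n) (Fin n) ℂ}
    (hρ : Continuous ρ) (h : ∀ s, Commute X (ρ s)) (a b : ℝ) : Commute X (∫ s in a..b, ρ s) := by
  have h1 := (ContinuousLinearMap.mul ℝ (Matrix (Fin n) (Fin n) ℂ) X).intervalIntegral_comp_comm
    (hρ.intervalIntegrable (μ := volume) a b)
  have h2 := ((ContinuousLinearMap.mul ℝ (Matrix (Fin n) (Fin n) ℂ)).flip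
    X).intervalIntegral_comp_comm (hρ.intervalIntegrable (μ := volume) a b)
  simp only [ContinuousLinearMap.mul_apply', ContinuousLinearMap.flip_apply] at h1 h2
  rw [Commute, SemiconjBy, ← h1, ← h2]
  congr 1
  funext s
  exact h s

/-- Commutation gives `exp (I u) = exp (I s) exp (I u - I s)`, reducing the claim to the derivative
of `exp` at zero. -/
theorem hasDerivAt_exp_of_commute {I : ℝ → Matrix (Fin n) (Fin n) ℂ}
    {I' : Matrix (Fin n) (Fin n) ℂ} {s : ℝ} (hI : HasDerivAt I I' s)
    (hc : ∀ u, Commute (I s) (I u)) :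
    HasDerivAt (fun u => NormedSpace.exp (I u)) (NormedSpace.exp (I s) * I') s := by
  have h1 : ∀ u, NormedSpace.exp (I u) = NormedSpace.exp (I s) * NormedSpace.exp (I u - I s) :=
    fun u => by
      rw [← Matrix.exp_add_of_commute _ _ ((hc u).sub_right (Commute.refl _)), add_sub_cancel]
  rw [funext h1]
  refine HasDerivAt.const_mul _ ?_
  have h2 : HasFDerivAt (NormedSpace.exp : Matrix (Fin n) (Fin n) ℂ → _)
      (1 : Matrix (Fin n) (Fin n) ℂ →L[ℝ] Matrix (Fin n) (Fin n) ℂ) (I s - I s) := by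
    rw [sub_self]; exact hasFDerivAt_exp_zero
  exact h2.comp_hasDerivAt s (hI.sub_const (I s))

/-- The exponential map is onto the invertible complex matrices. -/
theorem exists_matrix_exp_eq {M : Matrix (Fin n) (Fin n) ℂ} (hM : M.det ≠ 0) :
    ∃ R, NormedSpace.exp R = M := by
  obtain ⟨ε, hε⟩ := exists_curve_det_ne_zero hM
  set N := M - 1 with hN
  set z : ℝ → ℂ := fun s => (s : ℂ) + ε * s * (1 - s) * Complex.I with hz
  set z' : ℝ → ℂ := fun s => 1 + ε * (1 - 2 * s) * Complex.I with hz'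
  have hzd : ∀ s, HasDerivAt z (z' s) s := fun s => by
    have h1 : HasDerivAt (fun s : ℝ => (s : ℂ)) 1 s := Complex.ofRealCLM.hasDerivAt (x := s)
    have h2 := h1.add (((h1.const_mul (ε : ℂ)).mul (h1.const_sub 1)).mul_const Complex.I)
    refine h2.congr_deriv ?_
    simp only [hz']
    ring
  set Z : ℝ → Matrix (Fin n) (Fin n) ℂ := fun s => 1 + z s • N with hZ
  have hZu : ∀ s, IsUnit (Z s).det := fun s => isUnit_iff_ne_zero.2 (hε s)
  have hZd : ∀ s, HasDerivAt Z (z' s • N) s := fun s => ((hzd s).smul_const N).const_add 1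
  have hZc : Continuous Z := continuous_iff_continuousAt.2 fun s => (hZd s).continuousAt
  have hZic : Continuous fun s => (Z s)⁻¹ := by
    simp only [Matrix.inv_def, Ring.inverse_eq_inv']
    exact (hZc.matrix_det.inv₀ hε).smul hZc.matrix_adjugate
  -- `ρ = Z'Z⁻¹` is the logarithmic derivative of the curve from `1` to `M`. All values commute, so
  -- `exp (-∫ρ) Z` is constant and `∫₀¹ ρ` is a logarithm of `M`.
  set ρ : ℝ → Matrix (Fin n) (Fin n) ℂ := fun s => z' s • (N * (Z s)⁻¹) with hρ
  have hρc : Continuous ρ := by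
    have : Continuous z' := by fun_prop
    exact this.smul (continuous_const.mul hZic)
  have hcomm : ∀ X, Commute X N → ∀ s, Commute X (ρ s) := fun X hX s => by
    have h1 : Commute X (Z s) := (Commute.one_right X).add_right (hX.smul_right _)
    have h2 : Commute X (Z s)⁻¹ := by
      have h3 : X = (Z s)⁻¹ * X * Z s := by
        rw [Matrix.mul_assoc, h1.eq, ← Matrix.mul_assoc, Matrix.nonsing_inv_mul _ (hZu s),
          Matrix.one_mul]
      calc X * (Z s)⁻¹ = (Z s)⁻¹ * X * Z s * (Z s)⁻¹ := by rw [← h3]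
        _ = (Z s)⁻¹ * X := by
          rw [Matrix.mul_assoc, Matrix.mul_nonsing_inv _ (hZu s), Matrix.mul_one]
    exact (hX.mul_right h2).smul_right _
  set I : ℝ → Matrix (Fin n) (Fin n) ℂ := fun s => -∫ r in (0 : ℝ)..s, ρ r with hI
  have hId : ∀ s, HasDerivAt I (-ρ s) s := fun s =>
    (hρc.integral_hasStrictDerivAt 0 s).hasDerivAt.neg
  have hIN : ∀ s, Commute (I s) N := fun s =>
    ((commute_intervalIntegral hρc (hcomm N (Commute.refl N)) 0 s).neg_right).symm
  have hII : ∀ s u, Commute (I s) (I u) := fun s u =>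
    (commute_intervalIntegral hρc (hcomm (I s) (hIN s)) 0 u).neg_right
  have hder : ∀ s, HasDerivAt (fun s => NormedSpace.exp (I s) * Z s) 0 s := fun s => by
    have h1 := (hasDerivAt_exp_of_commute (hId s) (hII s)).mul (hZd s)
    refine h1.congr_deriv ?_
    have h2 : ρ s * Z s = z' s • N := by
      simp only [hρ]
      rw [smul_mul_assoc, Matrix.mul_assoc, Matrix.nonsing_inv_mul _ (hZu s), Matrix.mul_one]
    rw [mul_neg, neg_mul, mul_assoc, h2, neg_add_cancel]
  have hconst := is_const_of_deriv_eq_zero (fun s => (hder s).differentiableAt)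
    (fun s => (hder s).deriv) 1 0
  have hZ0 : Z 0 = 1 := by simp [hZ, hz]
  have hZ1 : Z 1 = M := by simp [hZ, hz, hN]
  have hI0 : I 0 = 0 := by simp [hI]
  simp only [hZ0, hZ1, hI0, NormedSpace.exp_zero, mul_one] at hconst
  refine ⟨-I 1, ?_⟩
  rw [Matrix.exp_neg]
  exact Matrix.inv_eq_right_inv hconst

end MatrixLog

/-! ### Sesquilinear forms of infinite matrices and rearrangement of double series -/

section Pairing

variable {ι : Type*}

theorem summable_prod_of_bound {κ : Type*} {f : ι → κ → ℂ} {b : ι → ℝ}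
    (hf : ∀ p, Summable fun q => ‖f p q‖) (hfb : ∀ p, ∑' q, ‖f p q‖ ≤ b p) (hb : Summable b) :
    Summable fun x : ι × κ => f x.1 x.2 :=
  Summable.of_norm ((summable_prod_of_nonneg fun _ => norm_nonneg _).2
    ⟨hf, hb.of_nonneg_of_le (fun _ => tsum_nonneg fun _ => norm_nonneg _) hfb⟩)

theorem norm_mul_le_half_add_sq (a b : ℂ) : ‖a * b‖ ≤ (‖a‖ ^ 2 + ‖b‖ ^ 2) / 2 := by
  rw [norm_mul]; nlinarith [sq_nonneg (‖a‖ - ‖b‖)]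

theorem tsum_norm_mul_le {a b : ι → ℂ} {C E : ℝ} (ha : Summable fun i => ‖a i‖ ^ 2)
    (hb : Summable fun i => ‖b i‖ ^ 2) (haC : ∑' i, ‖a i‖ ^ 2 ≤ C) (hbE : ∑' i, ‖b i‖ ^ 2 ≤ E) :
    ∑' i, ‖a i * b i‖ ≤ (C + E) / 2 := by
  refine ((summable_mul_of_sq ha hb).norm.tsum_le_tsum
    (fun i => norm_mul_le_half_add_sq (a i) (b i)) ((ha.add hb).div_const 2)).trans ?_
  rw [tsum_div_const, ha.tsum_add hb]
  linarith

/-- The sesquilinear form of an infinite matrix. -/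
noncomputable def sesqForm (D : ι → ι → ℂ) (x y : ι → ℂ) : ℂ :=
  ∑' p, conj (x p) * ∑' r, D p r * y r

/-- Uniformly square summable rows. -/
def RowBounded (C : ℝ) (D : ι → ι → ℂ) : Prop :=
  ∀ p, Summable (fun r => ‖D p r‖ ^ 2) ∧ ∑' r, ‖D p r‖ ^ 2 ≤ C

variable {D a K : ι → ι → ℂ} {C : ℝ} {x y g h ν : ι → ℂ}

/-- From `2d ≤ d² + 1`; the bound `C + 1` replaces the sharper `√C`. -/
theorem RowBounded.norm_le (hD : RowBounded C D) (p r : ι) : ‖D p r‖ ≤ C + 1 := by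
  have h1 : ‖D p r‖ ^ 2 ≤ C := ((hD p).1.le_tsum r fun _ _ => sq_nonneg _).trans (hD p).2
  nlinarith [sq_nonneg (‖D p r‖ - 1)]

theorem RowBounded.summable_mul (hD : RowBounded C D) (hy : Summable fun p => ‖y p‖) (p : ι) :
    Summable fun r => ‖D p r * y r‖ :=
  (hy.mul_left (C + 1)).of_nonneg_of_le (fun _ => norm_nonneg _) fun r => by
    rw [norm_mul]; exact mul_le_mul_of_nonneg_right (hD.norm_le p r) (norm_nonneg _)

theorem RowBounded.tsum_mul_le (hD : RowBounded C D) (hy : Summable fun p => ‖y p‖) (p : ι) :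
    ∑' r, ‖D p r * y r‖ ≤ (C + 1) * ∑' r, ‖y r‖ := by
  rw [← tsum_mul_left]
  exact (hD.summable_mul hy p).tsum_le_tsum (fun r => by
    rw [norm_mul]; exact mul_le_mul_of_nonneg_right (hD.norm_le p r) (norm_nonneg _))
    (hy.mul_left (C + 1))

/-- An `ℓ¹` weight on rows with a common `ℓ¹` bound makes the double series absolutely convergent;
this justifies exchanging the sums in the sesquilinear forms. -/
theorem summable_conj_mul_prod {E : ℝ} {F : ι → ι → ℂ} (hF : ∀ p, Summable fun q => ‖F p q‖)
    (hE : ∀ p, ∑' q, ‖F p q‖ ≤ E) (hx : Summable fun p => ‖x p‖) :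
    Summable fun z : ι × ι => conj (x z.1) * F z.1 z.2 := by
  refine summable_prod_of_bound (f := fun p q => conj (x p) * F p q) (b := fun p => ‖x p‖ * E)
    (fun p => ?_) (fun p => ?_) (hx.mul_right E)
  · simpa only [norm_mul, RCLike.norm_conj] using (hF p).mul_left ‖x p‖
  · simp only [norm_mul, RCLike.norm_conj, tsum_mul_left]
    exact mul_le_mul_of_nonneg_left (hE p) (norm_nonneg _)

theorem tsum_conj_mul_tsum {E : ℝ} {F : ι → ι → ℂ} (hF : ∀ p, Summable fun q => ‖F p q‖)
    (hE : ∀ p, ∑' q, ‖F p q‖ ≤ E) (hx : Summable fun p => ‖x p‖) :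
    ∑' p, conj (x p) * ∑' q, F p q = ∑' z : ι × ι, conj (x z.1) * F z.1 z.2 := by
  rw [(summable_conj_mul_prod hF hE hx).tsum_prod]
  simp only [tsum_mul_left]

theorem summable_sesqForm (hD : RowBounded C D) (hx : Summable fun p => ‖x p‖)
    (hy : Summable fun p => ‖y p‖) : Summable fun p => conj (x p) * ∑' r, D p r * y r := by
  have := (summable_conj_mul_prod (F := fun p r => D p r * y r) (hD.summable_mul hy)
    (hD.tsum_mul_le hy) hx).prod
  simpa only [tsum_mul_left] using this

/-- The form of a matrix and the form of its adjoint are conjugate, with the arguments exchanged. -/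
theorem sesqForm_eq_conj_sesqForm {E E' : ℝ} {F G : ι → ι → ℂ}
    (hF : ∀ p, Summable fun q => ‖F p q * y q‖) (hE : ∀ p, ∑' q, ‖F p q * y q‖ ≤ E)
    (hG : ∀ p, Summable fun q => ‖G p q * x q‖) (hE' : ∀ p, ∑' q, ‖G p q * x q‖ ≤ E')
    (hx : Summable fun p => ‖x p‖) (hy : Summable fun p => ‖y p‖)
    (h : ∀ p q, F p q = conj (G q p)) :
    sesqForm F x y = conj (sesqForm G y x) := by
  rw [sesqForm, sesqForm, tsum_conj_mul_tsum (F := fun p r => F p r * y r) hF hE hx,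
    tsum_conj_mul_tsum (F := fun p r => G p r * x r) hG hE' hy, Complex.conj_tsum,
    ← (Equiv.prodComm ι ι).tsum_eq]
  refine tsum_congr fun z => ?_
  simp only [Equiv.prodComm_apply, Prod.fst_swap, Prod.snd_swap, h, map_mul, Complex.conj_conj]
  ring

theorem conj_sesqForm (hD : RowBounded C D) (hH : ∀ p q, D p q = conj (D q p))
    (hx : Summable fun p => ‖x p‖) (hy : Summable fun p => ‖y p‖) :
    conj (sesqForm D y x) = sesqForm D x y :=
  (sesqForm_eq_conj_sesqForm (hD.summable_mul hy) (hD.tsum_mul_le hy) (hD.summable_mul hx)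
    (hD.tsum_mul_le hx) hx hy hH).symm

theorem sesqForm_sum_right {κ : Type*} (s : Finset κ) {w : κ → ι → ℂ} (c : κ → ℂ)
    (hD : RowBounded C D) (hx : Summable fun p => ‖x p‖)
    (hw : ∀ k ∈ s, Summable fun p => ‖w k p‖) :
    sesqForm D x (fun p => ∑ k ∈ s, c k * w k p) = ∑ k ∈ s, c k * sesqForm D x (w k) := by
  have h1 : ∀ p, ∑' r, D p r * ∑ k ∈ s, c k * w k r = ∑ k ∈ s, c k * ∑' r, D p r * w k r :=
    fun p => by
      simp only [Finset.mul_sum, ← tsum_mul_left]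
      rw [Summable.tsum_finsetSum fun k hk => ?_]
      · refine Finset.sum_congr rfl fun k _ => tsum_congr fun r => by ring
      · have := (hD.summable_mul (hw k hk) p).of_norm.mul_left (c k)
        exact this.congr fun r => by ring
  simp only [sesqForm, h1]
  simp only [Finset.mul_sum]
  rw [Summable.tsum_finsetSum fun k hk => ?_]
  · refine Finset.sum_congr rfl fun k _ => ?_
    rw [← tsum_mul_left]
    exact tsum_congr fun p => mul_left_comm _ _ _
  · exact ((summable_sesqForm hD hx (hw k hk)).mul_left (c k)).congr fun p => mul_left_comm _ _ _

/-- The associativity `D (L y) = (D L) y` for `L = a - ν`. -/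
theorem tsum_mul_eq_tsum_mul {α : ℝ} (hD : RowBounded C D)
    (ha : ∀ q, Summable (fun r => ‖a r q‖ ^ 2) ∧ ∑' r, ‖a r q‖ ^ 2 ≤ α)
    (hy : Summable fun p => ‖y p‖) (hνy : Summable fun p => ‖ν p * y p‖ ^ 2)
    (hg : ∀ p, HasSum (fun r => a p r * y r) (g p + ν p * y p)) (p : ι) :
    ∑' r, D p r * g r = ∑' q, (∑' r, D p r * a r q - ν q * D p q) * y q := by
  -- By Cauchy–Schwarz the inner sums are bounded uniformly in `q`, so `y` in `ℓ¹` suffices for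
  -- Fubini. The unbounded diagonal `ν` is split off and uses `νy` in `ℓ²`.
  have h1 : Summable fun z : ι × ι => y z.1 * (D p z.2 * a z.2 z.1) := by
    refine summable_prod_of_bound (f := fun q r => y q * (D p r * a r q))
      (b := fun q => ‖y q‖ * ((C + α) / 2)) (fun q => ?_) (fun q => ?_) (hy.mul_right _)
    · simpa only [norm_mul (y q)] using
        (summable_mul_of_sq (hD p).1 (ha q).1).norm.mul_left ‖y q‖
    · simp only [norm_mul (y q), tsum_mul_left]
      exact mul_le_mul_of_nonneg_left (tsum_norm_mul_le (hD p).1 (ha q).1 (hD p).2 (ha q).2)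
        (norm_nonneg _)
  have h2 : Summable fun r => D p r * (ν r * y r) := summable_mul_of_sq (hD p).1 hνy
  have h3 : Summable fun r => D p r * (g r + ν r * y r) := by
    have := ((Equiv.prodComm ι ι).summable_iff.2 h1).prod
    refine this.congr fun r => ?_
    rw [← (hg r).tsum_eq, ← tsum_mul_left]
    refine tsum_congr fun q => ?_
    simp only [Function.comp, Equiv.prodComm_apply, Prod.swap]
    ring
  have h4 : ∑' r, D p r * (g r + ν r * y r) = ∑' q, y q * ∑' r, D p r * a r q := by
    have := Summable.tsum_comm (f := fun q r => y q * (D p r * a r q)) h1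
    simp only [tsum_mul_left] at this
    rw [← this]
    refine tsum_congr fun r => ?_
    rw [← (hg r).tsum_eq, ← tsum_mul_left]
    exact tsum_congr fun q => by ring
  have h5 : Summable fun q => y q * ∑' r, D p r * a r q := by
    simpa only [tsum_mul_left] using h1.prod
  calc ∑' r, D p r * g r = ∑' r, (D p r * (g r + ν r * y r) - D p r * (ν r * y r)) :=
        tsum_congr fun r => by ring
    _ = ∑' q, y q * ∑' r, D p r * a r q - ∑' r, D p r * (ν r * y r) := by
        rw [h3.tsum_sub h2, h4]
    _ = _ := by
        rw [← h5.tsum_sub h2]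
        exact tsum_congr fun q => by ring

/-- The entries of `D L` may grow with `q` because of `ν q`. Pairing `ν` with `y` instead of `D`
gives a row bound independent of `p`. -/
theorem summable_mul_sub_mul_and_tsum_le {α : ℝ} (hD : RowBounded C D)
    (ha : ∀ q, Summable (fun r => ‖a r q‖ ^ 2) ∧ ∑' r, ‖a r q‖ ^ 2 ≤ α)
    (hy : Summable fun p => ‖y p‖) (hνy : Summable fun p => ‖ν p * y p‖ ^ 2) (p : ι) :
    Summable (fun q => ‖(∑' r, D p r * a r q - ν q * D p q) * y q‖) ∧
      ∑' q, ‖(∑' r, D p r * a r q - ν q * D p q) * y q‖ ≤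
        (C + α) / 2 * ∑' q, ‖y q‖ + (C + ∑' q, ‖ν q * y q‖ ^ 2) / 2 := by
  have h1 := hy.mul_left ((C + α) / 2)
  have h2 : Summable fun r => ‖D p r * (ν r * y r)‖ := (summable_mul_of_sq (hD p).1 hνy).norm
  have h3 : ∀ q, ‖(∑' r, D p r * a r q - ν q * D p q) * y q‖ ≤
      (C + α) / 2 * ‖y q‖ + ‖D p q * (ν q * y q)‖ := fun q => by
    rw [show (∑' r, D p r * a r q - ν q * D p q) * y q =
      (∑' r, D p r * a r q) * y q - D p q * (ν q * y q) by ring]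
    refine (norm_sub_le _ _).trans (add_le_add ?_ le_rfl)
    rw [norm_mul]
    exact mul_le_mul_of_nonneg_right ((norm_tsum_le_tsum_norm
      (summable_mul_of_sq (hD p).1 (ha q).1).norm).trans
      (tsum_norm_mul_le (hD p).1 (ha q).1 (hD p).2 (ha q).2)) (norm_nonneg _)
  have h4 := (h1.add h2).of_nonneg_of_le (fun _ => norm_nonneg _) h3
  refine ⟨h4, (h4.tsum_le_tsum h3 (h1.add h2)).trans ?_⟩
  rw [h1.tsum_add h2, tsum_mul_left]
  exact add_le_add le_rfl (tsum_norm_mul_le (hD p).1 hνy (hD p).2 le_rfl)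

/-- The weak form of the homogeneous Lyapunov equation `D L + L* D = 0`, `L = a - ν`. -/
theorem sesqForm_add_conj_eq_zero {α : ℝ} (hD : RowBounded C D)
    (hH : ∀ p q, D p q = conj (D q p)) (hν : ∀ p, conj (ν p) = -ν p)
    (ha : ∀ q, Summable (fun r => ‖a r q‖ ^ 2) ∧ ∑' r, ‖a r q‖ ^ 2 ≤ α)
    (heq : ∀ p q, ∑' r, D p r * a r q + ∑' r, conj (a r p) * D r q + (ν p - ν q) * D p q = 0)
    (hx : Summable fun p => ‖x p‖) (hνx : Summable fun p => ‖ν p * x p‖ ^ 2)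
    (hh : ∀ p, HasSum (fun r => a p r * x r) (h p + ν p * x p))
    (hy : Summable fun p => ‖y p‖) (hνy : Summable fun p => ‖ν p * y p‖ ^ 2)
    (hg : ∀ p, HasSum (fun r => a p r * y r) (g p + ν p * y p)) :
    sesqForm D x g + conj (sesqForm D y h) = 0 := by
  -- `K = D L`. As `D` is Hermitian, `L* D` is the adjoint of `K`, so the equation says that `K` is
  -- skew-Hermitian.
  set K : ι → ι → ℂ := fun p q => ∑' r, D p r * a r q - ν q * D p q with hK
  have hKc : ∀ p q, K p q = conj (-K q p) := fun p q => by
    have h1 : conj (K q p) = ∑' r, conj (a r p) * D r q + ν p * D p q := by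
      simp only [hK, map_sub, map_mul, Complex.conj_tsum, hν, ← hH p q]
      rw [neg_mul, sub_neg_eq_add]
      congr 1
      exact tsum_congr fun r => by rw [← hH r q, mul_comm]
    rw [map_neg, h1]
    linear_combination heq p q
  have h1 : sesqForm D x g = sesqForm K x y := by
    simp only [sesqForm, tsum_mul_eq_tsum_mul hD ha hy hνy hg, hK]
  have h2 : sesqForm D y h = sesqForm K y x := by
    simp only [sesqForm, tsum_mul_eq_tsum_mul hD ha hx hνx hh, hK]
  have h3 := sesqForm_eq_conj_sesqForm (F := K) (G := fun p q => -K p q) (x := x) (y := y)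
    (fun p => (summable_mul_sub_mul_and_tsum_le hD ha hy hνy p).1)
    (fun p => (summable_mul_sub_mul_and_tsum_le hD ha hy hνy p).2)
    (fun p => by
      simpa only [neg_mul, norm_neg] using (summable_mul_sub_mul_and_tsum_le hD ha hx hνx p).1)
    (fun p => by
      simpa only [neg_mul, norm_neg] using (summable_mul_sub_mul_and_tsum_le hD ha hx hνx p).2)
    hx hy hKc
  have h4 : sesqForm (fun p q => -K p q) y x = -sesqForm K y x := by
    simp only [sesqForm, neg_mul, tsum_neg, mul_neg]
  rw [h1, h2, h3, h4, map_neg, neg_add_cancel]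

/-- A matrix with uniformly square summable columns maps `ℓ¹` to `ℓ²`. -/
theorem summable_sq_tsum_mul (hD : RowBounded C fun p q => D q p) (hy : Summable fun p => ‖y p‖) :
    Summable fun p => ‖∑' q, D p q * y q‖ ^ 2 := by
  -- The columns are bounded vectors in `ℓ²`, so `∑ y_q d_q` converges absolutely there.
  let d : ι → lp (fun _ : ι => ℂ) 2 := fun q => ⟨fun p => D p q, memℓp_two_iff.2 (hD q).1⟩
  have hd : ∀ q, ‖d q‖ ≤ C + 1 := fun q => by
    have h1 := lp.norm_rpow_eq_tsum (p := 2) (by norm_num) (d q)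
    have h2 : ‖d q‖ ^ 2 ≤ C := by
      refine le_trans (le_of_eq ?_) (hD q).2
      simpa [d] using h1
    nlinarith [sq_nonneg (‖d q‖ - 1)]
  have hs : Summable fun q => y q • d q := by
    refine Summable.of_norm ((hy.mul_right (C + 1)).of_nonneg_of_le (fun _ => norm_nonneg _)
      fun q => ?_)
    rw [norm_smul]
    exact mul_le_mul_of_nonneg_left (hd q) (norm_nonneg _)
  have h1 := memℓp_two_iff.1 (lp.memℓp (∑' q, y q • d q))
  refine h1.congr fun p => ?_
  have h2 := ((lp.evalCLM ℂ (fun _ : ι => ℂ) 2 p).hasSum hs.hasSum).tsum_eq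
  congr 2
  refine (Eq.trans ?_ h2).symm
  exact tsum_congr fun q => by simp [d, lp.evalCLM, mul_comm]

end Pairing

/-! ### Floquet factorization and the Sylvester equation -/

section Floquet

variable {n : ℕ} {T : ℝ}

theorem isUnit_det_exp (X : Matrix (Fin n) (Fin n) ℂ) : IsUnit (NormedSpace.exp X).det :=
  (Matrix.isUnit_iff_isUnit_det _).1 (Matrix.isUnit_exp X)

attribute [local instance] Matrix.linftyOpNormedRing Matrix.linftyOpNormedAlgebra

/-- The intertwining passes to every power, hence to the exponential series. -/
theorem semiconjBy_exp {D X S : Matrix (Fin n) (Fin n) ℂ} (h : SemiconjBy D X S) :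
    SemiconjBy D (NormedSpace.exp X) (NormedSpace.exp S) := by
  have h1 := (NormedSpace.exp_series_hasSum_exp' (𝕂 := ℂ) X).mul_left D
  have h2 := (NormedSpace.exp_series_hasSum_exp' (𝕂 := ℂ) S).mul_right D
  refine h1.unique (h2.congr_fun fun k => ?_)
  rw [mul_smul_comm, smul_mul_assoc, (h.pow_right k).eq]

theorem matrix_exp_smul_one {c : ℂ} (hc : Complex.exp c = 1) :
    NormedSpace.exp (c • (1 : Matrix (Fin n) (Fin n) ℂ)) = 1 := by
  have h := NormedSpace.algebraMap_exp_comm (𝕂 := ℂ) (𝔸 := Matrix (Fin n) (Fin n) ℂ) c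
  rw [← Complex.exp_eq_exp_ℂ, hc, map_one, Algebra.algebraMap_eq_smul_one] at h
  exact h.symm

/-- A Sylvester equation whose exponentiated form is a Stein equation with stable data. -/
theorem eq_zero_of_sylvester {D R : Matrix (Fin n) (Fin n) ℂ} {c : ℂ}
    (hc : Complex.exp (T * c) = 1)
    (hG : Filter.Tendsto (fun k : ℕ => NormedSpace.exp (T • R) ^ k) Filter.atTop (nhds 0))
    (h : D * R + Rᴴ * D + c • D = 0) : D = 0 := by
  -- The equation reads `D (TR + Tc) = -(TR)* D`. Exponentiation removes `c`, since `exp (Tc) = 1`,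
  -- and gives `DG = (G*)⁻¹D`, that is `D = G*DG`.
  have hs : SemiconjBy D (T • R + ((T : ℂ) * c) • (1 : Matrix (Fin n) (Fin n) ℂ)) (-(T • R)ᴴ) := by
    have h1 : T • (D * R + Rᴴ * D + c • D) = 0 := by rw [h, smul_zero]
    rw [SemiconjBy, mul_add, mul_smul_comm, mul_smul_comm, mul_one, Matrix.conjTranspose_smul,
      star_trivial, neg_mul, smul_mul_assoc, mul_smul, Complex.coe_smul]
    rw [smul_add, smul_add] at h1
    rw [eq_neg_iff_add_eq_zero, ← h1]
    abel
  have h2 := semiconjBy_exp hs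
  rw [Matrix.exp_add_of_commute _ _ ((Commute.one_right _).smul_right _), matrix_exp_smul_one hc,
    mul_one, Matrix.exp_neg, Matrix.exp_conjTranspose, SemiconjBy] at h2
  set G := NormedSpace.exp (T • R) with hGdef
  have hu : IsUnit Gᴴ.det := by
    rw [Matrix.det_conjTranspose]
    exact (isUnit_det_exp (T • R)).star
  refine stein_injective (N := Gᴴ) hG ?_ ?_
  · have h3 := (hG.star : Filter.Tendsto (fun k => star (G ^ k)) _ _)
    simpa only [star_pow, star_zero, Matrix.star_eq_conjTranspose] using h3
  · rw [Matrix.mul_assoc, h2, ← Matrix.mul_assoc, Matrix.mul_nonsing_inv _ hu, Matrix.one_mul]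

variable {A Φ Ψ : ℝ → Matrix (Fin n) (Fin n) ℝ}

theorem isPrimitiveOn_exp_smul {a b : ℝ} (hab : a ≤ b) (X : Matrix (Fin n) (Fin n) ℂ)
    (i j : Fin n) :
    IsPrimitiveOn a b (fun t : ℝ => NormedSpace.exp (t • X) i j)
      (fun t => (NormedSpace.exp (t • X) * X) i j) := by
  have h1 : ∀ t : ℝ, HasDerivAt (fun t : ℝ => NormedSpace.exp (t • X))
      (NormedSpace.exp (t • X) * X) t := fun t => hasDerivAt_exp_smul_const X t
  have hc : Continuous fun t : ℝ => NormedSpace.exp (t • X) :=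
    continuous_iff_continuousAt.2 fun t => (h1 t).continuousAt
  refine .of_hasDerivAt hab (fun t => ?_) ((hc.mul continuous_const).matrix_elem i j)
  exact ((Matrix.entryLinearMap ℝ ℂ i j).toContinuousLinearMap.hasFDerivAt
    (x := NormedSpace.exp (t • X))).comp_hasDerivAt t (h1 t)

/-- The Floquet factorization of a fundamental matrix. -/
theorem IsFundamental.exists_floquet (hΦ : IsFundamental A 0 Φ Ψ) (hT : 0 < T) :
    ∃ (R : Matrix (Fin n) (Fin n) ℂ) (Y : ℝ → Matrix (Fin n) (Fin n) ℂ),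
      (∀ i j, IsPrimitiveOn 0 T (fun t => Y t i j)
        (fun t => (complexify A t * Y t - Y t * R) i j)) ∧
      Y T = Y 0 ∧ (∀ t ∈ Set.Icc 0 T, IsUnit (Y t)) ∧
      NormedSpace.exp (T • R) = complexify Φ T := by
  have hunit : ∀ t, 0 ≤ t → IsUnit (complexify Φ t) := fun t ht =>
    ((Matrix.isUnit_iff_isUnit_det _).2 (Matrix.isUnit_det_of_left_inverse
      (hΦ.inv_mul ht))).map (Complex.ofRealHom.mapMatrix)
  obtain ⟨R₀, hR₀⟩ := exists_matrix_exp_eq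
    ((Matrix.isUnit_iff_isUnit_det _).1 (hunit T hT.le)).ne_zero
  set R := T⁻¹ • R₀ with hR
  have hTR : T • R = R₀ := by rw [hR, smul_smul, mul_inv_cancel₀ hT.ne', one_smul]
  -- `Y = Φ exp(-tR)` equals `1` at both ends of the period, because `exp(TR) = Φ(T)`.
  refine ⟨R, fun t => complexify Φ t * NormedSpace.exp (t • -R), fun i j => ?_, ?_, fun t ht => ?_,
    hTR ▸ hR₀⟩
  · have h1 : ∀ i j, IsPrimitiveOn 0 T (fun t => complexify Φ t i j)
        (fun t => (complexify A t * complexify Φ t) i j) := fun i j => by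
      have := (hΦ.deriv T hT.le i j).ofReal
      refine this.congr_deriv (Filter.Eventually.of_forall fun t _ => ?_)
      simp [complexify, Matrix.mul_apply]
    refine (isPrimitiveOn_mul_matrix hT.le h1 (isPrimitiveOn_exp_smul hT.le (-R)) i
      j).congr_deriv (Filter.Eventually.of_forall fun t _ => ?_)
    rw [Matrix.mul_neg, Matrix.mul_neg, ← sub_eq_add_neg, Matrix.mul_assoc, Matrix.mul_assoc]
  · simp only [smul_neg, hTR, zero_smul, neg_zero, NormedSpace.exp_zero, mul_one]
    rw [← hR₀, Matrix.exp_neg, Matrix.mul_nonsing_inv _ (isUnit_det_exp R₀)]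
    ext i j
    simp [complexify, hΦ.init, Matrix.one_apply, apply_ite Complex.ofReal]
  · exact (hunit t ht.1).mul ((Matrix.isUnit_iff_isUnit_det _).2 (isUnit_det_exp _))

end Floquet

/-! ### Fourier coefficients of the periodic Floquet factor -/

section PeriodicFactor

variable {n : ℕ} {T : ℝ} {A : ℝ → Matrix (Fin n) (Fin n) ℝ} {R : Matrix (Fin n) (Fin n) ℂ}
  {Y : ℝ → Matrix (Fin n) (Fin n) ℂ}

/-- Split `c k` as `(ω k c k) · (ω k)⁻¹` for `k ≠ 0`; both factors are square summable. -/
theorem summable_norm_of_summable_sq_mul {c : ℤ → ℂ} {ω : ℂ} (hω : ω ≠ 0)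
    (h : Summable fun k : ℤ => ‖ω * k * c k‖ ^ 2) : Summable fun k => ‖c k‖ := by
  have h1 : Summable fun k : ℤ => ‖ω‖⁻¹ ^ 2 * (1 / (k : ℝ) ^ 2) :=
    (Real.summable_one_div_int_pow.2 (by norm_num)).mul_left _
  refine Summable.of_norm_bounded_eventually (h.add h1) ?_
  refine (Set.finite_singleton (0 : ℤ)).subset fun k hk => ?_
  by_contra hk0
  refine hk ?_
  have hk0' : (k : ℝ) ≠ 0 := by exact_mod_cast hk0
  have hω' : ‖ω‖ ≠ 0 := norm_ne_zero_iff.2 hω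
  have h2 : ‖c k‖ = ‖ω * k * c k‖ * (‖ω‖⁻¹ * |(k : ℝ)|⁻¹) := by
    rw [norm_mul, norm_mul, Complex.norm_intCast]
    have := abs_ne_zero.2 hk0'
    field_simp
  have h3 : ‖ω‖⁻¹ ^ 2 * (1 / (k : ℝ) ^ 2) = (‖ω‖⁻¹ * |(k : ℝ)|⁻¹) ^ 2 := by
    rw [mul_pow, inv_pow |(k : ℝ)|, sq_abs, one_div]
  simp only [Set.mem_ofPred_eq, norm_norm]
  rw [h3]
  refine h2.le.trans ?_
  nlinarith [sq_nonneg (‖ω * k * c k‖ - ‖ω‖⁻¹ * |(k : ℝ)|⁻¹),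
    sq_nonneg (‖ω * k * c k‖), sq_nonneg (‖ω‖⁻¹ * |(k : ℝ)|⁻¹)]

theorem summable_add_sq {ι : Type*} {a b : ι → ℂ} (ha : Summable fun i => ‖a i‖ ^ 2)
    (hb : Summable fun i => ‖b i‖ ^ 2) : Summable fun i => ‖a i + b i‖ ^ 2 :=
  ((ha.mul_left 2).add (hb.mul_left 2)).of_nonneg_of_le (fun _ => sq_nonneg _) fun i => by
    nlinarith [norm_add_le (a i) (b i), norm_nonneg (a i + b i), sq_nonneg (‖a i‖ - ‖b i‖)]

/-- The frequency `i ω k`. -/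
noncomputable def freq (T : ℝ) (k : ℤ) : ℂ := Complex.I * (2 * Real.pi / T : ℂ) * k

theorem conj_freq (k : ℤ) : conj (freq T k) = -freq T k := by
  simp only [freq, map_mul, Complex.conj_I, map_div₀, Complex.conj_ofReal, map_ofNat, map_intCast]
  ring

/-- The derivative of the periodic Floquet factor. -/
noncomputable def floquetDeriv (A : ℝ → Matrix (Fin n) (Fin n) ℝ) (R : Matrix (Fin n) (Fin n) ℂ)
    (Y : ℝ → Matrix (Fin n) (Fin n) ℂ) (t : ℝ) : Matrix (Fin n) (Fin n) ℂ :=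
  complexify A t * Y t - Y t * R

theorem toeplitzC_floquetDeriv (hT : 0 < T)
    (hY : ∀ i j, IsPrimitiveOn 0 T (fun t => Y t i j) (fun t => floquetDeriv A R Y t i j))
    (hYT : Y T = Y 0) (p q : ℤ × Fin n) :
    toeplitzC T (floquetDeriv A R Y) p q = freq T (p.1 - q.1) * toeplitzC T Y p q :=
  fourierC_deriv (hY p.2 q.2) hT (by rw [hYT]) (p.1 - q.1)

theorem sqIntegrableMatrix_floquet
    (hY : ∀ i j, IsPrimitiveOn 0 T (fun t => Y t i j) (fun t => floquetDeriv A R Y t i j)) :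
    SqIntegrableMatrix T Y := fun i j => sqIntegrable_of_continuousOn (hY i j).continuousOn

theorem sqIntegrableMatrix_floquetDeriv (hA : SqIntegrableMatrix T (complexify A))
    (hY : ∀ i j, IsPrimitiveOn 0 T (fun t => Y t i j) (fun t => floquetDeriv A R Y t i j)) :
    SqIntegrableMatrix T (floquetDeriv A R Y) := fun i j => by
  simp only [floquetDeriv, Matrix.sub_apply, Matrix.mul_apply]
  refine MemLp.sub (memLp_finsetSum _ fun l _ => ?_) (memLp_finsetSum _ fun l _ => ?_)
  · simpa only [mul_comm] using (hA i l).mul_continuousOn (hY l j).continuousOn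
  · simpa only [mul_comm] using (sqIntegrableMatrix_floquet hY i l).const_mul (R l j)

/-- The derivative `AY - YR` is square integrable because `A` is and `Y` is continuous, so the
coefficients of `Y` are absolutely summable. -/
theorem summable_norm_toeplitzC_floquet (hT : 0 < T) (hA : SqIntegrableMatrix T (complexify A))
    (hY : ∀ i j, IsPrimitiveOn 0 T (fun t => Y t i j) (fun t => floquetDeriv A R Y t i j))
    (hYT : Y T = Y 0) (q : ℤ × Fin n) : Summable fun p => ‖toeplitzC T Y p q‖ := by
  have hω : Complex.I * (2 * Real.pi / T : ℂ) ≠ 0 :=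
    mul_ne_zero Complex.I_ne_zero (div_ne_zero (mul_ne_zero two_ne_zero
      (by exact_mod_cast Real.pi_ne_zero)) (by exact_mod_cast hT.ne'))
  have h1 : ∀ i, Summable fun k => ‖fourierC T (fun t => Y t i q.2) k‖ := fun i =>
    summable_norm_of_summable_sq_mul hω
      ((summable_norm_fourierC_sq hT (sqIntegrableMatrix_floquetDeriv hA hY i q.2)).congr fun k => by
        rw [fourierC_deriv (hY i q.2) hT (by rw [hYT]) k])
  refine summable_prod_fin (f := fun p => ‖toeplitzC T Y p q‖) fun i => ?_
  have h2 := (Equiv.subRight q.1).summable_iff.2 (h1 i)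
  exact h2

/-- Split the frequency of `p` into that of `p - q`, which produces the coefficients of `Y'`, and
that of `q`, which is constant along the column. -/
theorem summable_freq_mul_toeplitzC (hT : 0 < T) (hA : SqIntegrableMatrix T (complexify A))
    (hY : ∀ i j, IsPrimitiveOn 0 T (fun t => Y t i j) (fun t => floquetDeriv A R Y t i j))
    (hYT : Y T = Y 0) (q : ℤ × Fin n) :
    Summable fun p : ℤ × Fin n => ‖freq T p.1 * toeplitzC T Y p q‖ ^ 2 := by
  have h1 := summable_toeplitzC_col hT (sqIntegrableMatrix_floquetDeriv hA hY) q
  have h2 : Summable fun p => ‖freq T q.1 * toeplitzC T Y p q‖ ^ 2 := by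
    simpa only [norm_mul, mul_pow] using
      (summable_toeplitzC_col hT (sqIntegrableMatrix_floquet hY) q).mul_left (‖freq T q.1‖ ^ 2)
  refine (summable_add_sq h1 h2).congr fun p => ?_
  rw [toeplitzC_floquetDeriv hT hY hYT, ← add_mul]
  congr 3
  simp only [freq]
  push_cast
  ring

/-- The block Toeplitz matrix of the periodic Floquet factor intertwines `𝒜 - N` with
`diag(R - i ω k)`. -/
theorem hasSum_toeplitzC_floquet (hT : 0 < T) (hA : SqIntegrableMatrix T (complexify A))
    (hY : ∀ i j, IsPrimitiveOn 0 T (fun t => Y t i j) (fun t => floquetDeriv A R Y t i j))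
    (hYT : Y T = Y 0) (p q : ℤ × Fin n) :
    HasSum (fun r => blockToeplitz T A p r * toeplitzC T Y r q)
      (∑ j, (R - freq T q.1 • 1) j q.2 * toeplitzC T Y p (q.1, j)
        + freq T p.1 * toeplitzC T Y p q) := by
  have hYs := sqIntegrableMatrix_floquet hY
  have h := hasSum_toeplitzC_mul hT hA hYs p q
  -- This is `AY = Y' + YR`. The factor `iω(k - l)` from `Y'` is then divided between `N` on the
  -- left and `R - iωl` on the right.
  have h1 : toeplitzC T (fun t => complexify A t * Y t) p q =
      toeplitzC T (floquetDeriv A R Y) p q + ∑ j, R j q.2 * toeplitzC T Y p (q.1, j) := by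
    have h2 : ∀ l, IntervalIntegrable (fun t => R l q.2 * Y t p.2 l) volume 0 T := fun l =>
      ((hYs p.2 l).intervalIntegrable hT).const_mul _
    have h3 := fourierC_add (T := T) (f := fun t => floquetDeriv A R Y t p.2 q.2)
      (g := fun t => ∑ l, R l q.2 * Y t p.2 l) (hY p.2 q.2).integrable
      (intervalIntegrable_fun_sum fun l _ => h2 l) (p.1 - q.1)
    rw [fourierC_sum _ fun l _ => h2 l] at h3
    simp only [fourierC_const_mul] at h3
    refine Eq.trans ?_ h3
    simp only [toeplitzC, Matrix.of_apply]
    congr 1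
    funext t
    simp only [floquetDeriv, Matrix.sub_apply, Matrix.mul_apply (M := Y t), mul_comm (R _ _)]
    ring
  have h4 : ∑ j, (R - freq T q.1 • 1) j q.2 * toeplitzC T Y p (q.1, j) =
      ∑ j, R j q.2 * toeplitzC T Y p (q.1, j) - freq T q.1 * toeplitzC T Y p q := by
    simp [sub_mul, Finset.sum_sub_distrib, Matrix.one_apply]
  have h5 : freq T (p.1 - q.1) = freq T p.1 - freq T q.1 := by
    simp only [freq]; push_cast; ring
  rw [h1, toeplitzC_floquetDeriv hT hY hYT, h5] at h
  rw [h4, blockToeplitz_eq]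
  convert h using 1
  ring

/-- The adjoint of the block Toeplitz matrix of a continuous, pointwise invertible function is
injective. -/
theorem eq_zero_of_conj_toeplitzC (hT : 0 < T)
    (hYc : ∀ i j, ContinuousOn (fun t => Y t i j) (Set.Icc 0 T))
    (hYu : ∀ t ∈ Set.Icc 0 T, IsUnit (Y t)) {u : ℤ × Fin n → ℂ}
    (hu : Summable fun p => ‖u p‖ ^ 2)
    (h : ∀ a, ∑' p, conj (toeplitzC T Y p a) * u p = 0) : u = 0 := by
  obtain ⟨U, hU, rfl⟩ := exists_fourierVec_eq hT hu
  have hYs : SqIntegrableMatrix T Y := fun i j => sqIntegrable_of_continuousOn (hYc i j)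
  have h1 : ∀ a, fourierVec T (fun t => (Y t)ᴴ *ᵥ U t) a = 0 := fun a => by
    rw [← (hasSum_toeplitzC_mulVec hT hYs.conjTranspose hU a).tsum_eq, ← h a]
    simp only [conj_toeplitzC]
  have h2 : ∀ j, SqIntegrable T fun t => ((Y t)ᴴ *ᵥ U t) j := fun j => by
    simp only [Matrix.mulVec, dotProduct, Matrix.conjTranspose_apply]
    exact memLp_finsetSum _ fun i _ => (hU i).mul_continuousOn (hYc i j).star
  have h3 : ∀ᵐ t, ∀ j, t ∈ Set.Ioc 0 T → ((Y t)ᴴ *ᵥ U t) j = 0 :=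
    ae_all_iff.2 fun j => ae_eq_zero_of_fourierC hT (h2 j) fun k => h1 (k, j)
  funext p
  have h4 : ∀ᵐ t, t ∈ Set.Ioc 0 T → U t p.2 = 0 := by
    filter_upwards [h3] with t ht htT
    have h5 : (Y t)ᴴ *ᵥ U t = 0 := funext fun j => ht j htT
    have h6 : IsUnit (Y t)ᴴ := (hYu t (Set.Ioc_subset_Icc_self htT)).star
    have h7 := Matrix.mulVec_injective_of_isUnit h6 (h5.trans (Matrix.mulVec_zero _).symm)
    rw [h7, Pi.zero_apply]
  have h8 := fourierC_congr hT h4 p.1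
  refine h8.trans ?_
  simp [fourierC]

end PeriodicFactor

/-! ### Uniqueness of the solution for stable systems -/

section Uniqueness

variable {n : ℕ} {T : ℝ} {A Q : ℝ → Matrix (Fin n) (Fin n) ℝ} {P₁ P₂ : BlockMatrix n}

theorem exp_mul_freq (hT : 0 < T) (k : ℤ) : Complex.exp (T * freq T k) = 1 := by
  rw [← wave_period hT k, wave, freq]
  congr 1
  ring

/-- The homogeneous harmonic Lyapunov equation of a stable system has no nonzero Hermitian
solution with uniformly square summable rows. -/
theorem eq_zero_of_homogeneous (hT : 0 < T) (hA : SqIntegrableMatrix T (complexify A))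
    {R : Matrix (Fin n) (Fin n) ℂ} {Y : ℝ → Matrix (Fin n) (Fin n) ℂ}
    (hY : ∀ i j, IsPrimitiveOn 0 T (fun t => Y t i j) (fun t => floquetDeriv A R Y t i j))
    (hYT : Y T = Y 0) (hYu : ∀ t ∈ Set.Icc 0 T, IsUnit (Y t))
    (hG : Filter.Tendsto (fun k : ℕ => NormedSpace.exp (T • R) ^ k) Filter.atTop (nhds 0))
    {C : ℝ} {D : BlockMatrix n} (hD : RowBounded C D) (hH : ∀ p q, D p q = conj (D q p))
    (heq : ∀ p q, ∑' r, D p r * blockToeplitz T A r q + ∑' r, conj (blockToeplitz T A r p) * D r q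
      + (freq T p.1 - freq T q.1) * D p q = 0) : D = 0 := by
  have hl := summable_norm_toeplitzC_floquet hT hA hY hYT
  have hw := summable_freq_mul_toeplitzC hT hA hY hYT
  have hs := hasSum_toeplitzC_floquet hT hA hY hYT
  have hYc : ∀ i j, ContinuousOn (fun t => Y t i j) (Set.Icc 0 T) := fun i j =>
    (hY i j).continuousOn
  obtain ⟨α, hα⟩ := isAdmissible_toeplitzC hT hA
  -- `B a b` is the form of `D` on columns `a` and `b` of the Toeplitz matrix of `Y`. Those columns
  -- span a space on which `𝒜 - N` acts block by block through `R - iωl`.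
  set B : ℤ × Fin n → ℤ × Fin n → ℂ := fun a b =>
    sesqForm D (fun p => toeplitzC T Y p a) (fun p => toeplitzC T Y p b) with hB
  have hBc : ∀ a b, conj (B b a) = B a b := fun a b => conj_sesqForm hD hH (hl a) (hl b)
  have hBeq : ∀ a b : ℤ × Fin n, ∑ j, (R - freq T b.1 • 1) j b.2 * B a (b.1, j)
      + ∑ i, conj ((R - freq T a.1 • 1) i a.2) * B (a.1, i) b = 0 := fun a b => by
    have h1 := sesqForm_add_conj_eq_zero (a := blockToeplitz T A) (ν := fun p => freq T p.1)
      hD hH (fun p => conj_freq p.1) hα heq (hl a) (hw a) (fun p => hs p a) (hl b) (hw b)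
      (fun p => hs p b)
    rw [sesqForm_sum_right Finset.univ _ hD (hl a) fun j _ => hl (b.1, j),
      sesqForm_sum_right Finset.univ _ hD (hl b) fun j _ => hl (a.1, j), map_sum] at h1
    rw [← h1]
    congr 1
    refine Finset.sum_congr rfl fun i _ => ?_
    rw [map_mul, ← hBc (a.1, i) b]
  have hB0 : ∀ a b, B a b = 0 := fun a b => by
    set E : Matrix (Fin n) (Fin n) ℂ := Matrix.of fun i j => B (a.1, i) (b.1, j) with hE
    have h1 : E * (R - freq T b.1 • 1) + (R - freq T a.1 • 1)ᴴ * E = 0 := by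
      ext i j
      rw [Matrix.zero_apply, ← hBeq (a.1, i) (b.1, j), Matrix.add_apply, Matrix.mul_apply,
        Matrix.mul_apply]
      congr 1
      exact Finset.sum_congr rfl fun k _ => mul_comm _ _
    have h2 : E = 0 := by
      refine eq_zero_of_sylvester (T := T) (R := R) (c := freq T (a.1 - b.1))
        (exp_mul_freq hT _) hG ?_
      rw [← h1, Matrix.conjTranspose_sub, Matrix.conjTranspose_smul, Matrix.conjTranspose_one,
        mul_sub, sub_mul, mul_smul_comm, smul_mul_assoc, mul_one, one_mul, ← starRingEnd_apply,
        conj_freq, show freq T (a.1 - b.1) = freq T a.1 - freq T b.1 by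
          simp only [freq]; push_cast; ring, sub_smul, neg_smul]
      abel
    have h3 := congrFun (congrFun h2 a.2) b.2
    exact h3
  have hDcol : RowBounded C fun p q => D q p := fun p => by
    have : ∀ q, ‖D q p‖ = ‖D p q‖ := fun q => by rw [hH p q, RCLike.norm_conj]
    simpa only [this] using hD p
  -- `B = 0` says that the `ℓ²` vector `D y_b` is orthogonal to every column of `𝒯(Y)`, hence zero.
  -- Each conjugated row of `D` is then orthogonal to all those columns too, so the same injectivity
  -- applies again.
  have hDy : ∀ b, (fun p => ∑' r, D p r * toeplitzC T Y r b) = 0 := fun b =>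
    eq_zero_of_conj_toeplitzC hT hYc hYu (summable_sq_tsum_mul hDcol (hl b)) fun a => hB0 a b
  ext p q
  have h1 := eq_zero_of_conj_toeplitzC hT hYc hYu (u := fun r => conj (D p r))
    (by simpa only [RCLike.norm_conj] using (hD p).1) fun b => by
      have h2 := congrArg conj (congrFun (hDy b) p)
      rw [Complex.conj_tsum, Pi.zero_apply, map_zero] at h2
      rw [← h2]
      exact tsum_congr fun r => by rw [map_mul, mul_comm]
  have h2 := congrFun h1 q
  simpa using h2

theorem exists_rowBounded_sub (h₁ : IsAdmissible P₁) (h₂ : IsAdmissible P₂)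
    (hH₁ : P₁.IsHermitian) (hH₂ : P₂.IsHermitian) : ∃ C, RowBounded C (P₁ - P₂) := by
  obtain ⟨C₁, hC₁⟩ := id h₁
  obtain ⟨C₂, hC₂⟩ := id h₂
  refine ⟨2 * C₁ + 2 * C₂, fun p => ?_⟩
  have h1 := ((hC₁ p).1.mul_left 2).add ((hC₂ p).1.mul_left 2)
  have h2 : ∀ r, ‖(P₁ - P₂) p r‖ ^ 2 ≤ 2 * ‖P₁ r p‖ ^ 2 + 2 * ‖P₂ r p‖ ^ 2 := fun r => by
    rw [Matrix.sub_apply, ← norm_apply_comm hH₁ p r, ← norm_apply_comm hH₂ p r]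
    nlinarith [norm_sub_le (P₁ p r) (P₂ p r), norm_nonneg (P₁ p r - P₂ p r),
      sq_nonneg (‖P₁ p r‖ - ‖P₂ p r‖)]
  have h3 := h1.of_nonneg_of_le (fun _ => sq_nonneg _) h2
  refine ⟨h3, (h3.tsum_le_tsum h2 h1).trans ?_⟩
  rw [((hC₁ p).1.mul_left 2).tsum_add ((hC₂ p).1.mul_left 2), tsum_mul_left, tsum_mul_left]
  linarith [(hC₁ p).2, (hC₂ p).2]

/-- The harmonic Lyapunov equation of a stable system has at most one Hermitian solution. -/
theorem eq_of_solves (hT : 0 < T) (hAper : Function.Periodic A T)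
    (hA : ∀ i j, MemLp (fun t => A t i j) 2 (volume.restrict (Set.Icc 0 T)))
    (hstab : GloballyAsymptoticallyStable A)
    (h₁ : IsAdmissible P₁) (hH₁ : P₁.IsHermitian) (hS₁ : SolvesHarmonicLyapunov T A Q P₁)
    (h₂ : IsAdmissible P₂) (hH₂ : P₂.IsHermitian) (hS₂ : SolvesHarmonicLyapunov T A Q P₂) :
    P₁ = P₂ := by
  have hAc := sqIntegrableMatrix_complexify hA
  obtain ⟨Φ, Ψ, hΦ, -⟩ := exists_isFundamental (locIntegrable_of_periodic hT hAper fun i j =>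
    intervalIntegrable_of_memLp_Icc hT (hA i j)) 0
  obtain ⟨R, Y, hY, hYT, hYu, hR⟩ := hΦ.exists_floquet hT
  have hG : Filter.Tendsto (fun k : ℕ => NormedSpace.exp (T • R) ^ k) Filter.atTop (nhds 0) := by
    have h1 := (hΦ.tendsto_pow hT hAper hstab)
    have h2 : Continuous fun M : Matrix (Fin n) (Fin n) ℝ => M.map Complex.ofReal :=
      continuous_id.matrix_map Complex.continuous_ofReal
    have h3 := (h2.tendsto 0).comp h1
    rw [Matrix.map_zero _ Complex.ofReal_zero] at h3
    refine h3.congr fun k => ?_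
    rw [hR]
    exact map_pow Complex.ofRealHom.mapMatrix (Φ T) k
  obtain ⟨C, hC⟩ := exists_rowBounded_sub h₁ h₂ hH₁ hH₂
  rw [← sub_eq_zero]
  refine eq_zero_of_homogeneous hT hAc hY hYT hYu hG hC
    (fun p q => ((hH₁.sub hH₂).apply p q).symm) fun p q => ?_
  have e₁ := (solves_iff hT hAc h₁ hH₁).1 hS₁ p q
  have e₂ := (solves_iff hT hAc h₂ hH₂).1 hS₂ p q
  have hrow : ∀ {P : BlockMatrix n}, IsAdmissible P → P.IsHermitian →
      Summable fun r => P p r * blockToeplitz T A r q := fun hP hH =>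
    summable_mul_of_sq (hP.summable_row hH p) (summable_toeplitzC_col hT hAc q)
  have hcol : ∀ {P : BlockMatrix n}, IsAdmissible P →
      Summable fun r => conj (blockToeplitz T A r p) * P r q := fun hP =>
    summable_mul_of_sq (a := fun r => conj (blockToeplitz T A r p))
      (by simp only [RCLike.norm_conj]; exact summable_toeplitzC_col hT hAc p) (hP.summable_col q)
  simp only [Matrix.sub_apply, sub_mul, mul_sub]
  rw [(hrow h₁ hH₁).tsum_sub (hrow h₂ hH₂), (hcol h₁).tsum_sub (hcol h₂)]
  simp only [freq]
  linear_combination e₁ - e₂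

end Uniqueness

end HarmonicLyapunov

theorem mainTheorem8 {n : ℕ} (T : ℝ) (hT : 0 < T)
    (A : ℝ → Matrix (Fin n) (Fin n) ℝ) (hAper : Function.Periodic A T)
    (hA : ∀ i j, MemLp (fun t => A t i j) 2 (volume.restrict (Set.Icc 0 T))) :
    HarmonicLyapunov.GloballyAsymptoticallyStable A ↔
      ∀ Q : ℝ → Matrix (Fin n) (Fin n) ℝ, Function.Periodic Q T →
        (∀ i j, MemLp (fun t => Q t i j) ⊤ (volume.restrict (Set.Icc 0 T))) →
        (∀ᵐ t, (Q t).PosDef) →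
        ∃! P : HarmonicLyapunov.BlockMatrix n,
          HarmonicLyapunov.IsAdmissible P ∧ P.IsHermitian ∧ HarmonicLyapunov.IsPosDef P ∧
            HarmonicLyapunov.SolvesHarmonicLyapunov T A Q P := by
  refine ⟨fun hstab Q _ hQ hQpos => ?_, fun h => ?_⟩
  · have hQi : ∀ i j, IntervalIntegrable (fun t => Q t i j) volume 0 T := fun i j =>
      (intervalIntegrable_iff_integrableOn_Icc_of_le hT.le).2 ((hQ i j).integrable le_top)
    obtain ⟨P, hP, hPT, hsymm, hpos⟩ := HarmonicLyapunov.exists_periodic_lyapunov hT hAper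
      (HarmonicLyapunov.locIntegrable_of_periodic hT hAper fun i j =>
        HarmonicLyapunov.intervalIntegrable_of_memLp_Icc hT (hA i j)) hstab hQi hQpos
    have hsol := HarmonicLyapunov.toeplitzC_isSolution hT
      (HarmonicLyapunov.sqIntegrableMatrix_complexify hA) hQi hP hPT hsymm hpos
    exact ⟨_, hsol, fun P' h' => HarmonicLyapunov.eq_of_solves hT hAper hA hstab h'.1 h'.2.1
      h'.2.2.2 hsol.1 hsol.2.1 hsol.2.2.2⟩
  -- The single right-hand side `Q = 1` already forces stability.
  · exact HarmonicLyapunov.globallyAsymptoticallyStable_of_existsUnique hT hAper hA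
      (h (fun _ => 1) (fun _ => rfl) (fun _ _ => memLp_const _)
        (Filter.Eventually.of_forall fun _ => Matrix.PosDef.one))
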